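/- Let $G$ be a finite group and $\mathscr{O}_G$ its orbit category (objects $G/H$ for $H\le G$, morphisms the $G$-maps). A diagram of DGAs is a covariant functor from $\mathscr{O}_G$ to commutative, non-negatively graded differential graded $\mathbb{Q}$-algebras; a system of vector spaces is a covariant functor from $\mathscr{O}_G$ to $\mathbb{Q}$-vector spaces. For a diagram of DGAs $\mathscr{N}$ and a system of vector spaces $\underline V$, let $H^{k}(\mathscr{N};\underline V)$ be the $k$-th cohomology of the cochain complex $\mathrm{Hom}(\underline V,\mathscr{N}^*)$ of natural transformations. Elementary extensions. Let $\underline V$ be placed in degree $n$ and let $\gamma\in H^{n+1}(\mathscr{N};\underline V)$ be represented by $\alpha:\underline V\to \underline Z^{n+1}(\mathscr{N})$. Let $0\to\underline V\to \underline V_0\xrightarrow{w_0}\underline V_1\xrightarrow{w_1}\cdots$ be a minimal injective resolution, and let $\alpha_i:\underline V_i\to\mathscr{N}^{n+1+i}$ satisfy $\alpha_0|_{\underline V}=\alpha$ and $\alpha_{i+1}w_i=d\alpha_i$. The elementary extension $\mathscr{N}_\gamma(\underline V)$ is the diagram of DGAs $\mathscr{N}\otimes\bigotimes_i\mathbb{Q}(\underline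 V_i)$, where $\mathbb{Q}(\underline V_i)$ is the free graded commutative algebra on $\underline V_i$ in degree $n+i$, with differential $d_\gamma$ equal to $d$ on $\mathscr{N}$ and to $(-1)^i\alpha_i+w_i$ on $\underline V_i$. A minimal system has stages $\mathscr{M}_0=\mathscr{M}_1=\mathbb{Q}$ (the constant diagram) and, for $k\ge 2$, $\mathscr{M}_k$ an elementary extension of $\mathscr{M}_{k-1}$ by a system of vector spaces in degree $k$. Proposition. Let $n\ge 2$, let $\mathscr{N}=\mathscr{M}_{n-1}$ be the $(n-1)$-st stage of a minimal system, let $\underline V$ be a system of vector spaces in degree $n$, and let $\gamma,\gamma'\in H^{n+1}(\mathscr{N};\underline V)$. Fix elementary extensions $\mathscr{N}_\gamma(\underline V)$ and $\mathscr{N}_{\gamma'}(\underline V)$ (that is, any choice of representatives $\alpha,\alpha'$, resolutions and maps $\alpha_i,\alpha_i'$ as above). Say that Condition $(C_n)$ holds if there do not exist an automorphism $\kappa$ of the diagram of DGAs $\mathscr{N}$, an automorphism $g$ of $\underline V$ and a map of systems $\beta:\underline V\to\mathscr{N}^n$ such that $$\kappa\circ\alpha=d_{\gamma'}\circ(g+\beta)$$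 as maps $\underline V\to\mathscr{N}_{\gamma'}(\underline V)^{n+1}$. Then the following are equivalent: 1. Condition $(C_n)$ is not satisfied; 2. $\mathscr{N}_\gamma(\underline V)$ and $\mathscr{N}_{\gamma'}(\underline V)$ are isomorphic as diagrams of DGAs. -/

import Mathlib

open CategoryTheory
open scoped DirectSum

universe u

/-- A commutative differential graded algebra over `ℚ`: nonnegatively graded, unital, associative,
graded commutative, with a differential of degree `+1`. -/
structure CDGA where
  carrier : Type u
  [ring : Ring carrier]
  [algebra : Algebra ℚ carrier]
  grading : ℕ → Submodule ℚ carrier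
  [graded : GradedAlgebra grading]
  graded_comm : ∀ {p q : ℕ} {a b : carrier}, a ∈ grading p → b ∈ grading q →
    a * b = (-1 : ℚ) ^ (p * q) • (b * a)
  d : carrier →ₗ[ℚ] carrier
  d_mem : ∀ {p : ℕ} {a : carrier}, a ∈ grading p → d a ∈ grading (p + 1)
  d_d : ∀ a : carrier, d (d a) = 0
  leibniz : ∀ {p : ℕ} {a : carrier}, a ∈ grading p → ∀ b : carrier,
    d (a * b) = d a * b + (-1 : ℚ) ^ p • (a * d b)

namespace CDGA

attribute [instance] CDGA.ring CDGA.algebra CDGA.graded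

/-- A morphism of CDGAs: a degree-preserving algebra homomorphism commuting with `d`. -/
@[ext]
structure Hom (A B : CDGA.{u}) where
  toAlgHom : A.carrier →ₐ[ℚ] B.carrier
  map_mem : ∀ {p : ℕ} {a : A.carrier}, a ∈ A.grading p → toAlgHom a ∈ B.grading p
  map_d : ∀ a : A.carrier, toAlgHom (A.d a) = B.d (toAlgHom a)

instance : Category CDGA.{u} where
  Hom := Hom
  id A := ⟨AlgHom.id ℚ A.carrier, fun h => h, fun _ => rfl⟩
  comp f g := ⟨g.toAlgHom.comp f.toAlgHom, fun h => g.map_mem (f.map_mem h), fun a => by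
    simp [f.map_d, g.map_d]⟩

/-- The degree `p` part of a CDGA, as a functor to rational vector spaces. -/
def degree (p : ℕ) : CDGA.{u} ⥤ ModuleCat.{u} ℚ where
  obj A := ModuleCat.of ℚ (A.grading p)
  map {A B} f := ModuleCat.ofHom
    (f.toAlgHom.toLinearMap.restrict (p := A.grading p) (q := B.grading p) fun _ h => f.map_mem h)

/-- The differential `A^p → A^{p+1}`, natural in the CDGA `A`. -/
def diff (p : ℕ) : degree.{u} p ⟶ degree.{u} (p + 1) where
  app A := ModuleCat.ofHom
    (A.d.restrict (p := A.grading p) (q := A.grading (p + 1)) fun _ h => A.d_mem h)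
  naturality {A B} f := by
    ext a
    exact Subtype.ext (f.map_d a.1).symm

end CDGA

/-- Data for adjoining to a CDGA `U` generators `W i` in degree `n + i`, `i ≥ 0`, with
`d = (-1)^i a i + w i` on `W i`. -/
structure HirschData (U : CDGA.{u}) (n : ℕ) where
  W : ℕ → ModuleCat.{u} ℚ
  a : ∀ i, W i →ₗ[ℚ] U.grading (n + i + 1)
  w : ∀ i, W i →ₗ[ℚ] W (i + 1)
  a_w : ∀ i v, (a (i + 1) (w i v) : U.carrier) = U.d (a i v)
  w_w : ∀ i v, w (i + 1) (w i v) = 0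

namespace HirschData

variable {U : CDGA.{u}} {n : ℕ} (D : HirschData U n)

/-- Homogeneous generators: the homogeneous elements of `U`, and the elements of all `W i`. -/
inductive Gen : Type u
  | base (p : ℕ) (x : U.grading p) : Gen
  | new (i : ℕ) (v : D.W i) : Gen

/-- The degree of a generator. -/
def Gen.deg {D : HirschData U n} : D.Gen → ℕ
  | .base p _ => p
  | .new i _ => n + i

/-- The relations: linearity in `U` and in the `W i`, the unit and the products of `U`, and
graded commutativity. -/
inductive Rel : FreeAlgebra ℚ D.Gen → FreeAlgebra ℚ D.Gen → Prop
  | base_add (p : ℕ) (x y : U.grading p) : Rel (FreeAlgebra.ι ℚ (.base p (x + y)))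
      (FreeAlgebra.ι ℚ (.base p x) + FreeAlgebra.ι ℚ (.base p y))
  | base_smul (p : ℕ) (c : ℚ) (x : U.grading p) : Rel (FreeAlgebra.ι ℚ (.base p (c • x)))
      (c • FreeAlgebra.ι ℚ (.base p x))
  | base_one : Rel (FreeAlgebra.ι ℚ (.base 0 ⟨1, SetLike.GradedOne.one_mem⟩)) 1
  | base_mul (p q : ℕ) (x : U.grading p) (y : U.grading q) :
      Rel (FreeAlgebra.ι ℚ (.base (p + q) ⟨x * y, SetLike.GradedMul.mul_mem x.2 y.2⟩))
        (FreeAlgebra.ι ℚ (.base p x) * FreeAlgebra.ι ℚ (.base q y))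
  | new_add (i : ℕ) (v w : D.W i) : Rel (FreeAlgebra.ι ℚ (.new i (v + w)))
      (FreeAlgebra.ι ℚ (.new i v) + FreeAlgebra.ι ℚ (.new i w))
  | new_smul (i : ℕ) (c : ℚ) (v : D.W i) : Rel (FreeAlgebra.ι ℚ (.new i (c • v)))
      (c • FreeAlgebra.ι ℚ (.new i v))
  | comm (x y : D.Gen) : Rel (FreeAlgebra.ι ℚ x * FreeAlgebra.ι ℚ y)
      ((-1 : ℚ) ^ (x.deg * y.deg) • (FreeAlgebra.ι ℚ y * FreeAlgebra.ι ℚ x))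

/-- The algebra `U ⊗ (⊗_i ℚ(W i))`: the graded commutative algebra freely generated over `U` by
the vector spaces `W i` placed in degree `n + i`. -/
abbrev Alg : Type u := RingQuot D.Rel

/-- The class of a generator. -/
def gen (x : D.Gen) : D.Alg := RingQuot.mkAlgHom ℚ D.Rel (FreeAlgebra.ι ℚ x)

theorem gen_base_add (p : ℕ) (x y : U.grading p) :
    D.gen (.base p (x + y)) = D.gen (.base p x) + D.gen (.base p y) := by
  simpa [gen] using RingQuot.mkAlgHom_rel ℚ (Rel.base_add (D := D) p x y)

theorem gen_base_smul (p : ℕ) (c : ℚ) (x : U.grading p) :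
    D.gen (.base p (c • x)) = c • D.gen (.base p x) := by
  simpa [gen] using RingQuot.mkAlgHom_rel ℚ (Rel.base_smul (D := D) p c x)

theorem gen_base_one : D.gen (.base 0 ⟨1, SetLike.GradedOne.one_mem⟩) = 1 := by
  simpa [gen] using RingQuot.mkAlgHom_rel ℚ (Rel.base_one (D := D))

theorem gen_base_mul (p q : ℕ) (x : U.grading p) (y : U.grading q) :
    D.gen (.base (p + q) ⟨x * y, SetLike.GradedMul.mul_mem x.2 y.2⟩) =
      D.gen (.base p x) * D.gen (.base q y) := by
  simpa [gen] using RingQuot.mkAlgHom_rel ℚ (Rel.base_mul (D := D) p q x y)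

theorem gen_new_add (i : ℕ) (v w : D.W i) :
    D.gen (.new i (v + w)) = D.gen (.new i v) + D.gen (.new i w) := by
  simpa [gen] using RingQuot.mkAlgHom_rel ℚ (Rel.new_add (D := D) i v w)

theorem gen_new_smul (i : ℕ) (c : ℚ) (v : D.W i) :
    D.gen (.new i (c • v)) = c • D.gen (.new i v) := by
  simpa [gen] using RingQuot.mkAlgHom_rel ℚ (Rel.new_smul (D := D) i c v)

theorem gen_comm (x y : D.Gen) :
    D.gen x * D.gen y = (-1 : ℚ) ^ (x.deg * y.deg) • (D.gen y * D.gen x) := by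
  simpa [gen] using RingQuot.mkAlgHom_rel ℚ (Rel.comm (D := D) x y)

theorem gen_base_eq {p q : ℕ} (h : p = q) (x : U.grading p) (y : U.grading q)
    (hxy : (x : U.carrier) = y) : D.gen (.base p x) = D.gen (.base q y) := by
  subst h
  rw [Subtype.ext hxy]

theorem gen_base_zero (p : ℕ) : D.gen (.base p 0) = 0 := by
  simpa using D.gen_base_smul p 0 0

theorem gen_new_zero (i : ℕ) : D.gen (.new i 0) = 0 := by
  simpa using D.gen_new_smul i 0 0

/-- A map on generators compatible with the relations extends to the algebra. -/
structure Compatible {B : Type*} [Semiring B] [Algebra ℚ B] (f : D.Gen → B) : Prop where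
  base_add : ∀ (p : ℕ) (x y : U.grading p),
    f (.base p (x + y)) = f (.base p x) + f (.base p y)
  base_smul : ∀ (p : ℕ) (c : ℚ) (x : U.grading p), f (.base p (c • x)) = c • f (.base p x)
  base_one : f (.base 0 ⟨1, SetLike.GradedOne.one_mem⟩) = 1
  base_mul : ∀ (p q : ℕ) (x : U.grading p) (y : U.grading q),
    f (.base (p + q) ⟨x * y, SetLike.GradedMul.mul_mem x.2 y.2⟩) = f (.base p x) * f (.base q y)
  new_add : ∀ (i : ℕ) (v w : D.W i), f (.new i (v + w)) = f (.new i v) + f (.new i w)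
  new_smul : ∀ (i : ℕ) (c : ℚ) (v : D.W i), f (.new i (c • v)) = c • f (.new i v)
  comm : ∀ x y : D.Gen, f x * f y = (-1 : ℚ) ^ (x.deg * y.deg) • (f y * f x)

/-- The extension of a compatible map on generators to an algebra homomorphism. -/
def lift {B : Type*} [Semiring B] [Algebra ℚ B] (f : D.Gen → B) (hf : D.Compatible f) :
    D.Alg →ₐ[ℚ] B :=
  RingQuot.liftAlgHom ℚ ⟨FreeAlgebra.lift ℚ f, fun x y h => by
    induction h with
    | base_add p x y => simpa using hf.base_add p x y
    | base_smul p c x => simpa using hf.base_smul p c x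
    | base_one => simpa using hf.base_one
    | base_mul p q x y => simpa using hf.base_mul p q x y
    | new_add i v w => simpa using hf.new_add i v w
    | new_smul i c v => simpa using hf.new_smul i c v
    | comm x y => simpa using hf.comm x y⟩

@[simp]
theorem lift_gen {B : Type*} [Semiring B] [Algebra ℚ B] (f : D.Gen → B) (hf : D.Compatible f)
    (x : D.Gen) : D.lift f hf (D.gen x) = f x := by
  simp [lift, gen]

theorem algHom_ext {B : Type*} [Semiring B] [Algebra ℚ B] {f g : D.Alg →ₐ[ℚ] B}
    (h : ∀ x, f (D.gen x) = g (D.gen x)) : f = g := by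
  apply RingQuot.ringQuot_ext'
  apply FreeAlgebra.hom_ext
  funext x
  exact h x

/-- The product of a list of generators. -/
def mon (l : List D.Gen) : D.Alg := (l.map D.gen).prod

/-- The total degree of a list of generators. -/
def wt (l : List D.Gen) : ℕ := (l.map Gen.deg).sum

/-- The degree `p` part: the span of the monomials of total degree `p`. -/
def gr (p : ℕ) : Submodule ℚ D.Alg := Submodule.span ℚ {a | ∃ l, D.wt l = p ∧ D.mon l = a}

theorem mon_mem (l : List D.Gen) : D.mon l ∈ D.gr (D.wt l) :=
  Submodule.subset_span ⟨l, rfl, rfl⟩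

theorem gen_mem (x : D.Gen) : D.gen x ∈ D.gr x.deg := by
  have := D.mon_mem [x]
  simpa [mon, wt] using this

instance gr_gradedMonoid : SetLike.GradedMonoid D.gr where
  one_mem := by simpa [mon, wt] using D.mon_mem []
  mul_mem p q a b ha hb := by
    induction ha using Submodule.span_induction with
    | zero => simp
    | add x y _ _ hx hy => rw [add_mul]; exact add_mem hx hy
    | smul c x _ hx => rw [smul_mul_assoc]; exact Submodule.smul_mem _ c hx
    | mem x hx =>
      obtain ⟨l, rfl, rfl⟩ := hx
      induction hb using Submodule.span_induction with
      | zero => simp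
      | add x y _ _ hx hy => rw [mul_add]; exact add_mem hx hy
      | smul c x _ hx => rw [mul_smul_comm]; exact Submodule.smul_mem _ c hx
      | mem y hy =>
        obtain ⟨m, rfl, rfl⟩ := hy
        simpa [mon, wt] using D.mon_mem (l ++ m)

/-- A homogeneous element, as an element of the direct sum of the graded pieces. -/
def homog (p : ℕ) (a : D.Alg) (ha : a ∈ D.gr p) : ⨁ i, D.gr i :=
  DirectSum.of (fun i => D.gr i) p ⟨a, ha⟩

theorem homog_congr {p q : ℕ} {a b : D.Alg} (h : p = q) (hab : a = b) (ha : a ∈ D.gr p)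
    (hb : b ∈ D.gr q) : D.homog p a ha = D.homog q b hb := by
  subst h hab
  rfl

theorem homog_add (p : ℕ) {a b : D.Alg} (ha : a ∈ D.gr p) (hb : b ∈ D.gr p) :
    D.homog p a ha + D.homog p b hb = D.homog p (a + b) (add_mem ha hb) :=
  (map_add (DirectSum.of (fun i => D.gr i) p) ⟨a, ha⟩ ⟨b, hb⟩).symm

theorem homog_smul (p : ℕ) (c : ℚ) {a : D.Alg} (ha : a ∈ D.gr p) :
    c • D.homog p a ha = D.homog p (c • a) (Submodule.smul_mem _ c ha) :=
  ((DirectSum.lof ℚ ℕ (fun i => D.gr i) p).map_smul c ⟨a, ha⟩).symm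

theorem homog_mul {p q : ℕ} {a b : D.Alg} (ha : a ∈ D.gr p) (hb : b ∈ D.gr q) :
    D.homog p a ha * D.homog q b hb = D.homog (p + q) (a * b) (SetLike.GradedMul.mul_mem ha hb) :=
  DirectSum.of_mul_of _ _

/-- The decomposition of the algebra into its homogeneous components. -/
def decomp : D.Alg →ₐ[ℚ] ⨁ i, D.gr i :=
  D.lift (fun x => D.homog x.deg (D.gen x) (D.gen_mem x))
    { base_add := fun p x y => (D.homog_congr rfl (D.gen_base_add p x y) _ _).trans
        (D.homog_add p (D.gen_mem (.base p x)) (D.gen_mem (.base p y))).symm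
      base_smul := fun p c x => (D.homog_congr rfl (D.gen_base_smul p c x) _ _).trans
        (D.homog_smul p c (D.gen_mem (.base p x))).symm
      base_one := D.homog_congr rfl D.gen_base_one _ SetLike.GradedOne.one_mem
      base_mul := fun p q x y => (D.homog_congr rfl (D.gen_base_mul p q x y) _ _).trans
        (D.homog_mul (D.gen_mem (.base p x)) (D.gen_mem (.base q y))).symm
      new_add := fun i v w => (D.homog_congr rfl (D.gen_new_add i v w) _ _).trans
        (D.homog_add (n + i) (D.gen_mem (.new i v)) (D.gen_mem (.new i w))).symm
      new_smul := fun i c v => (D.homog_congr rfl (D.gen_new_smul i c v) _ _).trans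
        (D.homog_smul (n + i) c (D.gen_mem (.new i v))).symm
      comm := fun x y => by
        rw [homog_mul, homog_mul, homog_smul]
        exact D.homog_congr (add_comm _ _) (D.gen_comm x y) _ _ }

theorem decomp_gen (x : D.Gen) : D.decomp (D.gen x) = D.homog x.deg (D.gen x) (D.gen_mem x) :=
  D.lift_gen _ _ x

theorem mon_cons (x : D.Gen) (l : List D.Gen) : D.mon (x :: l) = D.gen x * D.mon l := by
  simp [mon]

theorem wt_cons (x : D.Gen) (l : List D.Gen) : D.wt (x :: l) = x.deg + D.wt l := by
  simp [wt]

theorem decomp_mon (l : List D.Gen) :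
    D.decomp (D.mon l) = D.homog (D.wt l) (D.mon l) (D.mon_mem l) := by
  induction l with
  | nil => exact map_one D.decomp
  | cons x l ih =>
    have h4 : D.decomp (D.mon (x :: l)) = D.decomp (D.gen x) * D.decomp (D.mon l) := by
      rw [mon_cons, map_mul]
    rw [h4, ih, decomp_gen, homog_mul]
    exact D.homog_congr (D.wt_cons x l).symm (D.mon_cons x l).symm _ _

theorem decomp_mem {p : ℕ} {a : D.Alg} (ha : a ∈ D.gr p) : D.decomp a = D.homog p a ha := by
  induction ha using Submodule.span_induction with
  | zero => rw [map_zero]; exact (map_zero (DirectSum.of (fun i => D.gr i) p)).symm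
  | add x y hx' hy' hx hy => rw [map_add, hx, hy]; exact D.homog_add p hx' hy'
  | smul c x hx' hx => rw [map_smul, hx]; exact D.homog_smul p c hx'
  | mem x hx =>
    obtain ⟨l, rfl, rfl⟩ := hx
    exact D.decomp_mon l

instance gr_gradedAlgebra : GradedAlgebra D.gr :=
  GradedAlgebra.ofAlgHom D.gr D.decomp
    (D.algHom_ext fun x => by
      rw [AlgHom.comp_apply, decomp_gen]
      exact DirectSum.coeAlgHom_of _ _ _)
    (fun _ a => D.decomp_mem a.2)

theorem gen_comm_mem {p : ℕ} (x : D.Gen) {b : D.Alg} (hb : b ∈ D.gr p) :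
    D.gen x * b = (-1 : ℚ) ^ (x.deg * p) • (b * D.gen x) := by
  induction hb using Submodule.span_induction with
  | zero => simp
  | add y z _ _ hy hz => rw [mul_add, hy, hz, add_mul, smul_add]
  | smul c y _ hy => rw [mul_smul_comm, hy, smul_mul_assoc, smul_comm]
  | mem y hy =>
    obtain ⟨l, rfl, rfl⟩ := hy
    induction l with
    | nil => simp [mon, wt]
    | cons y l ih =>
      rw [mon_cons, wt_cons, ← mul_assoc, D.gen_comm x y, smul_mul_assoc, mul_assoc, ih, mul_smul_comm,
        smul_smul, ← pow_add, ← mul_add, mul_assoc]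

theorem gr_comm {p q : ℕ} {a b : D.Alg} (ha : a ∈ D.gr p) (hb : b ∈ D.gr q) :
    a * b = (-1 : ℚ) ^ (p * q) • (b * a) := by
  induction ha using Submodule.span_induction with
  | zero => simp
  | add y z _ _ hy hz => rw [add_mul, hy, hz, mul_add, smul_add]
  | smul c y _ hy => rw [mul_smul_comm, smul_mul_assoc, hy, smul_comm]
  | mem y hy =>
    obtain ⟨l, rfl, rfl⟩ := hy
    induction l with
    | nil => simp [mon, wt]
    | cons y l ih =>
      rw [mon_cons, wt_cons, mul_assoc, ih, mul_smul_comm, ← mul_assoc, D.gen_comm_mem y hb, smul_mul_assoc,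
        smul_smul, ← pow_add, mul_assoc, add_mul, add_comm (D.wt l * q)]

/-- The differential on generators: that of `U` on `U`, and `(-1)^i a i + w i` on `W i`. -/
def dGen : D.Gen → D.Alg
  | .base p x => D.gen (.base (p + 1) ⟨U.d x, U.d_mem x.2⟩)
  | .new i v => (-1 : ℚ) ^ i • D.gen (.base (n + i + 1) (D.a i v)) + D.gen (.new (i + 1) (D.w i v))

theorem dGen_mem (x : D.Gen) : D.dGen x ∈ D.gr (x.deg + 1) := by
  cases x with
  | base p x => exact D.gen_mem (.base (p + 1) ⟨U.d x, U.d_mem x.2⟩)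
  | new i v =>
    exact add_mem (Submodule.smul_mem _ _ (D.gen_mem (.base (n + i + 1) (D.a i v))))
      (D.gen_mem (.new (i + 1) (D.w i v)))

/-- The algebra homomorphism `a ↦ (ε a, d a; 0, a)`, `ε a = (-1)^{deg a} a`, which encodes the
graded derivation `d` extending `dGen`. -/
def dMat : D.Alg →ₐ[ℚ] Matrix (Fin 2) (Fin 2) D.Alg :=
  D.lift (fun x => !![(-1 : ℚ) ^ x.deg • D.gen x, D.dGen x; 0, D.gen x])
    { base_add := fun p x y => by
        have : D.dGen (.base p (x + y)) = D.dGen (.base p x) + D.dGen (.base p y) := by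
          simp only [dGen]
          rw [← gen_base_add]
          exact D.gen_base_eq rfl _ _ (by simp)
        ext i j
        fin_cases i <;> fin_cases j <;> simp [this, gen_base_add, Gen.deg]
      base_smul := fun p c x => by
        have : D.dGen (.base p (c • x)) = c • D.dGen (.base p x) := by
          simp only [dGen]
          rw [← gen_base_smul]
          exact D.gen_base_eq rfl _ _ (by simp)
        ext i j
        fin_cases i <;> fin_cases j <;> simp [this, gen_base_smul, Gen.deg, smul_comm c]
      base_one := by
        have h1 : U.d 1 = 0 := by
          have := U.leibniz (p := 0) (a := 1) SetLike.GradedOne.one_mem 1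
          simpa using this
        have : D.dGen (.base 0 ⟨1, SetLike.GradedOne.one_mem⟩) = 0 := by
          simp only [dGen]
          rw [← D.gen_base_zero (0 + 1)]
          exact D.gen_base_eq rfl _ _ (by simp [h1])
        ext i j
        fin_cases i <;> fin_cases j <;> simp [this, gen_base_one, Gen.deg]
      base_mul := fun p q x y => by
        have : D.dGen (.base (p + q) ⟨x * y, SetLike.GradedMul.mul_mem x.2 y.2⟩) =
            D.dGen (.base p x) * D.gen (.base q y) +
              (-1 : ℚ) ^ p • (D.gen (.base p x) * D.dGen (.base q y)) := by
          simp only [dGen]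
          rw [← gen_base_mul, ← gen_base_mul, ← gen_base_smul,
            D.gen_base_eq (p := p + 1 + q) (q := p + q + 1) (by omega) _
              ⟨U.d x * y, by
                have := SetLike.GradedMul.mul_mem (U.d_mem x.2) y.2
                rwa [show p + 1 + q = p + q + 1 by omega] at this⟩ rfl]
          refine Eq.trans (D.gen_base_eq rfl _ _ ?_) (D.gen_base_add (p + q + 1) _ _)
          exact U.leibniz x.2 y
        ext i j
        fin_cases i <;> fin_cases j <;>
          simp [this, gen_base_mul, Gen.deg, smul_smul, pow_add, add_comm]
      new_add := fun k v w => by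
        have : D.dGen (.new k (v + w)) = D.dGen (.new k v) + D.dGen (.new k w) := by
          simp only [dGen, map_add, gen_base_add, gen_new_add, smul_add]
          abel
        ext i j
        fin_cases i <;> fin_cases j <;> simp [this, gen_new_add, Gen.deg]
      new_smul := fun k c v => by
        have : D.dGen (.new k (c • v)) = c • D.dGen (.new k v) := by
          simp only [dGen, map_smul, gen_base_smul, gen_new_smul, smul_add, smul_comm c]
        ext i j
        fin_cases i <;> fin_cases j <;> simp [this, gen_new_smul, Gen.deg, smul_comm c]
      comm := fun x y => by
        have h1 := D.gr_comm (D.dGen_mem x) (D.gen_mem y)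
        have h2 := D.gr_comm (D.gen_mem x) (D.dGen_mem y)
        have h3 := D.gen_comm x y
        ext i j
        fin_cases i <;> fin_cases j
        · simp [h3, smul_smul]; ring_nf
        · have e1 : (-1 : ℚ) ^ ((x.deg + 1) * y.deg) =
              (-1) ^ (x.deg * y.deg) * (-1) ^ y.deg := by ring
          have e2 : (-1 : ℚ) ^ x.deg * (-1) ^ (x.deg * (y.deg + 1)) =
              (-1) ^ (x.deg * y.deg) := by
            rw [mul_add, mul_one, pow_add, mul_left_comm, ← mul_pow]; simp
          simp [h1, h2, smul_smul, e1, e2]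
          rw [add_comm]
        · simp
        · simp [h3] }

theorem dMat_gen (x : D.Gen) :
    D.dMat (D.gen x) = !![(-1 : ℚ) ^ x.deg • D.gen x, D.dGen x; 0, D.gen x] :=
  D.lift_gen _ _ x

theorem span_mon (a : D.Alg) : a ∈ Submodule.span ℚ (Set.range D.mon) := by
  classical
  rw [← DirectSum.sum_support_decompose D.gr a]
  refine Submodule.sum_mem _ fun p _ => ?_
  refine (Submodule.span_mono ?_ : D.gr p ≤ _) (DirectSum.decompose D.gr a p).2
  rintro _ ⟨l, _, rfl⟩
  exact ⟨l, rfl⟩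

theorem dMat_one_one (a : D.Alg) : D.dMat a 1 1 = a ∧ D.dMat a 1 0 = 0 := by
  induction D.span_mon a using Submodule.span_induction with
  | zero => simp
  | add x y _ _ hx hy => simp [hx, hy]
  | smul c x _ hx => simp [hx]
  | mem x hx =>
    obtain ⟨l, rfl⟩ := hx
    induction l with
    | nil => simp [mon]
    | cons x l ih => simp [mon_cons, Matrix.mul_apply, dMat_gen, ih]

theorem dMat_zero_zero {p : ℕ} {a : D.Alg} (ha : a ∈ D.gr p) :
    D.dMat a 0 0 = (-1 : ℚ) ^ p • a := by
  induction ha using Submodule.span_induction with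
  | zero => simp
  | add x y _ _ hx hy => simp [hx, hy]
  | smul c x _ hx => simp [hx, smul_comm c]
  | mem x hx =>
    obtain ⟨l, rfl, rfl⟩ := hx
    induction l with
    | nil => simp [mon, wt]
    | cons x l ih =>
      simp [mon_cons, wt_cons, Matrix.mul_apply, dMat_gen, ih, (D.dMat_one_one (D.mon l)).2,
        smul_smul, pow_add, mul_comm]

/-- The differential. -/
def dAlg : D.Alg →ₗ[ℚ] D.Alg where
  toFun a := D.dMat a 0 1
  map_add' a b := by simp
  map_smul' c a := by simp

theorem dAlg_gen (x : D.Gen) : D.dAlg (D.gen x) = D.dGen x := by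
  simp [dAlg, dMat_gen]

theorem dAlg_mul {p : ℕ} {a : D.Alg} (ha : a ∈ D.gr p) (b : D.Alg) :
    D.dAlg (a * b) = D.dAlg a * b + (-1 : ℚ) ^ p • (a * D.dAlg b) := by
  simp [dAlg, Matrix.mul_apply, D.dMat_zero_zero ha, (D.dMat_one_one b).1, add_comm]

theorem dAlg_one : D.dAlg 1 = 0 := by
  simp [dAlg]

theorem dAlg_mem {p : ℕ} {a : D.Alg} (ha : a ∈ D.gr p) : D.dAlg a ∈ D.gr (p + 1) := by
  induction ha using Submodule.span_induction with
  | zero => simp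
  | add x y _ _ hx hy => rw [map_add]; exact add_mem hx hy
  | smul c x _ hx => rw [map_smul]; exact Submodule.smul_mem _ c hx
  | mem x hx =>
    obtain ⟨l, rfl, rfl⟩ := hx
    induction l with
    | nil => simp [mon, dAlg_one]
    | cons x l ih =>
      rw [mon_cons, D.dAlg_mul (D.gen_mem x), dAlg_gen, wt_cons]
      refine add_mem ?_ (Submodule.smul_mem _ _ ?_)
      · have := SetLike.GradedMul.mul_mem (D.dGen_mem x) (D.mon_mem l)
        rwa [add_right_comm] at this
      · rw [add_assoc]; exact SetLike.GradedMul.mul_mem (D.gen_mem x) ih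

theorem dAlg_dGen (x : D.Gen) : D.dAlg (D.dGen x) = 0 := by
  cases x with
  | base p x =>
    simp only [dGen, dAlg_gen]
    rw [← D.gen_base_zero (p + 1 + 1)]
    exact D.gen_base_eq rfl _ _ (U.d_d x)
  | new i v =>
    have h : D.gen (.base (n + i + 1 + 1) ⟨U.d (D.a i v), U.d_mem (D.a i v).2⟩) =
        D.gen (.base (n + (i + 1) + 1) (D.a (i + 1) (D.w i v))) :=
      D.gen_base_eq rfl _ _ (D.a_w i v).symm
    simp only [dGen, map_add, map_smul, dAlg_gen, h, D.w_w, gen_new_zero, pow_succ]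
    rw [add_zero, mul_neg_one, ← add_smul, add_neg_cancel, zero_smul]

theorem dAlg_dAlg (a : D.Alg) : D.dAlg (D.dAlg a) = 0 := by
  induction D.span_mon a using Submodule.span_induction with
  | zero => simp
  | add x y _ _ hx hy => simp [hx, hy]
  | smul c x _ hx => simp [hx]
  | mem x hx =>
    obtain ⟨l, rfl⟩ := hx
    induction l with
    | nil => simp [mon, dAlg_one]
    | cons x l ih =>
      rw [mon_cons, D.dAlg_mul (D.gen_mem x), dAlg_gen, map_add, map_smul,
        D.dAlg_mul (D.dGen_mem x), D.dAlg_mul (D.gen_mem x), dAlg_dGen, dAlg_gen, ih, pow_succ, mul_neg_one,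
        zero_mul, mul_zero, smul_zero, add_zero, zero_add, ← add_smul, neg_add_cancel, zero_smul]

/-- The CDGA `U ⊗ (⊗_i ℚ(W i))` with differential extending that of `U` and equal to
`(-1)^i a i + w i` on `W i`. -/
def toCDGA : CDGA.{u} where
  carrier := D.Alg
  grading := D.gr
  graded_comm := D.gr_comm
  d := D.dAlg
  d_mem := D.dAlg_mem
  d_d := D.dAlg_dAlg
  leibniz := D.dAlg_mul

section Map

variable {U' : CDGA.{u}} {D} {D' : HirschData U' n}

/-- A morphism of extension data over a morphism of CDGAs. -/
structure Map (f : U ⟶ U') (D : HirschData U n) (D' : HirschData U' n) where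
  map : ∀ i, D.W i →ₗ[ℚ] D'.W i
  map_a : ∀ i v, (D'.a i (map i v) : U'.carrier) = f.toAlgHom (D.a i v)
  map_w : ∀ i v, D'.w i (map i v) = map (i + 1) (D.w i v)

variable {f : U ⟶ U'} (m : Map f D D')

/-- The induced map on generators. -/
def Map.onGen : D.Gen → D'.Gen
  | .base p x => .base p ⟨f.toAlgHom x, f.map_mem x.2⟩
  | .new i v => .new i (m.map i v)

theorem Map.deg_onGen (x : D.Gen) : (m.onGen x).deg = x.deg := by
  cases x <;> rfl

/-- The induced algebra homomorphism. -/
def Map.algHom : D.Alg →ₐ[ℚ] D'.Alg :=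
  D.lift (fun x => D'.gen (m.onGen x))
    { base_add := fun p x y => by
        simp only [Map.onGen]
        rw [← gen_base_add]
        exact D'.gen_base_eq rfl _ _ (by simp)
      base_smul := fun p c x => by
        simp only [Map.onGen]
        rw [← gen_base_smul]
        exact D'.gen_base_eq rfl _ _ (by simp)
      base_one := by
        simp only [Map.onGen]
        rw [← gen_base_one]
        exact D'.gen_base_eq rfl _ _ (by simp)
      base_mul := fun p q x y => by
        simp only [Map.onGen]
        rw [← gen_base_mul]
        exact D'.gen_base_eq rfl _ _ (by simp)
      new_add := fun i v w => by simp only [Map.onGen, map_add, gen_new_add]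
      new_smul := fun i c v => by simp only [Map.onGen, map_smul, gen_new_smul]
      comm := fun x y => by
        rw [D'.gen_comm, m.deg_onGen, m.deg_onGen] }

theorem Map.algHom_gen (x : D.Gen) : m.algHom (D.gen x) = D'.gen (m.onGen x) :=
  D.lift_gen _ _ x

theorem Map.algHom_mem {p : ℕ} {a : D.Alg} (ha : a ∈ D.gr p) : m.algHom a ∈ D'.gr p := by
  induction ha using Submodule.span_induction with
  | zero => simp
  | add x y _ _ hx hy => rw [map_add]; exact add_mem hx hy
  | smul c x _ hx => rw [map_smul]; exact Submodule.smul_mem _ c hx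
  | mem x hx =>
    obtain ⟨l, rfl, rfl⟩ := hx
    induction l with
    | nil => simpa [mon, wt] using D'.mon_mem []
    | cons x l ih =>
      rw [mon_cons, map_mul, wt_cons, algHom_gen, ← m.deg_onGen x]
      exact SetLike.GradedMul.mul_mem (D'.gen_mem _) ih

theorem Map.algHom_dGen (x : D.Gen) : m.algHom (D.dGen x) = D'.dGen (m.onGen x) := by
  cases x with
  | base p x =>
    simp only [dGen, algHom_gen, Map.onGen]
    exact D'.gen_base_eq rfl _ _ (f.map_d x)
  | new i v =>
    simp only [dGen, map_add, map_smul, algHom_gen, Map.onGen, m.map_w]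
    congr 2
    exact D'.gen_base_eq rfl _ _ (m.map_a i v).symm

theorem Map.algHom_dAlg (a : D.Alg) : m.algHom (D.dAlg a) = D'.dAlg (m.algHom a) := by
  induction D.span_mon a using Submodule.span_induction with
  | zero => simp
  | add x y _ _ hx hy => simp [hx, hy]
  | smul c x _ hx => simp [hx]
  | mem x hx =>
    obtain ⟨l, rfl⟩ := hx
    induction l with
    | nil => simp [mon, dAlg_one]
    | cons x l ih =>
      have h := D'.gen_mem (m.onGen x)
      rw [m.deg_onGen] at h
      rw [mon_cons, D.dAlg_mul (D.gen_mem x), map_mul, algHom_gen, D'.dAlg_mul h, dAlg_gen,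
        dAlg_gen, map_add, map_smul, map_mul, map_mul, algHom_dGen, algHom_gen, ih]

/-- The induced morphism of CDGAs. -/
def Map.toHom : D.toCDGA ⟶ D'.toCDGA where
  toAlgHom := m.algHom
  map_mem := m.algHom_mem
  map_d := m.algHom_dAlg

end Map

end HirschData

/-- The orbit category of `G`: objects are the orbits `G/H`, `H ≤ G`. -/
structure OrbitCat (G : Type u) [Group G] where
  sub : Subgroup G

namespace OrbitCat

variable (G : Type u) [Group G]

/-- Morphisms of the orbit category are the `G`-equivariant maps `G/H → G/K`. -/
instance : Category.{u} (OrbitCat G) where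
  Hom H K := (G ⧸ H.sub) →[G] (G ⧸ K.sub)
  id H := MulActionHom.id G
  comp f g := MulActionHom.comp g f

end OrbitCat

/-- Systems of rational vector spaces: covariant functors on the orbit category. -/
abbrev VecSystem (G : Type u) [Group G] := OrbitCat G ⥤ ModuleCat.{u} ℚ

/-- Diagrams of CDGAs: covariant functors on the orbit category. -/
abbrev DGADiagram (G : Type u) [Group G] := OrbitCat G ⥤ CDGA.{u}

section Systems

variable {G : Type u} [Group G]

/-- The system of degree `p` parts of a diagram of CDGAs. -/
abbrev degreeSystem (N : DGADiagram G) (p : ℕ) : VecSystem G := N ⋙ CDGA.degree p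

/-- The differential of a diagram of CDGAs, as a map of systems of vector spaces. -/
abbrev diffSystem (N : DGADiagram G) (p : ℕ) : degreeSystem N p ⟶ degreeSystem N (p + 1) :=
  Functor.whiskerLeft N (CDGA.diff p)

/-- The degree `p` part of a morphism of diagrams of CDGAs. -/
abbrev degreeMap {M N : DGADiagram G} (f : M ⟶ N) (p : ℕ) :
    degreeSystem M p ⟶ degreeSystem N p :=
  Functor.whiskerRight f (CDGA.degree p)

/-- The maps of systems `V → Z^k(N)`. -/
abbrev cocycles (N : DGADiagram G) (V : VecSystem G) (k : ℕ) :
    AddSubgroup (V ⟶ degreeSystem N k) :=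
  (Preadditive.rightComp V (diffSystem N k)).ker

/-- `H^{n+1}(N; V)`, the degree `n + 1` cohomology of the cochain complex `Hom(V, N)`. -/
abbrev CohomologySucc (N : DGADiagram G) (V : VecSystem G) (n : ℕ) :=
  cocycles N V (n + 1) ⧸
    (Preadditive.rightComp V (diffSystem N n)).range.addSubgroupOf (cocycles N V (n + 1))

/-- A minimal injective resolution `0 → V → V_0 → V_1 → ⋯` of a system of vector spaces: an
exact sequence in which each `V_i` is injective and is an essential extension of
`ker (V_i → V_{i+1})`, so that `V_0` is an injective envelope of `V` and `V_{i+1}` one of the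
cokernel of the preceding map. -/
structure MinimalInjectiveResolution (V : VecSystem G) where
  obj : ℕ → VecSystem G
  ι : V ⟶ obj 0
  w : ∀ i, obj i ⟶ obj (i + 1)
  injective : ∀ i, Injective (obj i)
  ι_injective : ∀ H, Function.Injective (ι.app H)
  exact_zero : ∀ H, Function.Exact (ι.app H) ((w 0).app H)
  exact_succ : ∀ i H, Function.Exact ((w i).app H) ((w (i + 1)).app H)
  /-- A map of systems on `V_i` that is injective on `ker (w i)` is injective. -/
  essential : ∀ (i : ℕ) (Z : VecSystem G) (g : obj i ⟶ Z),
    (∀ (H : OrbitCat G) (v : (obj i).obj H), (w i).app H v = 0 → g.app H v = 0 → v = 0) →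
      ∀ H, Function.Injective (g.app H)

/-- The choices made in forming the elementary extension `N_γ(V)`, for `V` in degree `n` and
`γ ∈ H^{n+1}(N; V)`: a map `α : V → Z^{n+1}(N)` representing `γ`, a minimal injective resolution
`V_i` of `V`, and an extension of `α` to maps `α_i : V_i → N^{n+i+1}` with
`α_{i+1} w_i = d α_i`. -/
structure ElementaryData {N : DGADiagram G} {V : VecSystem G} {n : ℕ}
    (γ : CohomologySucc N V n) where
  α : cocycles N V (n + 1)
  class_eq : QuotientAddGroup.mk α = γ
  res : MinimalInjectiveResolution V
  ext : ∀ i, res.obj i ⟶ degreeSystem N (n + i + 1)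
  ext_zero : res.ι ≫ ext 0 = α.1
  ext_succ : ∀ i, res.w i ≫ ext (i + 1) = ext i ≫ diffSystem N (n + i + 1)

namespace ElementaryData

variable {N : DGADiagram G} {V : VecSystem G} {n : ℕ} {γ : CohomologySucc N V n}
  (E : ElementaryData γ)

/-- The generators to be adjoined at an orbit. -/
def level (H : OrbitCat G) : HirschData (N.obj H) n where
  W i := (E.res.obj i).obj H
  a i := ((E.ext i).app H).hom
  w i := ((E.res.w i).app H).hom
  a_w i v := congrArg Subtype.val
    (LinearMap.congr_fun (congrArg ModuleCat.Hom.hom (NatTrans.congr_app (E.ext_succ i) H)) v)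
  w_w i v := (E.res.exact_succ i H _).2 ⟨v, rfl⟩

/-- The structure maps on generators. -/
def levelMap {H K : OrbitCat G} (f : H ⟶ K) :
    HirschData.Map (N.map f) (E.level H) (E.level K) where
  map i := ((E.res.obj i).map f).hom
  map_a i v := congrArg Subtype.val
    (LinearMap.congr_fun (congrArg ModuleCat.Hom.hom ((E.ext i).naturality f)) v)
  map_w i v :=
    LinearMap.congr_fun (congrArg ModuleCat.Hom.hom ((E.res.w i).naturality f)) v

/-- The elementary extension `N_γ(V) = N ⊗ (⊗_i ℚ(V_i))`. -/
def extension : DGADiagram G where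
  obj H := (E.level H).toCDGA
  map f := (E.levelMap f).toHom
  map_id H := by
    apply CDGA.Hom.ext
    apply HirschData.algHom_ext
    intro x
    refine (HirschData.Map.algHom_gen _ x).trans ?_
    change _ = (E.level H).gen x
    cases x with
    | base p x =>
      exact HirschData.gen_base_eq _ rfl _ _ (by simp; rfl)
    | new i v =>
      simp [HirschData.Map.onGen, levelMap]
      rfl
  map_comp {H K L} f g := by
    apply CDGA.Hom.ext
    apply HirschData.algHom_ext
    intro x
    refine (HirschData.Map.algHom_gen _ x).trans ?_
    change _ = (E.levelMap g).algHom ((E.levelMap f).algHom ((E.level H).gen x))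
    rw [HirschData.Map.algHom_gen, HirschData.Map.algHom_gen]
    cases x with
    | base p x =>
      exact HirschData.gen_base_eq _ rfl _ _ (by simp; rfl)
    | new i v =>
      simp [HirschData.Map.onGen, levelMap]
      rfl

/-- The inclusion `N → N_γ(V)` in degree `p`. -/
def inclBase (p : ℕ) : degreeSystem N p ⟶ degreeSystem E.extension p where
  app H := ModuleCat.ofHom
    { toFun := fun x => ⟨(E.level H).gen (.base p x), (E.level H).gen_mem (.base p x)⟩
      map_add' := fun x y => Subtype.ext ((E.level H).gen_base_add p x y)
      map_smul' := fun c x => Subtype.ext ((E.level H).gen_base_smul p c x) }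
  naturality H K f := by
    ext x
    exact Subtype.ext ((E.levelMap f).algHom_gen (.base p x)).symm

/-- The inclusion `V_i → N_γ(V)` in degree `n + i`. -/
def inclGen (i : ℕ) : E.res.obj i ⟶ degreeSystem E.extension (n + i) where
  app H := ModuleCat.ofHom
    { toFun := fun v => ⟨(E.level H).gen (.new i v), (E.level H).gen_mem (.new i v)⟩
      map_add' := fun v w => Subtype.ext ((E.level H).gen_new_add i v w)
      map_smul' := fun c v => Subtype.ext ((E.level H).gen_new_smul i c v) }
  naturality H K f := by
    ext v
    exact Subtype.ext ((E.levelMap f).algHom_gen (.new i v)).symm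

/-- The inclusion `V → V_0 → N_γ(V)` in degree `n`. -/
def inclV : V ⟶ degreeSystem E.extension n := E.res.ι ≫ E.inclGen 0

end ElementaryData

/-- `IsMinimalStage k N`: the diagram `N` is (up to isomorphism) the `k`-th stage `M_k` of a
minimal system, i.e. `M_0 = M_1 = ℚ` and, for `k ≥ 1`, `M_{k+1}` is an elementary extension
`(M_k)_γ(V)` by a system of vector spaces `V` in degree `k + 1`. -/
inductive IsMinimalStage : ℕ → DGADiagram G → Prop
  | base (k : ℕ) (hk : k ≤ 1) (N : DGADiagram G)
      (hN : ∀ H, Function.Bijective (algebraMap ℚ (N.obj H).carrier)) : IsMinimalStage k N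
  | step (k : ℕ) (hk : 1 ≤ k) (N N' : DGADiagram G) (hN : IsMinimalStage k N) (V : VecSystem G)
      (γ : CohomologySucc N V (k + 1)) (E : ElementaryData γ) (e : N' ≅ E.extension) :
      IsMinimalStage (k + 1) N'

/-- Condition `(C_n)` for `N_{γ'}(V)`, relative to `N_γ(V)`: there are no automorphisms `κ` of `N`
and `g` of `V` and map `β : V → N` (of degree `0`, `V` being in degree `n`) with
`κ γ = d_{γ'} (g + β)` as maps `V → N_{γ'}(V)`. -/
def ConditionC {N : DGADiagram G} {V : VecSystem G} {n : ℕ} {γ γ' : CohomologySucc N V n}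
    (E : ElementaryData γ) (E' : ElementaryData γ') : Prop :=
  ¬ ∃ (κ : N ≅ N) (g : V ≅ V) (β : V ⟶ degreeSystem N n),
    E.α.1 ≫ degreeMap κ.hom (n + 1) ≫ E'.inclBase (n + 1) =
      (g.hom ≫ E'.inclV + β ≫ E'.inclBase n) ≫ diffSystem E'.extension n

end Systems

/-! The two implications are proved separately; both rest on the fact that the systems `N^p` are
injective. Primes mark the data of the second extension.

From an equation to an isomorphism. The automorphism `g` of `V` lifts to maps `s_i : V_i → V'_i`
between the two minimal injective resolutions, and minimality makes every `s_i` bijective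
(`exists_lift`). The algebra map equal to `κ` on `N` and to `s_i + b_i` on `V_i` commutes with the
differentials as soon as `b_{i+1} w_i = d b_i + (-1)^i (α'_i s_i - κ α_i)`. The given equation makes
the right side for `i = 0` vanish on `V` when `b_0` extends `β`, and the `b_i` are then found one
after another because the `N^p` are injective (`exists_homotopy`).

Injectivity of `N^p`. The generators of a minimal stage form injective systems, and the point is to
pass from generators to products. An injective system is a retract of a coinduced one. In a
coinduced system the structure maps have sections, namely extension by zero, obeying identities that
involve only composition. Such identities survive the free graded commutative algebra functor, and
for finite `G` they force injectivity (`Sections.injective`).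

From an isomorphism to an equation. Below degree `n` the extension is `N`, so an isomorphism `φ`
induces a map of `N` that is invertible and compatible with `d` there; in degree `n` the generators
`V_0` interfere. This partial map is replaced by a true automorphism `κ` with the same values below
degree `n` (`exists_automorphism`). Although the resolutions put generators of `N` in higher
degrees, the complex of indecomposables of `N` is exact above degree `n - 1`, so values on the
higher generators can be chosen degree by degree, again by injectivity.

Now `F = φ` and `F' = κ` on `N` agree below degree `n`, hence also on decomposables of degree `n +
1`, because `N^1 = 0`. By exactness the cocycle `α(v)` is `dz` plus a decomposable. Then `h(v) =
φ(v) + F'(z) - F(z)` does not depend on `z`, and `d h(v) = κ α(v)`. An element of degree `n` whose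
differential lies in `N` belongs to `N^n ⊕ V`, so `h = β + g`; invertibility of `φ` makes `g`
bijective (`exists_eq_of_iso`). -/

section SystemBasics

variable {G : Type u} [Group G]

/-! ### Systems of vector spaces: extension of maps and essential subsystems -/

namespace VecSystem

/-- A natural family of linear maps, as a map of systems. -/
def mkHom {X Y : VecSystem G} (f : ∀ H, X.obj H →ₗ[ℚ] Y.obj H)
    (nat : ∀ {H K : OrbitCat G} (g : H ⟶ K) (x : X.obj H), f K (X.map g x) = Y.map g (f H x)) :
    X ⟶ Y where
  app H := ModuleCat.ofHom (f H)
  naturality H K g := by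
    ext x
    exact nat g x

theorem hom_ext {X Y : VecSystem G} {f g : X ⟶ Y} (h : ∀ H x, f.app H x = g.app H x) : f = g := by
  ext H x
  exact h H x

theorem map_apply_comm {X Y : VecSystem G} (f : X ⟶ Y) {H K : OrbitCat G} (g : H ⟶ K)
    (x : X.obj H) : f.app K (X.map g x) = Y.map g (f.app H x) :=
  NatTrans.naturality_apply f g x

theorem map_id_apply (X : VecSystem G) {H : OrbitCat G} (x : X.obj H) : X.map (𝟙 H) x = x := by
  simp

theorem map_comp_apply (X : VecSystem G) {H K L : OrbitCat G} (f : H ⟶ K) (g : K ⟶ L)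
    (x : X.obj H) : X.map (f ≫ g) x = X.map g (X.map f x) := by
  simp

theorem comp_apply {X Y Z : VecSystem G} (f : X ⟶ Y) (g : Y ⟶ Z) (H : OrbitCat G) (x : X.obj H) :
    (f ≫ g).app H x = g.app H (f.app H x) := rfl

theorem apply_of_comp_eq {X Y Z : VecSystem G} {f : X ⟶ Y} {g : Y ⟶ Z} {h : X ⟶ Z}
    (e : f ≫ g = h) {H : OrbitCat G} (x : X.obj H) : g.app H (f.app H x) = h.app H x := by
  rw [← e]; rfl

theorem sub_apply {X Y : VecSystem G} (f g : X ⟶ Y) (H : OrbitCat G) (x : X.obj H) :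
    (f - g).app H x = f.app H x - g.app H x := rfl

theorem injective_of_mono {X Y : VecSystem G} (f : X ⟶ Y) [Mono f] (H : OrbitCat G) :
    Function.Injective (f.app H) :=
  (ModuleCat.mono_iff_injective _).1 ((NatTrans.mono_iff_mono_app f).1 inferInstance H)

theorem injective_app_of_ker {X Y : VecSystem G} (f : X ⟶ Y) (H : OrbitCat G)
    (h : ∀ x, f.app H x = 0 → x = 0) : Function.Injective (f.app H) :=
  (injective_iff_map_eq_zero _).2 h

theorem isIso_of_bijective {X Y : VecSystem G} (f : X ⟶ Y)
    (hf : ∀ H, Function.Bijective (f.app H)) : IsIso f := by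
  rw [NatTrans.isIso_iff_isIso_app]
  exact fun H => (ConcreteCategory.isIso_iff_bijective _).2 (hf H)

theorem bijective_of_isIso {X Y : VecSystem G} (f : X ⟶ Y) [IsIso f] (H : OrbitCat G) :
    Function.Bijective (f.app H) :=
  (ConcreteCategory.isIso_iff_bijective _).1 inferInstance

/-- Maps into an injective system extend along any map whose kernel they annihilate. -/
theorem exists_extension {X Y Z : VecSystem G} (hX : Injective X) (u : Y ⟶ Z) (v : Y ⟶ X)
    (h : ∀ H y, u.app H y = 0 → v.app H y = 0) : ∃ g : Z ⟶ X, u ≫ g = v := by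
  have hex := ShortComplex.exact_kernel u
  have hz : Limits.kernel.ι u ≫ v = 0 := by
    apply hom_ext
    intro H x
    refine h H _ ?_
    exact apply_of_comp_eq (Limits.kernel.condition u) x
  exact ⟨hex.descToInjective v hz, hex.comp_descToInjective v hz⟩

theorem injective_of_extension {X : VecSystem G}
    (h : ∀ (A Y : VecSystem G) (i : A ⟶ Y) (f : A ⟶ X), (∀ H, Function.Injective (i.app H)) →
      ∃ g : Y ⟶ X, i ≫ g = f) : Injective X where
  factors f i _ := h _ _ i f (injective_of_mono i)

theorem injective_of_retract {X Y : VecSystem G} (hY : Injective Y) (i : X ⟶ Y) (r : Y ⟶ X)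
    (h : ∀ H x, r.app H (i.app H x) = x) : Injective X :=
  (Retract.mk i r (hom_ext fun H x => h H x)).injective

/-- An injective map out of an injective system is onto as soon as its image contains a subset
over which the target is essential. -/
theorem bijective_of_essential {I J : VecSystem G} (hI : Injective I) (f : I ⟶ J)
    (hf : ∀ H, Function.Injective (f.app H)) (S : ∀ H, Set (J.obj H))
    (hS : ∀ H, ∀ v ∈ S H, ∃ x, f.app H x = v)
    (ess : ∀ g : J ⟶ I, (∀ H, ∀ v ∈ S H, g.app H v = 0 → v = 0) →
      ∀ H, Function.Injective (g.app H)) (H : OrbitCat G) :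
    Function.Bijective (f.app H) := by
  -- Injectivity of `I` splits `f`. The retraction `s` is injective on `S`, which lies in the image
  -- of `f`, hence injective everywhere by essentiality; an injective retraction is inverse to `f`.
  obtain ⟨s, hs⟩ := exists_extension hI f (𝟙 I) (fun H y hy => by
    simpa using (injective_iff_map_eq_zero _).1 (hf H) y hy)
  have hs' : ∀ H x, s.app H (f.app H x) = x := fun H x => apply_of_comp_eq hs x
  have hinj := ess s (fun H v hv h0 => by
    obtain ⟨x, rfl⟩ := hS H v hv
    rw [hs'] at h0
    rw [h0, map_zero])
  exact ⟨hf H, fun y => ⟨s.app H y, hinj H (hs' H _)⟩⟩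

/-- The pointwise product of two systems. -/
def prod (X Y : VecSystem G) : VecSystem G where
  obj H := ModuleCat.of ℚ (X.obj H × Y.obj H)
  map f := ModuleCat.ofHom ((X.map f).hom.prodMap (Y.map f).hom)
  map_id H := by ext x <;> simp
  map_comp f g := by ext x <;> simp

theorem prod_injective {X Y : VecSystem G} (hX : Injective X) (hY : Injective Y) :
    Injective (prod X Y) := by
  refine injective_of_extension fun A Z i f hi => ?_
  have hker : ∀ (B : VecSystem G) (f : A ⟶ B) H y, i.app H y = 0 → f.app H y = 0 :=
    fun B f H y hy => by rw [(injective_iff_map_eq_zero _).1 (hi H) y hy, map_zero]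
  let p₁ : prod X Y ⟶ X := mkHom (fun H => LinearMap.fst ℚ (X.obj H) (Y.obj H)) fun _ _ => rfl
  let p₂ : prod X Y ⟶ Y := mkHom (fun H => LinearMap.snd ℚ (X.obj H) (Y.obj H)) fun _ _ => rfl
  obtain ⟨g₁, h₁⟩ := exists_extension hX i (f ≫ p₁) (hker _ _)
  obtain ⟨g₂, h₂⟩ := exists_extension hY i (f ≫ p₂) (hker _ _)
  refine ⟨mkHom (Y := prod X Y) (fun H => (g₁.app H).hom.prod (g₂.app H).hom) ?_, ?_⟩
  · intro H K g x
    exact Prod.ext (map_apply_comm g₁ g x) (map_apply_comm g₂ g x)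
  · refine hom_ext fun H x => Prod.ext ?_ ?_
    · exact apply_of_comp_eq h₁ x
    · exact apply_of_comp_eq h₂ x

/-- A family of subspaces stable under the structure maps. -/
def IsSub (X : VecSystem G) (S : ∀ H, Submodule ℚ (X.obj H)) : Prop :=
  ∀ ⦃H K : OrbitCat G⦄ (f : H ⟶ K), ∀ x ∈ S H, X.map f x ∈ S K

/-- A stable family of subspaces, as a system. -/
def sub (X : VecSystem G) (S : ∀ H, Submodule ℚ (X.obj H)) (hS : IsSub X S) : VecSystem G where
  obj H := ModuleCat.of ℚ (S H)
  map f := ModuleCat.ofHom ((X.map f).hom.restrict (hS f))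
  map_id H := by
    refine ModuleCat.hom_ext (LinearMap.ext fun x => Subtype.ext ?_)
    exact map_id_apply X (x : S H).1
  map_comp {H K L} f g := by
    refine ModuleCat.hom_ext (LinearMap.ext fun x => Subtype.ext ?_)
    exact map_comp_apply X f g (x : S H).1

/-- A stable family of subspaces has a complement up to an essential extension. -/
theorem exists_essential_complement (X : VecSystem G) (B : ∀ H, Submodule ℚ (X.obj H)) :
    ∃ C : ∀ H, Submodule ℚ (X.obj H), IsSub X C ∧ B ⊓ C = ⊥ ∧
      ∀ D : ∀ H, Submodule ℚ (X.obj H), IsSub X D → D ⊓ (B ⊔ C) = ⊥ → D = ⊥ := by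
  obtain ⟨C, hC⟩ := zorn_le₀ {C : ∀ H, Submodule ℚ (X.obj H) | IsSub X C ∧ B ⊓ C = ⊥} (by
    intro c hc hchain
    by_cases hne : c.Nonempty
    -- The supremum of a nonempty chain is the union at each orbit, so both conditions pass to it
    -- elementwise.
    · have hmem : ∀ H x, x ∈ (sSup c) H ↔ ∃ C ∈ c, x ∈ C H := by
        intro H x
        rw [sSup_apply]
        have : Nonempty c := hne.to_subtype
        rw [Submodule.mem_iSup_of_directed]
        · simp
        · rintro ⟨a, ha⟩ ⟨b, hb⟩
          rcases hchain.total ha hb with h | h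
          · exact ⟨⟨b, hb⟩, h H, le_rfl⟩
          · exact ⟨⟨a, ha⟩, le_rfl, h H⟩
      refine ⟨sSup c, ⟨?_, ?_⟩, fun C hC => le_sSup hC⟩
      · intro H K f x hx
        obtain ⟨C, hC, hx⟩ := (hmem H x).1 hx
        exact (hmem K _).2 ⟨C, hC, (hc hC).1 f x hx⟩
      · refine eq_bot_iff.2 fun H x hx => ?_
        obtain ⟨C, hC, hx'⟩ := (hmem H x).1 hx.2
        have := (hc hC).2
        rw [← this]
        exact ⟨hx.1, hx'⟩
    · refine ⟨⊥, ⟨?_, inf_bot_eq _⟩, fun C hC => (hne ⟨C, hC⟩).elim⟩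
      intro H K f x hx
      have : x = 0 := hx
      subst this
      rw [map_zero]
      exact Submodule.zero_mem _)
  refine ⟨C, hC.prop.1, hC.prop.2, fun D hD hDB => ?_⟩
  have hdisj : ∀ H x, x ∈ B H → x ∈ C H → x = 0 := fun H x hb hc => by
    have h : x ∈ (B ⊓ C) H := ⟨hb, hc⟩
    rw [hC.prop.2] at h
    exact h
  have hdisj' : ∀ H x, x ∈ D H → x ∈ B H ⊔ C H → x = 0 := fun H x hb hc => by
    have h : x ∈ (D ⊓ (B ⊔ C)) H := ⟨hb, hc⟩
    rw [hDB] at h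
    exact h
  -- If `D` meets `B + C` trivially then `C + D` still meets `B` trivially, so maximality puts `D`
  -- inside `C`, where it must vanish.
  have hle : C ⊔ D ≤ C := by
    refine hC.le_of_ge ⟨?_, ?_⟩ le_sup_left
    · intro H K f x hx
      obtain ⟨y, hy, z, hz, rfl⟩ := Submodule.mem_sup.1 hx
      rw [map_add]
      exact Submodule.add_mem_sup (hC.prop.1 f y hy) (hD f z hz)
    · refine eq_bot_iff.2 fun H x hx => ?_
      obtain ⟨y, hy, z, hz, rfl⟩ := Submodule.mem_sup.1 hx.2
      have hz0 : z = 0 := hdisj' H z hz (by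
        have := Submodule.sub_mem _ (Submodule.mem_sup_left (T := C H) hx.1)
          (Submodule.mem_sup_right (S := B H) hy)
        rwa [add_sub_cancel_left] at this)
      subst hz0
      have := hdisj H y (by simpa using hx.1) hy
      simp [this]
  refine eq_bot_iff.2 fun H x hx => ?_
  exact hdisj' H x hx (Submodule.mem_sup_right (hle H (Submodule.mem_sup_right hx)))

/-- An automorphism of `Y` that induces one of the image of `δ : Y → X` lifts to an automorphism
of the injective system `X`. -/
theorem exists_automorphism_extending {X Y : VecSystem G} (hX : Injective X) (δ : Y ⟶ X)
    (e : Y ⟶ Y) (he : ∀ H, Function.Surjective (e.app H))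
    (hδ : ∀ H y, δ.app H (e.app H y) = 0 ↔ δ.app H y = 0) :
    ∃ e' : X ⟶ X, δ ≫ e' = e ≫ δ ∧ ∀ H, Function.Bijective (e'.app H) := by
  obtain ⟨C, hC, hBC, hess⟩ := exists_essential_complement X
    fun H => LinearMap.range (δ.app H).hom
  have hdisj : ∀ H y (c : X.obj H), c ∈ C H → δ.app H y + c = 0 → δ.app H y = 0 ∧ c = 0 := by
    intro H y c hc h
    have hc' : c = 0 := by
      have h1 : c ∈ ((fun H => LinearMap.range (δ.app H).hom) ⊓ C) H := by
        refine ⟨⟨-y, ?_⟩, hc⟩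
        rw [map_neg]
        exact neg_eq_of_add_eq_zero_right h
      rw [hBC] at h1
      exact h1
    subst hc'
    exact ⟨by simpa using h, rfl⟩
  -- The image of `u` is `im δ ⊕ C`, over which `X` is essential. The map wanted on it is the one
  -- induced by `e` on `im δ` and the identity on `C`; it is `v` read through `u`, well defined
  -- because `e` preserves the kernel of `δ`.
  let u : prod Y (sub X C hC) ⟶ X := mkHom
    (fun H => (δ.app H).hom.coprod (C H).subtype) fun {H K} g x => by
      refine Eq.trans ?_ (map_add _ _ _).symm
      exact congrArg₂ (· + ·) (map_apply_comm δ g x.1) rfl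
  let v : prod Y (sub X C hC) ⟶ X := mkHom
    (fun H => ((e ≫ δ).app H).hom.coprod (C H).subtype) fun {H K} g x => by
      refine Eq.trans ?_ (map_add _ _ _).symm
      exact congrArg₂ (· + ·) (map_apply_comm (e ≫ δ) g x.1) rfl
  obtain ⟨e', he'⟩ := exists_extension hX u v (by
    rintro H ⟨y, c⟩ h
    obtain ⟨h1, h2⟩ := hdisj H y (c : C H).1 (c : C H).2 h
    change δ.app H (e.app H y) + (c : C H).1 = 0
    rw [(hδ H y).2 h1, h2, zero_add])
  have key : ∀ H (y : Y.obj H) (c : C H),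
      e'.app H (δ.app H y + c) = δ.app H (e.app H y) + c := fun H y c =>
    apply_of_comp_eq he' (H := H) (y, c)
  have ess : ∀ g : X ⟶ X, (∀ H, ∀ v ∈ {v | ∃ (y : Y.obj H) (c : C H), v = δ.app H y + c},
      g.app H v = 0 → v = 0) → ∀ H, Function.Injective (g.app H) := by
    intro g hg
    have := hess (fun H => LinearMap.ker (g.app H).hom)
      (fun H K f x hx => by
        have hx' : g.app H x = 0 := hx
        change g.app K (X.map f x) = 0
        rw [map_apply_comm, hx', map_zero])
      (eq_bot_iff.2 fun H x hx => by
        obtain ⟨y, ⟨z, rfl⟩, c, hc, rfl⟩ := Submodule.mem_sup.1 hx.2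
        exact hg H _ ⟨z, ⟨c, hc⟩, rfl⟩ hx.1)
    intro H
    exact LinearMap.ker_eq_bot.1 (congrFun this H)
  refine ⟨e', hom_ext fun H y => ?_, ?_⟩
  · simpa using key H y 0
  -- On `im δ ⊕ C` the map `e'` is injective since `e` reflects the kernel of `δ`, and onto since
  -- `e` is onto. Essentiality spreads both properties to all of `X`.
  · refine bijective_of_essential hX e' (ess e' ?_)
      (fun H => {v | ∃ (y : Y.obj H) (c : C H), v = δ.app H y + c}) ?_ ess
    · rintro H v ⟨y, c, rfl⟩ h
      rw [key] at h
      obtain ⟨h1, h2⟩ := hdisj H _ c c.2 h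
      rw [(hδ H y).1 h1, h2, zero_add]
    · rintro H v ⟨y, c, rfl⟩
      obtain ⟨y', rfl⟩ := he H y
      exact ⟨_, key H y' c⟩

end VecSystem

end SystemBasics

/-! ### Morphisms of the orbit category -/

namespace OrbitCat

variable {G : Type u} [Group G]

/-- The map of orbits underlying a morphism. -/
def fn {H K : OrbitCat G} (f : H ⟶ K) : G ⧸ H.sub → G ⧸ K.sub :=
  fun x => (show (G ⧸ H.sub) →[G] (G ⧸ K.sub) from f) x

theorem fn_smul {H K : OrbitCat G} (f : H ⟶ K) (g : G) (x : G ⧸ H.sub) :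
    fn f (g • x) = g • fn f x :=
  map_smul (show (G ⧸ H.sub) →[G] (G ⧸ K.sub) from f) g x

theorem fn_comp {H K L : OrbitCat G} (f : H ⟶ K) (g : K ⟶ L) (x : G ⧸ H.sub) :
    fn (f ≫ g) x = fn g (fn f x) := rfl

theorem fn_id (H : OrbitCat G) (x : G ⧸ H.sub) : fn (𝟙 H) x = x := rfl

theorem hom_ext_fn {H K : OrbitCat G} {f g : H ⟶ K} (h : ∀ x, fn f x = fn g x) : f = g := by
  apply MulActionHom.ext
  exact h

theorem hom_eq_of_point {H K : OrbitCat G} {f g : H ⟶ K} (x : G ⧸ H.sub)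
    (h : fn f x = fn g x) : f = g := by
  refine hom_ext_fn fun y => ?_
  obtain ⟨a, rfl⟩ := MulAction.exists_smul_eq G x y
  rw [fn_smul, fn_smul, h]

theorem fn_surjective {H K : OrbitCat G} (f : H ⟶ K) : Function.Surjective (fn f) := by
  intro y
  obtain ⟨a, rfl⟩ := MulAction.exists_smul_eq G (fn f (QuotientGroup.mk 1)) y
  exact ⟨a • QuotientGroup.mk 1, fn_smul _ _ _⟩

/-- Maps of orbits are onto, so every morphism is an epimorphism. This makes the extension by zero
along `f` well defined and lets sums over morphisms be reindexed along precomposition. -/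
theorem comp_left_cancel {H K L : OrbitCat G} (f : H ⟶ K) {g h : K ⟶ L} (e : f ≫ g = f ≫ h) :
    g = h := by
  refine hom_ext_fn fun y => ?_
  obtain ⟨x, rfl⟩ := fn_surjective f y
  rw [← fn_comp, e, fn_comp]

theorem exists_hom {H K : OrbitCat G} (x : G ⧸ H.sub) (y : G ⧸ K.sub)
    (h : MulAction.stabilizer G x ≤ MulAction.stabilizer G y) : ∃ f : H ⟶ K, fn f x = y := by
  have key : ∀ a b : G, a • x = b • x → a • y = b • y := fun a b hab => by
    have : b⁻¹ * a ∈ MulAction.stabilizer G x := by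
      rw [MulAction.mem_stabilizer_iff, mul_smul, hab, inv_smul_smul]
    have := h this
    rw [MulAction.mem_stabilizer_iff, mul_smul, inv_smul_eq_iff] at this
    exact this
  choose a ha using MulAction.exists_smul_eq G x
  let f : (G ⧸ H.sub) →[G] (G ⧸ K.sub) :=
    { toFun := fun z => a z • y
      map_smul' := fun g z => by
        change a (g • z) • y = g • a z • y
        rw [smul_smul]
        apply key
        rw [ha, mul_smul, ha] }
  refine ⟨f, ?_⟩
  change a x • y = y
  have := key (a x) 1 (by rw [ha, one_smul])
  rwa [one_smul] at this

theorem stabilizer_le_fn {H K : OrbitCat G} (f : H ⟶ K) (x : G ⧸ H.sub) :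
    MulAction.stabilizer G x ≤ MulAction.stabilizer G (fn f x) := fun g hg => by
  rw [MulAction.mem_stabilizer_iff] at hg ⊢
  rw [← fn_smul, hg]

theorem stabilizer_one (H : OrbitCat G) :
    MulAction.stabilizer G (QuotientGroup.mk 1 : G ⧸ H.sub) = H.sub :=
  MulAction.stabilizer_quotient H.sub

/-- A substitute for the pushout of `f` and `g`. -/
theorem exists_weak_pushout {H K L : OrbitCat G} (f : H ⟶ K) (g : H ⟶ L) :
    ∃ (Q : OrbitCat G) (h : K ⟶ Q),
      (∀ (M : OrbitCat G) (k : K ⟶ M) (l : L ⟶ M), f ≫ k = g ≫ l → ∃ q : Q ⟶ M, h ≫ q = k) ∧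
      (Function.Injective (fn h) → ∃ l : L ⟶ K, g ≫ l = f) := by
  obtain ⟨x, hx⟩ := fn_surjective f (QuotientGroup.mk 1)
  -- `x` lies over the base point of `G/K`. If `f ≫ k = g ≫ l`, the image of that point under `k` is
  -- fixed by `K` and by the stabilizer of `g x`, hence by the subgroup they generate. If `G/K →
  -- G/Q` is injective, that stabilizer already lies in `K`, which is what a map `L ⟶ K` requires.
  let Q : OrbitCat G := ⟨K.sub ⊔ MulAction.stabilizer G (fn g x)⟩
  let y₀ : G ⧸ K.sub := QuotientGroup.mk 1
  let q₀ : G ⧸ Q.sub := QuotientGroup.mk 1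
  have hK : MulAction.stabilizer G y₀ = K.sub := stabilizer_one K
  have hQ : MulAction.stabilizer G q₀ = Q.sub := stabilizer_one Q
  obtain ⟨h, hh⟩ := exists_hom y₀ q₀ (by rw [hK, hQ]; exact le_sup_left)
  refine ⟨Q, h, fun M k l e => ?_, fun hinj => ?_⟩
  · have e' : fn k y₀ = fn l (fn g x) := by rw [← fn_comp, ← e, fn_comp, hx]
    obtain ⟨q, hq⟩ := exists_hom q₀ (fn k y₀) (by
      rw [hQ]
      refine sup_le (hK ▸ stabilizer_le_fn k y₀) ?_
      rw [e']
      exact stabilizer_le_fn l _)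
    exact ⟨q, hom_eq_of_point y₀ (by rw [fn_comp, hh, hq])⟩
  · obtain ⟨l, hl⟩ := exists_hom (fn g x) y₀ (fun a ha => by
      rw [MulAction.mem_stabilizer_iff]
      apply hinj
      rw [fn_smul, hh]
      have : a ∈ MulAction.stabilizer G q₀ := by rw [hQ]; exact Subgroup.mem_sup_right ha
      exact this)
    exact ⟨l, hom_eq_of_point x (by rw [fn_comp, hl, hx])⟩

theorem exists_inverse {H K : OrbitCat G} (f : H ⟶ K) (hf : Function.Injective (fn f)) :
    ∃ g : K ⟶ H, f ≫ g = 𝟙 H := by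
  let x₀ : G ⧸ H.sub := QuotientGroup.mk 1
  obtain ⟨g, hg⟩ := exists_hom (fn f x₀) x₀ (fun a ha => by
    rw [MulAction.mem_stabilizer_iff] at ha ⊢
    apply hf
    rw [fn_smul, ha])
  exact ⟨g, hom_eq_of_point x₀ (by rw [fn_comp, hg, fn_id])⟩

instance [Finite G] : Finite (OrbitCat G) :=
  Finite.of_injective (fun H : OrbitCat G => H.sub) fun H K h => by
    cases H; cases K; congr

instance [Finite G] (H K : OrbitCat G) : Finite (H ⟶ K) :=
  Finite.of_injective (fun f : H ⟶ K => fn f) fun _ _ h => hom_ext_fn fun x => congrFun h x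

theorem card_lt_of_not_injective [Finite G] {H K : OrbitCat G} (f : H ⟶ K)
    (hf : ¬ Function.Injective (fn f)) : Nat.card (G ⧸ K.sub) < Nat.card (G ⧸ H.sub) := by
  refine lt_of_le_of_ne (Nat.card_le_card_of_surjective _ (fn_surjective f)) fun h => hf ?_
  exact ((Nat.bijective_iff_surjective_and_card _).2 ⟨fn_surjective f, h.symm⟩).1

theorem not_injective_comp {H K L : OrbitCat G} (f : H ⟶ K) (g : K ⟶ L)
    (hg : ¬ Function.Injective (fn g)) : ¬ Function.Injective (fn (f ≫ g)) := fun h =>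
  hg <| Function.Injective.of_comp_right (f := fn g) (g := fn f) h (fn_surjective f)

end OrbitCat

/-! ### Coinduced systems, and injectivity from coherent sections -/

/-- A finite commuting family of idempotents has a projection onto its common kernel. -/
theorem exists_projection_of_commuting {M ι : Type*} [AddCommGroup M] [Module ℚ M]
    (ε : ι → Module.End ℚ M) (hc : ∀ i j, ε i * ε j = ε j * ε i) (hi : ∀ i, ε i * ε i = ε i)
    (s : Finset ι) :
    ∃ p : Module.End ℚ M, (∀ i ∈ s, ε i * p = 0) ∧ (∀ i ∈ s, p * ε i = 0) ∧
      (∀ x, (∀ i ∈ s, ε i x = 0) → p x = x) ∧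
      (∀ x, x - p x ∈ ⨆ i ∈ s, LinearMap.range (ε i)) ∧ ∀ j, ε j * p = p * ε j := by
  classical
  induction s using Finset.induction_on with
  | empty => exact ⟨1, by simp, by simp, by simp, by simp, by simp⟩
  | insert i s _ ih =>
    obtain ⟨p, h1, h2, h3, h4, h5⟩ := ih
    -- Altogether `p` is the product of the factors `1 - ε i`. Commutation with every `ε j`, also
    -- outside `s`, is carried along to keep the induction going.
    refine ⟨(1 - ε i) * p, fun j hj => ?_, fun j hj => ?_, fun x hx => ?_, fun x => ?_,
      fun j => ?_⟩
    · rw [← mul_assoc, mul_sub, mul_one]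
      rcases Finset.mem_insert.1 hj with rfl | hj
      · rw [hi, sub_self, zero_mul]
      · rw [sub_mul, h1 j hj, hc, mul_assoc, h1 j hj, mul_zero, sub_zero]
    · rw [mul_assoc, ← h5, ← mul_assoc, sub_mul, one_mul]
      rcases Finset.mem_insert.1 hj with rfl | hj
      · rw [hi, sub_self, zero_mul]
      · rw [sub_mul, h1 j hj, mul_assoc, h1 j hj, mul_zero, sub_zero]
    · have hp := h3 x fun j hj => hx j (Finset.mem_insert_of_mem hj)
      simp [hp, hx i (Finset.mem_insert_self i s)]
    · have : x - ((1 - ε i) * p) x = (x - p x) + ε i (p x) := by simp; abel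
      rw [this]
      refine add_mem ?_ ?_
      · exact (iSup₂_le (fun j hj => le_iSup₂_of_le
          (f := fun j (_ : j ∈ insert i s) => LinearMap.range (ε j)) j
          (Finset.mem_insert_of_mem hj) le_rfl) :
            (⨆ j ∈ s, LinearMap.range (ε j)) ≤ _) (h4 x)
      · exact (le_iSup₂_of_le (f := fun j (_ : j ∈ insert i s) => LinearMap.range (ε j)) i
          (Finset.mem_insert_self i s) le_rfl) ⟨p x, rfl⟩
    · rw [mul_assoc, ← h5, ← mul_assoc, ← mul_assoc, mul_sub, sub_mul 1, hc i j, mul_one, one_mul]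

namespace VecSystem

variable {G : Type u} [Group G]

/-- The system coinduced from a family of vector spaces. -/
def coind (U : OrbitCat G → ModuleCat.{u} ℚ) : VecSystem G where
  obj T := ModuleCat.of ℚ (∀ K : OrbitCat G, (T ⟶ K) → U K)
  map f := ModuleCat.ofHom
    { toFun := fun y K k => y K (f ≫ k)
      map_add' := fun _ _ => rfl
      map_smul' := fun _ _ => rfl }
  map_id T := by
    refine ModuleCat.hom_ext (LinearMap.ext fun y => ?_)
    funext K k
    exact congrArg (y K) (Category.id_comp k)
  map_comp f g := by
    refine ModuleCat.hom_ext (LinearMap.ext fun y => ?_)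
    funext K k
    exact congrArg (y K) (Category.assoc f g k)

/-- A map into `coind U` amounts to an arbitrary family of linear maps `A(K) → U K`, obtained by
evaluating at identities. No naturality constrains the family, so it extends along linear
retractions chosen at each orbit separately. -/
theorem coind_injective (U : OrbitCat G → ModuleCat.{u} ℚ) : Injective (coind U) := by
  refine injective_of_extension fun A Y i f hi => ?_
  choose r hr using fun H => LinearMap.exists_leftInverse_of_injective (i.app H).hom
    (LinearMap.ker_eq_bot.2 (hi H))
  have hr' : ∀ H x, r H (i.app H x) = x := fun H x => LinearMap.congr_fun (hr H) x
  let ev : ∀ K, A.obj K →ₗ[ℚ] U K := fun K =>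
    { toFun := fun a => (show ∀ L : OrbitCat G, (K ⟶ L) → U L from f.app K a) K (𝟙 K)
      map_add' := fun a b => by rw [map_add]; rfl
      map_smul' := fun c a => by rw [map_smul]; rfl }
  refine ⟨mkHom (Y := coind U) (fun H =>
    { toFun := fun y K k => ev K (r K (Y.map k y))
      map_add' := fun a b => by
        funext K k
        simp only [map_add]
        rfl
      map_smul' := fun c a => by
        funext K k
        simp only [map_smul]
        rfl }) ?_, ?_⟩
  · intro H K g x
    funext L k
    change ev L (r L (Y.map k (Y.map g x))) = ev L (r L (Y.map (g ≫ k) x))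
    rw [map_comp_apply]
  · refine hom_ext fun H x => ?_
    funext K k
    change ev K (r K (Y.map k (i.app H x))) =
      (show ∀ L : OrbitCat G, (H ⟶ L) → U L from f.app H x) K k
    rw [← map_apply_comm, hr']
    have := map_apply_comm f k x
    change (show ∀ L : OrbitCat G, (K ⟶ L) → U L from f.app K (A.map k x)) K (𝟙 K) = _
    rw [this]
    exact congrArg _ (Category.comp_id k)

/-- The canonical embedding of a system into a coinduced one. -/
def toCoind (X : VecSystem G) : X ⟶ coind X.obj :=
  mkHom (Y := coind X.obj) (fun H =>
    { toFun := fun x K k => X.map k x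
      map_add' := fun a b => by
        funext K k
        exact map_add _ _ _
      map_smul' := fun c a => by
        funext K k
        exact map_smul _ _ _ }) fun {H K} g x => by
    funext L k
    exact (map_comp_apply X g k x).symm

theorem toCoind_injective (X : VecSystem G) (H : OrbitCat G) :
    Function.Injective ((toCoind X).app H) := fun x y h => by
  have := congrFun (congrFun (show (fun K k => X.map k x : ∀ K : OrbitCat G, (H ⟶ K) → X.obj K) =
    fun K k => X.map k y from h) H) (𝟙 H)
  simpa using this

theorem exists_coind_retraction {X : VecSystem G} (hX : Injective X) :
    ∃ r : coind X.obj ⟶ X, toCoind X ≫ r = 𝟙 X :=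
  exists_extension hX _ _ fun H y hy => by
    rw [(injective_iff_map_eq_zero _).1 (toCoind_injective X H) y hy, map_zero]

/-- Coherent sections of the structure maps of a system. -/
structure Sections (X : VecSystem G) where
  s : ∀ {H K : OrbitCat G}, (H ⟶ K) → (X.obj K →ₗ[ℚ] X.obj H)
  sec : ∀ {H K : OrbitCat G} (f : H ⟶ K), (X.map f).hom ∘ₗ s f = LinearMap.id
  comp : ∀ {H K L : OrbitCat G} (f : H ⟶ K) (g : K ⟶ L), s (f ≫ g) = s f ∘ₗ s g
  comm : ∀ {H K L : OrbitCat G} (f : H ⟶ K) (g : H ⟶ L),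
    (s f ∘ₗ (X.map f).hom) ∘ₗ (s g ∘ₗ (X.map g).hom) =
      (s g ∘ₗ (X.map g).hom) ∘ₗ (s f ∘ₗ (X.map f).hom)
  base_left : ∀ {H K L Q : OrbitCat G} (f : H ⟶ K) (g : H ⟶ L) (h : K ⟶ Q),
    (∀ (M : OrbitCat G) (k : K ⟶ M) (l : L ⟶ M), f ≫ k = g ≫ l → ∃ q : Q ⟶ M, h ≫ q = k) →
      (X.map f).hom ∘ₗ s g = (s h ∘ₗ (X.map h).hom) ∘ₗ ((X.map f).hom ∘ₗ s g)
  base_right : ∀ {H K L Q : OrbitCat G} (f : H ⟶ K) (g : H ⟶ L) (h : K ⟶ Q),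
    (∀ (M : OrbitCat G) (k : K ⟶ M) (l : L ⟶ M), f ≫ k = g ≫ l → ∃ q : Q ⟶ M, h ≫ q = k) →
      (X.map g).hom ∘ₗ s f = ((X.map g).hom ∘ₗ s f) ∘ₗ (s h ∘ₗ (X.map h).hom)

namespace Sections

variable {X : VecSystem G} (S : Sections X)

theorem map_s {H K : OrbitCat G} (f : H ⟶ K) (x : X.obj K) : X.map f (S.s f x) = x :=
  LinearMap.congr_fun (S.sec f) x

theorem s_comp {H K L : OrbitCat G} (f : H ⟶ K) (g : K ⟶ L) (x : X.obj L) :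
    S.s (f ≫ g) x = S.s f (S.s g x) :=
  LinearMap.congr_fun (S.comp f g) x

/-- With `f ≫ g = 𝟙`, functoriality of the sections gives `s f ∘ s g = id`, so `s f` is onto. Being
a section of `X.map f` it is also injective, hence a two-sided inverse. -/
theorem s_map_of_injective {H K : OrbitCat G} (f : H ⟶ K)
    (hf : Function.Injective (OrbitCat.fn f)) (x : X.obj H) : S.s f (X.map f x) = x := by
  obtain ⟨g, hg⟩ := OrbitCat.exists_inverse f hf
  have h1 : ∀ y, S.s f (S.s g y) = y := fun y => by
    rw [← S.s_comp, hg]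
    simpa using S.map_s (𝟙 H) y
  conv_lhs => rw [← h1 x, S.map_s]
  exact h1 x

/-- A noninjective morphism leads to a strictly smaller orbit. The idempotents `s h ∘ X.map h` of
these morphisms are finitely many and commute, so there is a projection `p` onto the part of `X(K)`
invisible on smaller orbits, with complement spanned by the images of the `s h`. -/
theorem exists_projection [Finite G] (K : OrbitCat G) :
    ∃ p : X.obj K →ₗ[ℚ] X.obj K,
      (∀ {L : OrbitCat G} (h : K ⟶ L), ¬ Function.Injective (OrbitCat.fn h) →
        (∀ x, S.s h (X.map h (p x)) = 0) ∧ ∀ x, p (S.s h (X.map h x)) = 0) ∧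
      (∀ x, (∀ (L : OrbitCat G) (h : K ⟶ L), ¬ Function.Injective (OrbitCat.fn h) →
        X.map h x = 0) → p x = x) ∧
      ∀ (N : Submodule ℚ (X.obj K)), (∀ (L : OrbitCat G) (h : K ⟶ L),
        ¬ Function.Injective (OrbitCat.fn h) → ∀ x, S.s h x ∈ N) → ∀ x, x - p x ∈ N := by
  let ι := {h : Σ L : OrbitCat G, (K ⟶ L) // ¬ Function.Injective (OrbitCat.fn h.2)}
  have : Fintype ι := Fintype.ofFinite ι
  obtain ⟨p, h1, h2, h3, h4, -⟩ := exists_projection_of_commuting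
    (fun i : ι => (S.s i.1.2 ∘ₗ (X.map i.1.2).hom : Module.End ℚ (X.obj K)))
    (fun i j => S.comm i.1.2 j.1.2)
    (fun i => LinearMap.ext fun x => congrArg (S.s i.1.2) (S.map_s i.1.2 (X.map i.1.2 x)))
    Finset.univ
  refine ⟨p, fun {L} h hh => ⟨fun x => ?_, fun x => ?_⟩, fun x hx => ?_, fun N hN x => ?_⟩
  · exact LinearMap.congr_fun (h1 ⟨⟨L, h⟩, hh⟩ (Finset.mem_univ _)) x
  · exact LinearMap.congr_fun (h2 ⟨⟨L, h⟩, hh⟩ (Finset.mem_univ _)) x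
  · refine h3 x fun i _ => ?_
    have h0 : X.map i.1.2 x = 0 := hx _ i.1.2 i.2
    have : S.s i.1.2 (X.map i.1.2 x) = 0 := by rw [h0, map_zero]
    exact this
  · refine (iSup₂_le fun i _ => ?_ : (⨆ i ∈ (Finset.univ : Finset ι),
      LinearMap.range (S.s i.1.2 ∘ₗ (X.map i.1.2).hom : Module.End ℚ (X.obj K))) ≤ N) (h4 x)
    rintro _ ⟨y, rfl⟩
    exact hN _ i.1.2 i.2 _

/-- A system with coherent sections is injective. -/
theorem injective [Finite G] {X : VecSystem G} (S : Sections X) : Injective X := by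
  choose p hp hp1 hp2 using S.exists_projection
  have hfin : ∀ H : OrbitCat G, Fintype (Σ K : OrbitCat G, (H ⟶ K)) := fun H => Fintype.ofFinite _
  -- When `f` does not factor through `g`, the map `h` out of `K` to the weak pushout is not
  -- injective. The base change axioms insert `s h ∘ X.map h` next to `p K`, and these annihilate
  -- each other.
  have vanish : ∀ {H K L : OrbitCat G} (f : H ⟶ K) (g : H ⟶ L), (¬ ∃ l : L ⟶ K, g ≫ l = f) →
      (∀ x, X.map g (S.s f (p K x)) = 0) ∧ ∀ x, p K (X.map f (S.s g x)) = 0 := by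
    intro H K L f g hfg
    obtain ⟨Q, h, h1, h2⟩ := OrbitCat.exists_weak_pushout f g
    have hh : ¬ Function.Injective (OrbitCat.fn h) := fun hi => hfg (h2 hi)
    refine ⟨fun x => ?_, fun x => ?_⟩
    · have e : X.map g (S.s f (p K x)) = X.map g (S.s f (S.s h (X.map h (p K x)))) :=
        LinearMap.congr_fun (S.base_right f g h h1) (p K x)
      rw [e, (hp K h hh).1, map_zero, map_zero]
    · have e : X.map f (S.s g x) = S.s h (X.map h (X.map f (S.s g x))) :=
        LinearMap.congr_fun (S.base_left f g h h1) x
      rw [e, (hp K h hh).2]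
  have inj : ∀ {H L : OrbitCat G} (g : H ⟶ L), Function.Injective
      (fun k : Σ K : OrbitCat G, (L ⟶ K) => (⟨k.1, g ≫ k.2⟩ : Σ K : OrbitCat G, (H ⟶ K))) := by
    rintro H L g ⟨K, k⟩ ⟨K', k'⟩ h
    obtain ⟨rfl, h⟩ := Sigma.mk.inj_iff.1 h
    exact congrArg (Sigma.mk K) (OrbitCat.comp_left_cancel g (eq_of_heq h))
  -- The map is `y ↦ ∑ s f (p K (y K f))` over all `f : H ⟶ K`. It is natural because `X.map g`
  -- kills the terms whose `f` does not factor through `g`, while the terms `f = g ≫ k` form the sum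
  -- for `L`.
  let ρ : coind X.obj ⟶ X := mkHom
    (fun H => ∑ f : (Σ K : OrbitCat G, (H ⟶ K)), S.s f.2 ∘ₗ p f.1 ∘ₗ
      (LinearMap.proj f.2 : (((H ⟶ f.1) → X.obj f.1) →ₗ[ℚ] X.obj f.1)) ∘ₗ
      (LinearMap.proj f.1 :
        (∀ K : OrbitCat G, (H ⟶ K) → X.obj K) →ₗ[ℚ] ((H ⟶ f.1) → X.obj f.1))) (by
    intro H L g y
    simp only [LinearMap.sum_apply]
    refine Eq.trans ?_ (map_sum (X.map g).hom _ _).symm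
    refine Fintype.sum_of_injective _ (inj g) _ _ ?_ ?_
    · rintro ⟨K, f⟩ hf
      exact (vanish f g fun ⟨l, hl⟩ => hf ⟨⟨K, l⟩, by simp [hl]⟩).1 _
    · rintro ⟨K, k⟩
      change _ = X.map g (S.s (g ≫ k) (p K _))
      rw [S.s_comp, S.map_s]
      rfl)
  have hρ : ∀ H x, (toCoind X ≫ ρ).app H x =
      ∑ f : (Σ K : OrbitCat G, (H ⟶ K)), S.s f.2 (p f.1 (X.map f.2 x)) := by
    intro H x
    exact LinearMap.sum_apply _ _ _
  generalize hθ : toCoind X ≫ ρ = θ at hρ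
  have hθs : ∀ {H L : OrbitCat G} (g : H ⟶ L) (x : X.obj L),
      S.s g (θ.app L x) = θ.app H (S.s g x) := by
    intro H L g x
    rw [hρ, hρ, map_sum]
    refine Fintype.sum_of_injective _ (inj g) _ _ ?_ ?_
    · rintro ⟨K, f⟩ hf
      rw [(vanish f g fun ⟨l, hl⟩ => hf ⟨⟨K, l⟩, by simp [hl]⟩).2, map_zero]
    · rintro ⟨K, k⟩
      change _ = S.s (g ≫ k) (p K (X.map (g ≫ k) (S.s g x)))
      rw [S.s_comp, map_comp_apply, S.map_s]
  -- On vectors killed by all noninjective morphisms, each injective `f` contributes `x` itself and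
  -- the others contribute zero. So `m` is the number of injective morphisms out of `H`, nonzero
  -- because of the identity.
  have hm : ∀ H : OrbitCat G, ∃ m : ℕ, m ≠ 0 ∧ ∀ x : X.obj H,
      (∀ (L : OrbitCat G) (h : H ⟶ L), ¬ Function.Injective (OrbitCat.fn h) → X.map h x = 0) →
        θ.app H x = (m : ℚ) • x := by
    classical
    intro H
    refine ⟨(Finset.univ.filter fun f : (Σ K : OrbitCat G, (H ⟶ K)) =>
      Function.Injective (OrbitCat.fn f.2)).card, ?_, fun x hx => ?_⟩
    · refine Finset.card_ne_zero_of_mem (a := ⟨H, 𝟙 H⟩) ?_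
      rw [Finset.mem_filter]
      exact ⟨Finset.mem_univ _, fun a b h => h⟩
    · rw [hρ, Nat.cast_smul_eq_nsmul, ← Finset.sum_const, Finset.sum_filter]
      refine Finset.sum_congr rfl ?_
      rintro ⟨K, f⟩ -
      split_ifs with hf
      · rw [hp1, S.s_map_of_injective f hf]
        intro L h hh
        rw [← map_comp_apply]
        exact hx _ _ (OrbitCat.not_injective_comp f h hh)
      · rw [hx _ _ hf, map_zero, map_zero]
  -- Induction on the size of the orbit. By naturality a vector in the kernel of `θ` dies on smaller
  -- orbits, so `θ` multiplies it by `m`. For surjectivity, `x - p x` is a sum of values of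
  -- sections, which commute with `θ`, and `p x` is divisible by `m`.
  have hbij : ∀ (n : ℕ) (H : OrbitCat G), Nat.card (G ⧸ H.sub) = n →
      Function.Bijective (θ.app H) := by
    intro n
    induction n using Nat.strong_induction_on with
    | _ n ih =>
      intro H hn
      have ih' : ∀ (L : OrbitCat G) (h : H ⟶ L), ¬ Function.Injective (OrbitCat.fn h) →
          Function.Bijective (θ.app L) := fun L h hh =>
        ih _ (hn ▸ OrbitCat.card_lt_of_not_injective h hh) L rfl
      obtain ⟨m, hm0, hm⟩ := hm H
      refine ⟨(injective_iff_map_eq_zero _).2 fun x hx => ?_, fun x => ?_⟩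
      · have h0 := hm x fun L h hh => by
          refine (injective_iff_map_eq_zero _).1 (ih' L h hh).1 _ ?_
          rw [map_apply_comm, hx, map_zero]
        rw [hx] at h0
        exact (smul_eq_zero.1 h0.symm).resolve_left (by exact_mod_cast hm0)
      · have h1 : x - p H x ∈ LinearMap.range (θ.app H).hom := by
          refine hp2 H _ (fun L h hh y => ?_) x
          obtain ⟨z, rfl⟩ := (ih' L h hh).2 y
          exact ⟨_, (hθs h z).symm⟩
        have h2 : p H x ∈ LinearMap.range (θ.app H).hom := by
          refine ⟨(m : ℚ)⁻¹ • p H x, ?_⟩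
          have := hm (p H x) fun L h hh => by
            rw [← S.map_s h (X.map h (p H x)), (hp H h hh).1, map_zero]
          rw [map_smul]
          refine (congrArg _ this).trans ?_
          rw [smul_smul, inv_mul_cancel₀ (by exact_mod_cast hm0),
            one_smul]
        have := add_mem h1 h2
        rw [sub_add_cancel] at this
        exact this
  have := isIso_of_bijective θ fun H => hbij _ H rfl
  refine injective_of_retract (coind_injective X.obj) (toCoind X) (ρ ≫ inv θ) fun H x => ?_
  have : toCoind X ≫ ρ ≫ inv θ = 𝟙 X := by rw [← Category.assoc, hθ, IsIso.hom_inv_id]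
  exact apply_of_comp_eq (g := ρ ≫ inv θ) this x

end Sections

end VecSystem

/-! ### Free graded commutative algebras inherit coherent sections -/

/-- The relations of the free graded commutative algebra on vector spaces `W p` in degree `p`. -/
inductive GradedSymRel (W : ℕ → Type u) [∀ p, AddCommGroup (W p)] [∀ p, Module ℚ (W p)] :
    FreeAlgebra ℚ (Σ p, W p) → FreeAlgebra ℚ (Σ p, W p) → Prop
  | add (p : ℕ) (x y : W p) : GradedSymRel W (FreeAlgebra.ι ℚ ⟨p, x + y⟩)
      (FreeAlgebra.ι ℚ ⟨p, x⟩ + FreeAlgebra.ι ℚ ⟨p, y⟩)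
  | smul (p : ℕ) (c : ℚ) (x : W p) : GradedSymRel W (FreeAlgebra.ι ℚ ⟨p, c • x⟩)
      (c • FreeAlgebra.ι ℚ ⟨p, x⟩)
  | comm (p q : ℕ) (x : W p) (y : W q) :
      GradedSymRel W (FreeAlgebra.ι ℚ ⟨p, x⟩ * FreeAlgebra.ι ℚ ⟨q, y⟩)
      ((-1 : ℚ) ^ (p * q) • (FreeAlgebra.ι ℚ ⟨q, y⟩ * FreeAlgebra.ι ℚ ⟨p, x⟩))

/-- The free graded commutative algebra on vector spaces `W p` in degree `p`. -/
abbrev GradedSym (W : ℕ → Type u) [∀ p, AddCommGroup (W p)] [∀ p, Module ℚ (W p)] : Type u :=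
  RingQuot (GradedSymRel W)

namespace GradedSym

variable {W W' W₂ : ℕ → Type u} [∀ p, AddCommGroup (W p)] [∀ p, Module ℚ (W p)]
  [∀ p, AddCommGroup (W' p)] [∀ p, Module ℚ (W' p)]
  [∀ p, AddCommGroup (W₂ p)] [∀ p, Module ℚ (W₂ p)]

/-- The inclusion of the generators. -/
def ι (p : ℕ) : W p →ₗ[ℚ] GradedSym W where
  toFun x := RingQuot.mkAlgHom ℚ (GradedSymRel W) (FreeAlgebra.ι ℚ ⟨p, x⟩)
  map_add' x y := by
    simpa using RingQuot.mkAlgHom_rel ℚ (GradedSymRel.add (W := W) p x y)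
  map_smul' c x := by
    simpa using RingQuot.mkAlgHom_rel ℚ (GradedSymRel.smul (W := W) p c x)

theorem ι_comm (p q : ℕ) (x : W p) (y : W q) :
    ι p x * ι q y = (-1 : ℚ) ^ (p * q) • (ι q y * ι p x) := by
  simpa [ι] using RingQuot.mkAlgHom_rel ℚ (GradedSymRel.comm (W := W) p q x y)

/-- The universal property. -/
def lift {B : Type*} [Ring B] [Algebra ℚ B] (f : ∀ p, W p →ₗ[ℚ] B)
    (hf : ∀ p q x y, f p x * f q y = (-1 : ℚ) ^ (p * q) • (f q y * f p x)) :
    GradedSym W →ₐ[ℚ] B :=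
  RingQuot.liftAlgHom ℚ ⟨FreeAlgebra.lift ℚ fun x => f x.1 x.2, fun x y h => by
    induction h with
    | add p x y => simp
    | smul p c x => simp
    | comm p q x y => simpa using hf p q x y⟩

@[simp]
theorem lift_ι {B : Type*} [Ring B] [Algebra ℚ B] (f : ∀ p, W p →ₗ[ℚ] B)
    (hf : ∀ p q x y, f p x * f q y = (-1 : ℚ) ^ (p * q) • (f q y * f p x)) (p : ℕ) (x : W p) :
    lift f hf (ι p x) = f p x := by
  simp [lift, ι]

theorem algHom_ext {B : Type*} [Ring B] [Algebra ℚ B] {f g : GradedSym W →ₐ[ℚ] B}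
    (h : ∀ p x, f (ι p x) = g (ι p x)) : f = g := by
  apply RingQuot.ringQuot_ext'
  apply FreeAlgebra.hom_ext
  funext x
  exact h x.1 x.2

/-- Functoriality in the generators. -/
def map (φ : ∀ p, W p →ₗ[ℚ] W' p) : GradedSym W →ₐ[ℚ] GradedSym W' :=
  lift (fun p => ι p ∘ₗ φ p) fun p q x y => ι_comm p q (φ p x) (φ q y)

@[simp]
theorem map_ι (φ : ∀ p, W p →ₗ[ℚ] W' p) (p : ℕ) (x : W p) : map φ (ι p x) = ι p (φ p x) := by
  simp [map]

theorem map_id : map (fun p => (LinearMap.id : W p →ₗ[ℚ] W p)) = AlgHom.id ℚ _ :=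
  algHom_ext fun p x => by simp

theorem map_comp (φ : ∀ p, W p →ₗ[ℚ] W' p) (ψ : ∀ p, W' p →ₗ[ℚ] W₂ p) :
    map (fun p => ψ p ∘ₗ φ p) = (map ψ).comp (map φ) :=
  algHom_ext fun p x => by simp

theorem map_comp_toLinearMap (φ : ∀ p, W p →ₗ[ℚ] W' p) (ψ : ∀ p, W' p →ₗ[ℚ] W₂ p) :
    (map ψ).toLinearMap ∘ₗ (map φ).toLinearMap = (map fun p => ψ p ∘ₗ φ p).toLinearMap := by
  rw [map_comp]; rfl

end GradedSym

namespace VecSystem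

variable {G : Type u} [Group G]

/-- The free graded commutative algebras on systems in each degree, as a system. -/
def freeSystem (X : ℕ → VecSystem G) : VecSystem G where
  obj H := ModuleCat.of ℚ (GradedSym fun p => (X p).obj H)
  map f := ModuleCat.ofHom (GradedSym.map fun p => ((X p).map f).hom).toLinearMap
  map_id H := by
    refine ModuleCat.hom_ext ?_
    have : (fun p => ((X p).map (𝟙 H)).hom) = fun p => LinearMap.id := by
      funext p
      rw [(X p).map_id]; rfl
    change (GradedSym.map fun p => ((X p).map (𝟙 H)).hom).toLinearMap = LinearMap.id
    rw [this, GradedSym.map_id]; rfl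
  map_comp {H K L} f g := by
    refine ModuleCat.hom_ext ?_
    have : (fun p => ((X p).map (f ≫ g)).hom) =
        fun p => ((X p).map g).hom ∘ₗ ((X p).map f).hom := by
      funext p
      rw [(X p).map_comp]; rfl
    change (GradedSym.map fun p => ((X p).map (f ≫ g)).hom).toLinearMap =
      (GradedSym.map fun p => ((X p).map g).hom).toLinearMap ∘ₗ
        (GradedSym.map fun p => ((X p).map f).hom).toLinearMap
    rw [this, GradedSym.map_comp_toLinearMap]

/-- Coherent sections pass to free graded commutative algebras. -/
def Sections.free {X : ℕ → VecSystem G} (S : ∀ p, Sections (X p)) : Sections (freeSystem X) where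
  -- The axioms of `Sections` are equations between composites of structure maps and sections,
  -- without sums. A functor therefore preserves them even though it is not additive.
  s f := (GradedSym.map fun p => (S p).s f).toLinearMap
  sec {H K} f := by
    change (GradedSym.map fun p => ((X p).map f).hom).toLinearMap ∘ₗ
      (GradedSym.map fun p => (S p).s f).toLinearMap = LinearMap.id
    rw [GradedSym.map_comp_toLinearMap]
    simp only [(S _).sec]
    rw [GradedSym.map_id]; rfl
  comp {H K L} f g := by
    change _ = (GradedSym.map fun p => (S p).s f).toLinearMap ∘ₗ
      (GradedSym.map fun p => (S p).s g).toLinearMap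
    rw [GradedSym.map_comp_toLinearMap]
    simp only [(S _).comp]
  comm {H K L} f g := by
    change ((GradedSym.map fun p => (S p).s f).toLinearMap ∘ₗ
        (GradedSym.map fun p => ((X p).map f).hom).toLinearMap) ∘ₗ
      ((GradedSym.map fun p => (S p).s g).toLinearMap ∘ₗ
        (GradedSym.map fun p => ((X p).map g).hom).toLinearMap) =
      ((GradedSym.map fun p => (S p).s g).toLinearMap ∘ₗ
        (GradedSym.map fun p => ((X p).map g).hom).toLinearMap) ∘ₗ
      ((GradedSym.map fun p => (S p).s f).toLinearMap ∘ₗ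
        (GradedSym.map fun p => ((X p).map f).hom).toLinearMap)
    simp only [GradedSym.map_comp_toLinearMap]
    simp only [(S _).comm f g]
  base_left {H K L Q} f g h hyp := by
    change (GradedSym.map fun p => ((X p).map f).hom).toLinearMap ∘ₗ
        (GradedSym.map fun p => (S p).s g).toLinearMap =
      ((GradedSym.map fun p => (S p).s h).toLinearMap ∘ₗ
        (GradedSym.map fun p => ((X p).map h).hom).toLinearMap) ∘ₗ
      ((GradedSym.map fun p => ((X p).map f).hom).toLinearMap ∘ₗ
        (GradedSym.map fun p => (S p).s g).toLinearMap)
    simp only [GradedSym.map_comp_toLinearMap]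
    simp only [← (S _).base_left f g h hyp]
  base_right {H K L Q} f g h hyp := by
    change (GradedSym.map fun p => ((X p).map g).hom).toLinearMap ∘ₗ
        (GradedSym.map fun p => (S p).s f).toLinearMap =
      ((GradedSym.map fun p => ((X p).map g).hom).toLinearMap ∘ₗ
        (GradedSym.map fun p => (S p).s f).toLinearMap) ∘ₗ
      ((GradedSym.map fun p => (S p).s h).toLinearMap ∘ₗ
        (GradedSym.map fun p => ((X p).map h).hom).toLinearMap)
    simp only [GradedSym.map_comp_toLinearMap]
    simp only [← (S _).base_right f g h hyp]

open Classical in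
/-- Extension by zero of a function on the morphisms out of `K` along `f : H ⟶ K`. -/
noncomputable def coindSection (U : OrbitCat G → ModuleCat.{u} ℚ) {H K : OrbitCat G}
    (f : H ⟶ K) :
    (∀ M : OrbitCat G, (K ⟶ M) → U M) →ₗ[ℚ] (∀ M : OrbitCat G, (H ⟶ M) → U M) where
  toFun y M k := if h : ∃ l : K ⟶ M, f ≫ l = k then y M h.choose else 0
  map_add' y z := by
    funext M k
    by_cases h : ∃ l : K ⟶ M, f ≫ l = k <;> simp [h]
  map_smul' c y := by
    funext M k
    by_cases h : ∃ l : K ⟶ M, f ≫ l = k <;> simp [h]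

open Classical in
theorem coindSection_comp (U : OrbitCat G → ModuleCat.{u} ℚ) {H K : OrbitCat G} (f : H ⟶ K)
    (y : ∀ M : OrbitCat G, (K ⟶ M) → U M) (M : OrbitCat G) (l : K ⟶ M) :
    coindSection U f y M (f ≫ l) = y M l := by
  have h : ∃ l' : K ⟶ M, f ≫ l' = f ≫ l := ⟨l, rfl⟩
  change (if h : ∃ l' : K ⟶ M, f ≫ l' = f ≫ l then y M h.choose else 0) = _
  rw [dif_pos h, OrbitCat.comp_left_cancel f h.choose_spec]

theorem coindSection_of_not (U : OrbitCat G → ModuleCat.{u} ℚ) {H K : OrbitCat G} (f : H ⟶ K)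
    (y : ∀ M : OrbitCat G, (K ⟶ M) → U M) (M : OrbitCat G) (k : H ⟶ M)
    (h : ¬ ∃ l : K ⟶ M, f ≫ l = k) : coindSection U f y M k = 0 :=
  dif_neg h

/-- Restriction of a function on the morphisms out of `H` along `f : H ⟶ K`. -/
def coindRestrict (U : OrbitCat G → ModuleCat.{u} ℚ) {H K : OrbitCat G} (f : H ⟶ K) :
    (∀ M : OrbitCat G, (H ⟶ M) → U M) →ₗ[ℚ] (∀ M : OrbitCat G, (K ⟶ M) → U M) :=
  ((coind U).map f).hom

theorem coindRestrict_apply (U : OrbitCat G → ModuleCat.{u} ℚ) {H K : OrbitCat G} (f : H ⟶ K)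
    (y : ∀ M : OrbitCat G, (H ⟶ M) → U M) (M : OrbitCat G) (l : K ⟶ M) :
    coindRestrict U f y M l = y M (f ≫ l) := rfl

open Classical in
theorem coindSection_restrict (U : OrbitCat G → ModuleCat.{u} ℚ) {H K : OrbitCat G} (f : H ⟶ K)
    (y : ∀ M : OrbitCat G, (H ⟶ M) → U M) (M : OrbitCat G) (k : H ⟶ M) :
    coindSection U f (coindRestrict U f y) M k =
      if ∃ l : K ⟶ M, f ≫ l = k then y M k else 0 := by
  split_ifs with h
  · obtain ⟨l, rfl⟩ := h
    rw [coindSection_comp]; rfl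
  · exact coindSection_of_not U f _ M k h

/-- A coinduced system has coherent sections, the extensions by zero. -/
noncomputable def coindSections (U : OrbitCat G → ModuleCat.{u} ℚ) : Sections (coind U) where
  s f := coindSection U f
  sec {H K} f := by
    refine LinearMap.ext fun y => ?_
    funext M l
    exact coindSection_comp U f y M l
  comp {H K L} f g := by
    refine LinearMap.ext fun (y : ∀ M : OrbitCat G, (L ⟶ M) → U M) => ?_
    funext M k
    change coindSection U (f ≫ g) y M k = coindSection U f (coindSection U g y) M k
    by_cases h : ∃ l : K ⟶ M, f ≫ l = k
    · obtain ⟨l, rfl⟩ := h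
      rw [coindSection_comp]
      by_cases h' : ∃ l' : L ⟶ M, g ≫ l' = l
      · obtain ⟨l', rfl⟩ := h'
        rw [coindSection_comp, ← Category.assoc, coindSection_comp]
      · rw [coindSection_of_not U g _ _ _ h', coindSection_of_not]
        rintro ⟨l', hl'⟩
        rw [Category.assoc] at hl'
        exact h' ⟨l', OrbitCat.comp_left_cancel f hl'⟩
    · rw [coindSection_of_not U f _ _ _ h, coindSection_of_not]
      rintro ⟨l', hl'⟩
      rw [Category.assoc] at hl'
      exact h ⟨_, hl'⟩
  comm {H K L} f g := by
    refine LinearMap.ext fun (y : ∀ M : OrbitCat G, (H ⟶ M) → U M) => ?_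
    funext M k
    change coindSection U f (coindRestrict U f (coindSection U g (coindRestrict U g y))) M k =
      coindSection U g (coindRestrict U g (coindSection U f (coindRestrict U f y))) M k
    -- Restricting along `f` and extending by zero multiplies by the indicator function of the
    -- morphisms that factor through `f`; such multiplications commute.
    simp only [coindSection_restrict]
    split_ifs <;> rfl
  base_left {H K L Q} f g h hyp := by
    refine LinearMap.ext fun (y : ∀ M : OrbitCat G, (L ⟶ M) → U M) => ?_
    funext M k
    change coindRestrict U f (coindSection U g y) M k =
      coindSection U h (coindRestrict U h (coindRestrict U f (coindSection U g y))) M k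
    rw [coindSection_restrict]
    split_ifs with hq
    · rfl
    · rw [coindRestrict_apply]
      refine coindSection_of_not U g _ _ _ ?_
      rintro ⟨l, hl⟩
      exact hq (hyp M k l hl.symm)
  base_right {H K L Q} f g h hyp := by
    refine LinearMap.ext fun (y : ∀ M : OrbitCat G, (K ⟶ M) → U M) => ?_
    funext M l
    change coindRestrict U g (coindSection U f y) M l =
      coindRestrict U g (coindSection U f (coindSection U h (coindRestrict U h y))) M l
    rw [coindRestrict_apply, coindRestrict_apply]
    -- Either `g ≫ l` factors through `f` by some `k`, which then factors through `h` and survives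
    -- the truncation, or both sides are zero.
    by_cases hk : ∃ k : K ⟶ M, f ≫ k = g ≫ l
    · obtain ⟨k, hk⟩ := hk
      rw [← hk, coindSection_comp, coindSection_comp, coindSection_restrict,
        if_pos (hyp M k l hk)]
    · rw [coindSection_of_not U f _ _ _ hk, coindSection_of_not U f _ _ _ hk]

/-- The free graded commutative algebra on coinduced systems is injective. -/
theorem freeSystem_coind_injective [Finite G] (U : ℕ → OrbitCat G → ModuleCat.{u} ℚ) :
    Injective (freeSystem fun p => coind (U p)) :=
  (Sections.free fun p => coindSections (U p)).injective

end VecSystem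

/-! ### Decomposables and freely generated algebras -/

namespace CDGA

variable {A B : CDGA.{u}}

theorem one_mem_grading (A : CDGA.{u}) : (1 : A.carrier) ∈ A.grading 0 := SetLike.GradedOne.one_mem

theorem mul_mem_grading {p q : ℕ} {a b : A.carrier} (ha : a ∈ A.grading p) (hb : b ∈ A.grading q) :
    a * b ∈ A.grading (p + q) := SetLike.GradedMul.mul_mem ha hb

theorem d_one (A : CDGA.{u}) : A.d 1 = 0 := by
  simpa using A.leibniz A.one_mem_grading 1

/-- A family of subspaces of the graded pieces that spans a CDGA consists of the graded pieces. -/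
theorem grading_le_of_iSup_eq_top (C : ℕ → Submodule ℚ A.carrier) (hC : ∀ p, C p ≤ A.grading p)
    (h : ⨆ p, C p = ⊤) (p : ℕ) : A.grading p ≤ C p := by
  have key : ∀ a : A.carrier, ∀ q, (DirectSum.decompose A.grading a q : A.carrier) ∈ C q := by
    intro a
    have ha : a ∈ ⨆ p, C p := h ▸ Submodule.mem_top
    induction ha using Submodule.iSup_induction' with
    | mem i x hx =>
      intro q
      by_cases hq : i = q
      · subst hq
        rwa [DirectSum.decompose_of_mem_same _ (hC i hx)]
      · rw [DirectSum.decompose_of_mem_ne _ (hC i hx) hq]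
        exact zero_mem _
    | zero => intro q; simp
    | add x y _ _ hx hy => intro q; simpa using add_mem (hx q) (hy q)
  intro a ha
  have := key a p
  rwa [DirectSum.decompose_of_mem_same _ ha] at this

/-- The projection onto the degree `p` part. -/
def component (A : CDGA.{u}) (p : ℕ) : A.carrier →ₗ[ℚ] A.grading p where
  toFun a := DirectSum.decompose A.grading a p
  map_add' a b := by simp
  map_smul' c a := by
    rw [DirectSum.decompose_smul]
    rfl

theorem decompose_map (F : A.carrier →ₐ[ℚ] B.carrier)
    (hF : ∀ {p : ℕ} {a : A.carrier}, a ∈ A.grading p → F a ∈ B.grading p) (a : A.carrier)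
    (q : ℕ) : (DirectSum.decompose B.grading (F a) q : B.carrier) =
      F (DirectSum.decompose A.grading a q) := by
  induction a using DirectSum.Decomposition.inductionOn A.grading with
  | zero => simp
  | @homogeneous i m =>
    by_cases hq : i = q
    · subst hq
      rw [DirectSum.decompose_of_mem_same _ (hF m.2), DirectSum.decompose_of_mem_same _ m.2]
    · rw [DirectSum.decompose_of_mem_ne _ (hF m.2) hq, DirectSum.decompose_of_mem_ne _ m.2 hq,
        map_zero]
  | add x y hx hy => simp [hx, hy]

/-- The decomposable elements of degree `p`. -/
def dec (A : CDGA.{u}) (p : ℕ) : Submodule ℚ A.carrier :=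
  Submodule.span ℚ {x | ∃ (i j : ℕ) (a b : A.carrier), 1 ≤ i ∧ 1 ≤ j ∧ i + j = p ∧
    a ∈ A.grading i ∧ b ∈ A.grading j ∧ a * b = x}

theorem mul_mem_dec {i j : ℕ} {a b : A.carrier} (hi : 1 ≤ i) (hj : 1 ≤ j) (ha : a ∈ A.grading i)
    (hb : b ∈ A.grading j) : a * b ∈ A.dec (i + j) :=
  Submodule.subset_span ⟨i, j, a, b, hi, hj, rfl, ha, hb, rfl⟩

theorem dec_le (A : CDGA.{u}) (p : ℕ) : A.dec p ≤ A.grading p := by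
  refine Submodule.span_le.2 ?_
  rintro _ ⟨i, j, a, b, -, -, rfl, ha, hb, rfl⟩
  exact mul_mem_grading ha hb

theorem map_dec (F : A.carrier →ₐ[ℚ] B.carrier)
    (hF : ∀ {p : ℕ} {a : A.carrier}, a ∈ A.grading p → F a ∈ B.grading p) {p : ℕ}
    {a : A.carrier} (ha : a ∈ A.dec p) : F a ∈ B.dec p := by
  have : A.dec p ≤ (B.dec p).comap F.toLinearMap := by
    refine Submodule.span_le.2 ?_
    rintro _ ⟨i, j, a, b, hi, hj, rfl, ha, hb, rfl⟩
    change F (a * b) ∈ B.dec (i + j)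
    rw [map_mul]
    exact mul_mem_dec hi hj (hF ha) (hF hb)
  exact this ha

theorem d_mem_dec {p : ℕ} {a : A.carrier} (ha : a ∈ A.dec p) : A.d a ∈ A.dec (p + 1) := by
  have : A.dec p ≤ (A.dec (p + 1)).comap A.d := by
    refine Submodule.span_le.2 ?_
    rintro _ ⟨i, j, a, b, hi, hj, rfl, ha, hb, rfl⟩
    change A.d (a * b) ∈ A.dec (i + j + 1)
    rw [A.leibniz ha]
    refine add_mem ?_ (Submodule.smul_mem _ _ ?_)
    · have := mul_mem_dec (by omega) hj (A.d_mem ha) hb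
      rwa [add_right_comm] at this
    · rw [add_assoc]; exact mul_mem_dec hi (by omega) ha (A.d_mem hb)
  exact this ha

theorem eq_of_mem_dec {R : Type*} [Ring R] [Algebra ℚ R] {F F' : A.carrier →ₐ[ℚ] R} {p : ℕ}
    (h : ∀ q < p, ∀ a ∈ A.grading q, F a = F' a) {a : A.carrier} (ha : a ∈ A.dec p) :
    F a = F' a := by
  have : A.dec p ≤ LinearMap.eqLocus F.toLinearMap F'.toLinearMap := by
    refine Submodule.span_le.2 ?_
    rintro _ ⟨i, j, a, b, hi, hj, rfl, ha, hb, rfl⟩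
    change F (a * b) = F' (a * b)
    rw [map_mul, map_mul, h i (by omega) a ha, h j (by omega) b hb]
  exact this ha

theorem d_comm_mul {F : A.carrier →ₐ[ℚ] B.carrier}
    (hF : ∀ {p : ℕ} {a : A.carrier}, a ∈ A.grading p → F a ∈ B.grading p) {i : ℕ}
    {a b : A.carrier} (ha : a ∈ A.grading i) (h₁ : B.d (F a) = F (A.d a))
    (h₂ : B.d (F b) = F (A.d b)) : B.d (F (a * b)) = F (A.d (a * b)) := by
  rw [map_mul, B.leibniz (hF ha), A.leibniz ha, h₁, h₂, map_add, map_smul, map_mul, map_mul]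

theorem d_comm_of_mem_dec {F : A.carrier →ₐ[ℚ] B.carrier}
    (hF : ∀ {p : ℕ} {a : A.carrier}, a ∈ A.grading p → F a ∈ B.grading p) {p : ℕ}
    (h : ∀ q < p, ∀ a ∈ A.grading q, B.d (F a) = F (A.d a)) {a : A.carrier} (ha : a ∈ A.dec p) :
    B.d (F a) = F (A.d a) := by
  have : A.dec p ≤ LinearMap.eqLocus (B.d ∘ₗ F.toLinearMap) (F.toLinearMap ∘ₗ A.d) := by
    refine Submodule.span_le.2 ?_
    rintro _ ⟨i, j, a, b, hi, hj, rfl, ha, hb, rfl⟩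
    exact d_comm_mul hF ha (h i (by omega) a ha) (h j (by omega) b hb)
  exact this ha

/-- `A` is, as a graded algebra, freely generated by the vector spaces `W p` in degree `p ≥ 2`. -/
structure FreeOn (A : CDGA.{u}) (W : ℕ → Type u) [∀ p, AddCommGroup (W p)]
    [∀ p, Module ℚ (W p)] (σ : ∀ p, W p →ₗ[ℚ] A.carrier) : Prop where
  mem : ∀ p x, σ p x ∈ A.grading p
  low : ∀ p < 2, ∀ x : W p, x = 0
  adjoin : Algebra.adjoin ℚ (⋃ p, Set.range (σ p)) = ⊤
  free : ∀ (R : Type u) [Ring R] [Algebra ℚ R] (f : ∀ p, W p →ₗ[ℚ] R),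
    (∀ p q x y, f p x * f q y = (-1 : ℚ) ^ (p * q) • (f q y * f p x)) →
      ∃ F : A.carrier →ₐ[ℚ] R, ∀ p x, F (σ p x) = f p x

namespace FreeOn

variable {W : ℕ → Type u} [∀ p, AddCommGroup (W p)] [∀ p, Module ℚ (W p)]
  {σ : ∀ p, W p →ₗ[ℚ] A.carrier}

theorem hom_ext (hA : A.FreeOn W σ) {R : Type*} [Ring R] [Algebra ℚ R] {F F' : A.carrier →ₐ[ℚ] R}
    (h : ∀ p x, F (σ p x) = F' (σ p x)) : F = F' := by
  refine AlgHom.ext_of_adjoin_eq_top hA.adjoin ?_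
  rintro _ ⟨_, ⟨p, rfl⟩, x, rfl⟩
  exact h p x

/-- Induction over the products of generators. -/
theorem grading_le (hA : A.FreeOn W σ) (C : ℕ → Submodule ℚ A.carrier) (one : (1 : A.carrier) ∈ C 0)
    (mul : ∀ p q x, ∀ y ∈ C q, σ p x * y ∈ C (p + q)) (p : ℕ) : A.grading p ≤ C p := by
  -- Left multiplication by an element of `D p` carries `C q` into `C (p + q)`. Unlike `C`, this
  -- family is visibly closed under products, and it contains the generators, so it is everything;
  -- applying it to `1 ∈ C 0` gives the claim.
  let D : ℕ → Submodule ℚ A.carrier := fun p =>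
    { carrier := {a | a ∈ A.grading p ∧ ∀ q, ∀ y ∈ C q, a * y ∈ C (p + q)}
      zero_mem' := ⟨zero_mem _, fun q y _ => by simp⟩
      add_mem' := fun {a b} ha hb => ⟨add_mem ha.1 hb.1, fun q y hy => by
        rw [add_mul]; exact add_mem (ha.2 q y hy) (hb.2 q y hy)⟩
      smul_mem' := fun c a ha => ⟨Submodule.smul_mem _ c ha.1, fun q y hy => by
        rw [smul_mul_assoc]; exact Submodule.smul_mem _ c (ha.2 q y hy)⟩ }
  have hD1 : (1 : A.carrier) ∈ D 0 := ⟨A.one_mem_grading, fun q y hy => by rwa [one_mul, zero_add]⟩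
  have hDmul : ∀ p q, D p * D q ≤ D (p + q) := fun p q => Submodule.mul_le.2 fun a ha b hb =>
    ⟨mul_mem_grading ha.1 hb.1, fun r y hy => by
      rw [mul_assoc, add_assoc]; exact ha.2 _ _ (hb.2 r y hy)⟩
  have hmul : (⨆ p, D p) * (⨆ p, D p) ≤ ⨆ p, D p := by
    simp only [Submodule.iSup_mul, Submodule.mul_iSup]
    exact iSup_le fun p => iSup_le fun q => (hDmul _ _).trans (le_iSup D _)
  have htop : ⨆ p, D p = ⊤ := by
    refine eq_top_iff.2 fun a _ => ?_
    have ha : a ∈ Algebra.adjoin ℚ (⋃ p, Set.range (σ p)) := hA.adjoin ▸ Algebra.mem_top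
    induction ha using Algebra.adjoin_induction with
    | mem x hx =>
      obtain ⟨_, ⟨p, rfl⟩, x, rfl⟩ := hx
      exact Submodule.mem_iSup_of_mem p ⟨hA.mem p x, fun q y hy => mul p q x y hy⟩
    | algebraMap c =>
      rw [Algebra.algebraMap_eq_smul_one]
      exact Submodule.smul_mem _ _ (Submodule.mem_iSup_of_mem 0 hD1)
    | add x y _ _ hx hy => exact add_mem (hx trivial) (hy trivial)
    | mul x y _ _ hx hy => exact hmul (Submodule.mul_mem_mul (hx trivial) (hy trivial))
  intro a ha
  have := (grading_le_of_iSup_eq_top D (fun p a ha => ha.1) htop p ha).2 0 1 one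
  rwa [mul_one, add_zero] at this

theorem exists_scalar (hA : A.FreeOn W σ) {a : A.carrier} (ha : a ∈ A.grading 0) : ∃ c : ℚ, a = c • 1 := by
  have := hA.grading_le (fun p => if p = 0 then Submodule.span ℚ {1} else ⊤)
    (by simp) (fun p q x y hy => by
      by_cases h : p + q = 0
      · have hx : x = 0 := hA.low p (by omega) x
        simp [hx]
      · rw [if_neg h]; trivial) 0 ha
  obtain ⟨c, hc⟩ := Submodule.mem_span_singleton.1 (by simpa using this)
  exact ⟨c, hc.symm⟩

/-- In positive degrees, every element is a generator up to decomposables. -/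
theorem exists_sub_mem_dec (hA : A.FreeOn W σ) {p : ℕ} (hp : 1 ≤ p) {a : A.carrier} (ha : a ∈ A.grading p) :
    ∃ x, a - σ p x ∈ A.dec p := by
  have := hA.grading_le (fun p => if p = 0 then Submodule.span ℚ {1} else
      LinearMap.range (σ p) ⊔ A.dec p)
    (by simp) (fun p q x y hy => by
      rcases Nat.eq_zero_or_pos p with rfl | hp
      · simp [hA.low 0 (by omega) x]
      rw [if_neg (by omega)]
      rcases Nat.eq_zero_or_pos q with rfl | hq
      · obtain ⟨c, rfl⟩ := Submodule.mem_span_singleton.1 (by simpa using hy)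
        rw [mul_smul_comm, mul_one]
        exact Submodule.smul_mem _ _ (Submodule.mem_sup_left ⟨x, rfl⟩)
      · rw [if_neg (by omega)] at hy
        refine Submodule.mem_sup_right (mul_mem_dec hp hq (hA.mem p x) ?_)
        refine (sup_le ?_ (A.dec_le q) : _ ≤ A.grading q) hy
        rintro _ ⟨z, rfl⟩
        exact hA.mem q z) p ha
  rw [if_neg (by omega)] at this
  obtain ⟨_, ⟨x, rfl⟩, z, hz, rfl⟩ := Submodule.mem_sup.1 this
  exact ⟨x, by simpa using hz⟩

theorem grading_one (hA : A.FreeOn W σ) {a : A.carrier} (ha : a ∈ A.grading 1) : a = 0 := by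
  obtain ⟨x, hx⟩ := hA.exists_sub_mem_dec le_rfl ha
  have h1 : A.dec 1 ≤ ⊥ := by
    refine Submodule.span_le.2 ?_
    rintro _ ⟨i, j, a, b, hi, hj, h, -⟩
    omega
  rw [hA.low 1 (by omega) x, map_zero, sub_zero] at hx
  exact h1 hx

theorem map_mem (hA : A.FreeOn W σ) {F : A.carrier →ₐ[ℚ] B.carrier} (hF : ∀ p x, F (σ p x) ∈ B.grading p) {p : ℕ}
    {a : A.carrier} (ha : a ∈ A.grading p) : F a ∈ B.grading p := by
  refine hA.grading_le (fun p => (B.grading p).comap F.toLinearMap) ?_ ?_ p ha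
  · change F 1 ∈ B.grading 0
    rw [map_one]; exact B.one_mem_grading
  · intro p q x y hy
    change F (σ p x * y) ∈ B.grading (p + q)
    rw [map_mul]; exact mul_mem_grading (hF p x) hy

theorem eq_of_le (hA : A.FreeOn W σ) {R : Type*} [Ring R] [Algebra ℚ R] {F F' : A.carrier →ₐ[ℚ] R} {m : ℕ}
    (h : ∀ q ≤ m, ∀ x, F (σ q x) = F' (σ q x)) {p : ℕ} (hp : p ≤ m) {a : A.carrier}
    (ha : a ∈ A.grading p) : F a = F' a := by
  -- The family is truncated to the whole algebra above degree `m`, where nothing is assumed about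
  -- the generators.
  have := hA.grading_le (fun p => if p ≤ m then
      LinearMap.eqLocus F.toLinearMap F'.toLinearMap else ⊤) (by simp) (fun p q x y hy => by
      by_cases hpq : p + q ≤ m
      · rw [if_pos hpq]
        rw [if_pos (by omega)] at hy
        have hy' : F y = F' y := hy
        change F (σ p x * y) = F' (σ p x * y)
        rw [map_mul, map_mul, h p (by omega), hy']
      · simp [hpq]) p ha
  rw [if_pos hp] at this
  exact this

theorem d_comm (hA : A.FreeOn W σ) {F : A.carrier →ₐ[ℚ] B.carrier} (hF : ∀ p x, F (σ p x) ∈ B.grading p) {m : ℕ}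
    (h : ∀ q < m, ∀ x, B.d (F (σ q x)) = F (A.d (σ q x))) {p : ℕ} (hp : p < m) {a : A.carrier}
    (ha : a ∈ A.grading p) : B.d (F a) = F (A.d a) := by
  have := hA.grading_le (fun p => if p < m then
      LinearMap.eqLocus (B.d ∘ₗ F.toLinearMap) (F.toLinearMap ∘ₗ A.d) else ⊤) (by
      split_ifs
      · simp [d_one]
      · trivial) (fun p q x y hy => by
      by_cases hpq : p + q < m
      · rw [if_pos hpq]
        rw [if_pos (by omega)] at hy
        exact d_comm_mul (fun h => hA.map_mem hF h) (hA.mem p x) (h p (by omega) x) hy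
      · simp [hpq]) p ha
  rw [if_pos hp] at this
  exact this

open Classical in
/-- The projection onto the generators of degree `p`. -/
theorem exists_lin (hA : A.FreeOn W σ) (p : ℕ) : ∃ L : A.carrier →ₗ[ℚ] W p,
    (∀ x, L (σ p x) = x) ∧ ∀ a ∈ A.dec p, L a = 0 := by
  -- The square-zero extension `ℚ ⊕ W p`, realized by operators on itself. All products of the
  -- operators `nil x` vanish, so graded commutativity is automatic, decomposables go to zero, and
  -- evaluation at `(1, 0)` recovers the generator.
  let nil : W p →ₗ[ℚ] Module.End ℚ (ℚ × W p) := LinearMap.mk₂ ℚ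
    (fun x z => (0, z.1 • x)) (by intros; simp)
    (fun c x z => Prod.ext (by simp) (smul_comm z.1 c x))
    (by intros; simp [add_smul]) (by intros; simp [mul_smul])
  have hnil : ∀ x y, nil x * nil y = 0 := fun x y => LinearMap.ext fun z => by simp [nil]
  let f : ∀ q, W q →ₗ[ℚ] Module.End ℚ (ℚ × W p) := fun q =>
    if h : q = p then h ▸ nil else 0
  have hf : ∀ q x, ∃ y, f q x = nil y := by
    intro q x
    by_cases h : q = p
    · subst h; exact ⟨x, by simp [f]⟩
    · exact ⟨0, by simp [f, h]⟩
  obtain ⟨F, hF⟩ := hA.free _ f (fun q r x y => by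
    obtain ⟨x', hx⟩ := hf q x
    obtain ⟨y', hy⟩ := hf r y
    rw [hx, hy, hnil, hnil, smul_zero])
  have hpos : ∀ q, 1 ≤ q → ∀ a ∈ A.grading q, F a ∈ LinearMap.range nil := by
    intro q hq a ha
    have := hA.grading_le (fun q => if q = 0 then Submodule.span ℚ {1} else
        (LinearMap.range nil).comap F.toLinearMap)
      (by simp) (fun q r x y hy => by
        rcases Nat.eq_zero_or_pos q with rfl | hq
        · simp [hA.low 0 (by omega) x]
        rw [if_neg (by omega)]
        change F (σ q x * y) ∈ LinearMap.range nil
        rw [map_mul, hF]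
        obtain ⟨x', hx⟩ := hf q x
        rw [hx]
        rcases Nat.eq_zero_or_pos r with rfl | hr
        · obtain ⟨c, rfl⟩ := Submodule.mem_span_singleton.1 (by simpa using hy)
          rw [map_smul, map_one, mul_smul_comm, mul_one]
          exact Submodule.smul_mem _ _ ⟨x', rfl⟩
        · rw [if_neg (by omega)] at hy
          obtain ⟨y', hy'⟩ := hy
          have hy' : nil y' = F y := hy'
          rw [← hy', hnil]
          exact zero_mem _) q ha
    rw [if_neg (by omega)] at this
    exact this
  refine ⟨LinearMap.snd ℚ ℚ (W p) ∘ₗ LinearMap.applyₗ ((1, 0) : ℚ × W p) ∘ₗ F.toLinearMap,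
    fun x => ?_, fun a ha => ?_⟩
  · change (F (σ p x) (1, 0)).2 = x
    rw [hF]
    simp [f, nil]
  · have : A.dec p ≤ LinearMap.ker (LinearMap.snd ℚ ℚ (W p) ∘ₗ
        LinearMap.applyₗ ((1, 0) : ℚ × W p) ∘ₗ F.toLinearMap) := by
      refine Submodule.span_le.2 ?_
      rintro _ ⟨i, j, a, b, hi, hj, -, ha, hb, rfl⟩
      change (F (a * b) (1, 0)).2 = 0
      obtain ⟨x, hx⟩ := hpos i hi a ha
      obtain ⟨y, hy⟩ := hpos j hj b hb
      rw [map_mul, ← hx, ← hy, hnil]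
      rfl
    exact this ha

/-- The projection onto the generators of degree `p`. -/
noncomputable def lin (hA : A.FreeOn W σ) (p : ℕ) : A.carrier →ₗ[ℚ] W p := (hA.exists_lin p).choose

theorem lin_gen (hA : A.FreeOn W σ) (p : ℕ) (x : W p) : hA.lin p (σ p x) = x := (hA.exists_lin p).choose_spec.1 x

theorem lin_dec (hA : A.FreeOn W σ) {p : ℕ} {a : A.carrier} (ha : a ∈ A.dec p) : hA.lin p a = 0 :=
  (hA.exists_lin p).choose_spec.2 a ha

theorem sub_lin_mem_dec (hA : A.FreeOn W σ) {p : ℕ} (hp : 1 ≤ p) {a : A.carrier} (ha : a ∈ A.grading p) :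
    a - σ p (hA.lin p a) ∈ A.dec p := by
  obtain ⟨x, hx⟩ := hA.exists_sub_mem_dec hp ha
  have := hA.lin_dec hx
  rw [map_sub, lin_gen, sub_eq_zero] at this
  rwa [this]

theorem mem_dec_of_lin (hA : A.FreeOn W σ) {p : ℕ} (hp : 1 ≤ p) {a : A.carrier} (ha : a ∈ A.grading p)
    (h : hA.lin p a = 0) : a ∈ A.dec p := by
  simpa [h] using hA.sub_lin_mem_dec hp ha

/-- A graded algebra map onto the generators up to decomposables is onto. -/
theorem mem_range_of_lin (hA : A.FreeOn W σ) (F : A.carrier →ₐ[ℚ] A.carrier)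
    (hF : ∀ {p : ℕ} {a : A.carrier}, a ∈ A.grading p → F a ∈ A.grading p)
    (hlin : ∀ p x, ∃ y, hA.lin p (F (σ p y)) = x) : Function.Surjective F := by
  have key : ∀ p x, σ p x ∈ F.range := by
    intro p
    induction p using Nat.strong_induction_on with
    | _ p ih =>
      intro x
      rcases Nat.eq_zero_or_pos p with rfl | hp
      · rw [hA.low 0 (by omega) x, map_zero]; exact zero_mem _
      have hgr : ∀ q < p, A.grading q ≤ Subalgebra.toSubmodule F.range := by
        intro q hq a ha
        have := hA.grading_le (fun q => if q < p then Subalgebra.toSubmodule F.range else ⊤)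
          (by rw [if_pos hp]; exact one_mem F.range) (fun q r x y hy => by
            by_cases hqr : q + r < p
            · rw [if_pos hqr]
              rw [if_pos (by omega)] at hy
              exact F.range.mul_mem (ih q (by omega) x) hy
            · simp [hqr]) q ha
        rwa [if_pos hq] at this
      have hdec : A.dec p ≤ Subalgebra.toSubmodule F.range := by
        refine Submodule.span_le.2 ?_
        rintro _ ⟨i, j, a, b, hi, hj, h, ha, hb, rfl⟩
        exact F.range.mul_mem (hgr i (by omega) ha) (hgr j (by omega) hb)
      obtain ⟨y, rfl⟩ := hlin p x
      -- The prescribed generator differs from `F (σ p y)` by a decomposable, whose factors have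
      -- lower degree and are in the range by induction.
      have h1 := hdec (hA.sub_lin_mem_dec hp (hF (hA.mem p y)))
      have h2 : F (σ p y) ∈ F.range := ⟨_, rfl⟩
      have := F.range.sub_mem h2 h1
      rwa [sub_sub_cancel] at this
  have : Algebra.adjoin ℚ (⋃ p, Set.range (σ p)) ≤ F.range := by
    refine Algebra.adjoin_le ?_
    rintro _ ⟨_, ⟨p, rfl⟩, x, rfl⟩
    exact key p x
  rw [hA.adjoin] at this
  exact fun a => this trivial

theorem exists_hom (hA : A.FreeOn W σ) (f : ∀ p, W p →ₗ[ℚ] B.carrier) (hf : ∀ p x, f p x ∈ B.grading p) :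
    ∃ F : A.carrier →ₐ[ℚ] B.carrier, ∀ p x, F (σ p x) = f p x :=
  hA.free _ f fun p q x y => B.graded_comm (hf p x) (hf q y)

theorem lin_map (hA : A.FreeOn W σ) {F : A.carrier →ₐ[ℚ] A.carrier}
    (hF : ∀ {p : ℕ} {a : A.carrier}, a ∈ A.grading p → F a ∈ A.grading p) {p : ℕ} (hp : 1 ≤ p)
    {a : A.carrier} (ha : a ∈ A.grading p) :
    hA.lin p (F a) = hA.lin p (F (σ p (hA.lin p a))) := by
  have := hA.lin_dec (map_dec F hF (hA.sub_lin_mem_dec hp ha))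
  rwa [map_sub, map_sub, sub_eq_zero] at this

/-- A graded algebra endomorphism that is bijective on generators modulo decomposables is
bijective. -/
theorem bijective_of_lin (hA : A.FreeOn W σ) (F : A.carrier →ₐ[ℚ] A.carrier)
    (hF : ∀ {p : ℕ} {a : A.carrier}, a ∈ A.grading p → F a ∈ A.grading p)
    (hlin : ∀ p, Function.Bijective fun x => hA.lin p (F (σ p x))) : Function.Bijective F := by
  have hsurj := hA.mem_range_of_lin F hF fun p x => (hlin p).2 x
  have hsurj' : ∀ p, ∀ a ∈ A.grading p, ∃ b ∈ A.grading p, F b = a := by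
    intro p a ha
    obtain ⟨b, rfl⟩ := hsurj a
    refine ⟨_, (DirectSum.decompose A.grading b p).2, ?_⟩
    rw [← decompose_map F hF, DirectSum.decompose_of_mem_same _ ha]
  have hg : ∀ p, ∃ g : W p →ₗ[ℚ] A.grading p, ∀ x, F (g x) = σ p x := by
    intro p
    let Fp : A.grading p →ₗ[ℚ] A.grading p := F.toLinearMap.restrict fun _ h => hF h
    have hFp : Function.Surjective Fp := fun a => by
      obtain ⟨b, hb, h⟩ := hsurj' p a.1 a.2
      exact ⟨⟨b, hb⟩, Subtype.ext h⟩
    obtain ⟨r, hr⟩ := LinearMap.exists_rightInverse_of_surjective Fp (LinearMap.range_eq_top.2 hFp)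
    refine ⟨r ∘ₗ (σ p).codRestrict _ (hA.mem p), fun x => ?_⟩
    exact congrArg Subtype.val (LinearMap.congr_fun hr ⟨σ p x, hA.mem p x⟩)
  -- Preimages of the generators define a right inverse `R` of `F`. Modulo decomposables `R` inverts
  -- a bijection, so `R` is itself onto, and `F` is injective.
  choose g hg using hg
  obtain ⟨R, hR⟩ := hA.exists_hom (B := A) (fun p => (A.grading p).subtype ∘ₗ g p)
    (fun p x => (g p x).2)
  have hRgr : ∀ {p : ℕ} {a : A.carrier}, a ∈ A.grading p → R a ∈ A.grading p :=
    fun ha => hA.map_mem (fun p x => by rw [hR]; exact (g p x).2) ha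
  have hFR : ∀ a, F (R a) = a := fun a => by
    have : F.comp R = AlgHom.id ℚ _ := hA.hom_ext fun p x => by
      change F (R (σ p x)) = σ p x
      rw [hR]; exact hg p x
    exact DFunLike.congr_fun this a
  have hRsurj : Function.Surjective R := hA.mem_range_of_lin R hRgr fun p x => by
    rcases Nat.eq_zero_or_pos p with rfl | hp
    · exact ⟨x, by rw [hA.low 0 (by omega) x, hA.low 0 (by omega) (hA.lin 0 _)]⟩
    refine ⟨hA.lin p (F (σ p x)), (hlin p).1 ?_⟩
    have h1 := hA.lin_map hF hp (hRgr (hA.mem p (hA.lin p (F (σ p x)))))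
    rw [hFR, lin_gen] at h1
    exact h1.symm
  refine ⟨fun a b hab => ?_, hsurj⟩
  obtain ⟨a', rfl⟩ := hRsurj a
  obtain ⟨b', rfl⟩ := hRsurj b
  rw [hFR, hFR] at hab
  rw [hab]

end FreeOn

end CDGA

/-! ### Extensions of a free algebra: universal property, generators, low degrees -/

namespace HirschData

variable {U : CDGA.{u}} {n : ℕ} (D : HirschData U n)

/-- The inclusion of the base algebra, with values in the underlying algebra. -/
def inclAlg : U.carrier →ₐ[ℚ] D.Alg :=
  (DirectSum.toAlgebra ℚ (fun p => U.grading p)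
    (fun p =>
      { toFun := fun x => D.gen (.base p x)
        map_add' := D.gen_base_add p
        map_smul' := D.gen_base_smul p })
    D.gen_base_one
    (fun {p q} x y => D.gen_base_mul p q x y)).comp
    (DirectSum.decomposeAlgEquiv U.grading).toAlgHom

/-- The inclusion of the base algebra. -/
def incl : U.carrier →ₐ[ℚ] D.toCDGA.carrier := D.inclAlg

/-- The inclusion of the new generators. -/
def new (i : ℕ) : D.W i →ₗ[ℚ] D.toCDGA.carrier where
  toFun v := D.gen (.new i v)
  map_add' v w := D.gen_new_add i v w
  map_smul' c v := D.gen_new_smul i c v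

theorem incl_of_mem {p : ℕ} {x : U.carrier} (hx : x ∈ U.grading p) :
    D.incl x = D.gen (.base p ⟨x, hx⟩) := by
  have : (DirectSum.decomposeAlgEquiv U.grading).toAlgHom x =
      DirectSum.of (fun p => U.grading p) p ⟨x, hx⟩ := DirectSum.decompose_of_mem U.grading hx
  change D.inclAlg x = _
  rw [inclAlg, AlgHom.comp_apply, this]
  exact DirectSum.toSemiring_of _ D.gen_base_one (fun {p q} x y => D.gen_base_mul p q x y) _ _

theorem incl_coe {p : ℕ} (x : U.grading p) : D.incl x = D.gen (.base p x) :=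
  D.incl_of_mem x.2

theorem incl_mem {p : ℕ} {x : U.carrier} (hx : x ∈ U.grading p) :
    D.incl x ∈ D.toCDGA.grading p := by
  rw [D.incl_of_mem hx]; exact D.gen_mem (.base p ⟨x, hx⟩)

theorem new_mem (i : ℕ) (v : D.W i) : D.new i v ∈ D.toCDGA.grading (n + i) :=
  D.gen_mem (.new i v)

theorem incl_d (x : U.carrier) : D.incl (U.d x) = D.toCDGA.d (D.incl x) := by
  induction x using DirectSum.Decomposition.inductionOn U.grading with
  | zero => simp
  | @homogeneous i m =>
    rw [D.incl_of_mem m.2, D.incl_of_mem (U.d_mem m.2)]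
    exact (D.dAlg_gen (.base i m)).symm
  | add x y hx hy => simp [hx, hy]

theorem d_new (i : ℕ) (v : D.W i) : D.toCDGA.d (D.new i v) =
    (-1 : ℚ) ^ i • D.incl (D.a i v) + D.new (i + 1) (D.w i v) := by
  refine (D.dAlg_gen (.new i v)).trans ?_
  rw [D.incl_coe]; rfl

/-- The algebra is spanned by the products of generators. -/
theorem span_induction {P : D.toCDGA.carrier → Prop} (one : P 1)
    (base : ∀ p, ∀ x ∈ U.grading p, ∀ y, P y → P (D.incl x * y))
    (new : ∀ i v y, P y → P (D.new i v * y))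
    (add : ∀ x y, P x → P y → P (x + y)) (smul : ∀ (c : ℚ) x, P x → P (c • x))
    (a : D.toCDGA.carrier) : P a := by
  have hmon : ∀ l, P (D.mon l) := fun l => by
    induction l with
    | nil => exact one
    | cons x l ih =>
      rw [mon_cons]
      cases x with
      | base p x => rw [← D.incl_coe]; exact base p x x.2 _ ih
      | new i v => exact new i v _ ih
  have ha := D.span_mon a
  induction ha using Submodule.span_induction with
  | zero => exact (zero_smul ℚ (1 : D.toCDGA.carrier)) ▸ smul 0 1 one
  | add x y _ _ hx hy => exact add x y hx hy
  | smul c x _ hx => exact smul c x hx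
  | mem x hx =>
    obtain ⟨l, rfl⟩ := hx
    exact hmon l

theorem hom_ext {R : Type*} [Ring R] [Algebra ℚ R] {L L' : D.toCDGA.carrier →ₐ[ℚ] R}
    (base : ∀ x, L (D.incl x) = L' (D.incl x)) (new : ∀ i v, L (D.new i v) = L' (D.new i v)) :
    L = L' := by
  refine AlgHom.ext fun a => ?_
  induction a using D.span_induction with
  | one => rw [map_one, map_one]
  | base p x _ y hy => rw [map_mul, map_mul, base, hy]
  | new i v y hy => rw [map_mul, map_mul, new, hy]
  | add x y hx hy => rw [map_add, map_add, hx, hy]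
  | smul c x hx => rw [map_smul, map_smul, hx]

theorem map_mem {B : CDGA.{u}} {L : D.toCDGA.carrier →ₐ[ℚ] B.carrier}
    (base : ∀ p, ∀ x ∈ U.grading p, L (D.incl x) ∈ B.grading p)
    (new : ∀ i v, L (D.new i v) ∈ B.grading (n + i)) {p : ℕ} {a : D.toCDGA.carrier}
    (ha : a ∈ D.toCDGA.grading p) : L a ∈ B.grading p := by
  have hmon : ∀ l, L (D.mon l) ∈ B.grading (D.wt l) := fun l => by
    induction l with
    | nil => exact (map_one L).symm ▸ B.one_mem_grading
    | cons x l ih =>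
      rw [mon_cons, wt_cons]
      refine (map_mul L _ _).symm ▸ CDGA.mul_mem_grading ?_ ih
      cases x with
      | base p x => rw [← D.incl_coe]; exact base p x x.2
      | new i v => exact new i v
  have : D.toCDGA.grading p ≤ (B.grading p).comap L.toLinearMap := by
    refine Submodule.span_le.2 ?_
    rintro _ ⟨l, rfl, rfl⟩
    exact hmon l
  exact this ha

theorem map_d {B : CDGA.{u}} {L : D.toCDGA.carrier →ₐ[ℚ] B.carrier}
    (hL : ∀ {p : ℕ} {a : D.toCDGA.carrier}, a ∈ D.toCDGA.grading p → L a ∈ B.grading p)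
    (base : ∀ p, ∀ x ∈ U.grading p, B.d (L (D.incl x)) = L (D.toCDGA.d (D.incl x)))
    (new : ∀ i v, B.d (L (D.new i v)) = L (D.toCDGA.d (D.new i v))) (a : D.toCDGA.carrier) :
    B.d (L a) = L (D.toCDGA.d a) := by
  induction a using D.span_induction with
  | one => simp [CDGA.d_one]
  | base p x hx y hy => exact CDGA.d_comm_mul hL (D.incl_mem hx) (base p x hx) hy
  | new i v y hy => exact CDGA.d_comm_mul hL (D.new_mem i v) (new i v) hy
  | add x y hx hy => simp only [map_add, hx, hy]
  | smul c x hx => simp only [map_smul, hx]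

/-- The universal property of the extension. -/
theorem exists_hom {R : Type*} [Ring R] [Algebra ℚ R] (F : U.carrier →ₐ[ℚ] R)
    (f : ∀ i, D.W i →ₗ[ℚ] R)
    (hFf : ∀ p i, ∀ x ∈ U.grading p, ∀ v,
      F x * f i v = (-1 : ℚ) ^ (p * (n + i)) • (f i v * F x))
    (hf : ∀ i j v w, f i v * f j w = (-1 : ℚ) ^ ((n + i) * (n + j)) • (f j w * f i v)) :
    ∃ L : D.toCDGA.carrier →ₐ[ℚ] R, (∀ x, L (D.incl x) = F x) ∧ ∀ i v, L (D.new i v) = f i v := by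
  let L₀ : D.Alg →ₐ[ℚ] R := D.lift (fun x => match x with
      | .base _ x => F x
      | .new i v => f i v)
      { base_add := fun p x y => by simp
        base_smul := fun p c x => by simp
        base_one := map_one F
        base_mul := fun p q x y => map_mul F _ _
        new_add := fun i v w => map_add _ _ _
        new_smul := fun i c v => map_smul _ _ _
        comm := fun x y => by
          cases x with
          | base p x =>
            cases y with
            | base q y =>
              change F x * F y = (-1 : ℚ) ^ (p * q) • (F y * F x)
              rw [← map_mul, U.graded_comm x.2 y.2, map_smul, map_mul]
            | new i v => exact hFf p i x x.2 _
          | new i v =>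
            cases y with
            | base q y =>
              change f i v * F y = (-1 : ℚ) ^ ((n + i) * q) • (F y * f i v)
              rw [hFf q i y y.2, smul_smul, mul_comm q, ← mul_pow]
              simp
            | new j w => exact hf _ _ _ _ }
  let L : D.toCDGA.carrier →ₐ[ℚ] R := L₀
  refine ⟨L, fun x => ?_, fun i v => D.lift_gen _ _ _⟩
  induction x using DirectSum.Decomposition.inductionOn U.grading with
  | zero => simp
  | @homogeneous i m =>
    rw [D.incl_of_mem m.2]
    exact D.lift_gen _ _ (.base i m)
  | add x y hx hy => rw [map_add, map_add, map_add, hx, hy]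

theorem exists_ret : ∃ L : D.toCDGA.carrier →ₐ[ℚ] U.carrier,
    (∀ x, L (D.incl x) = x) ∧ ∀ i v, L (D.new i v) = 0 :=
  D.exists_hom (AlgHom.id ℚ _) (fun _ => 0) (by simp) (by simp)

/-- The retraction onto the base algebra that annihilates the new generators. -/
noncomputable def ret : D.toCDGA.carrier →ₐ[ℚ] U.carrier := D.exists_ret.choose

theorem ret_new (i : ℕ) (v : D.W i) : D.ret (D.new i v) = 0 := D.exists_ret.choose_spec.2 i v

theorem ret_incl (x : U.carrier) : D.ret (D.incl x) = x := D.exists_ret.choose_spec.1 x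

theorem ret_mem {p : ℕ} {a : D.toCDGA.carrier} (ha : a ∈ D.toCDGA.grading p) :
    D.ret a ∈ U.grading p :=
  D.map_mem (fun p x hx => by rwa [ret_incl]) (fun i v => by rw [ret_new]; exact zero_mem _) ha

/-- The new generators of degree `p`. -/
abbrev NewGen (p : ℕ) : Type u := ∀ i : {i // n + i = p}, D.W i.1

/-- A new generator, as an element of the generators of its degree. -/
def single (i : ℕ) (v : D.W i) : D.NewGen (n + i) := fun j =>
  (show i = j.1 by have := j.2; omega) ▸ v

theorem single_self (i : ℕ) (v : D.W i) : D.single i v ⟨i, rfl⟩ = v := rfl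

theorem single_eq (i : ℕ) (z : D.NewGen (n + i)) : D.single i (z ⟨i, rfl⟩) = z := by
  funext ⟨j, hj⟩
  obtain rfl : i = j := by omega
  rfl

theorem single_add (i : ℕ) (v w : D.W i) : D.single i (v + w) = D.single i v + D.single i w := by
  funext ⟨j, hj⟩
  obtain rfl : i = j := by omega
  rfl

theorem single_smul (i : ℕ) (c : ℚ) (v : D.W i) : D.single i (c • v) = c • D.single i v := by
  funext ⟨j, hj⟩
  obtain rfl : i = j := by omega
  rfl

/-- The inclusion of the new generators of degree `p`. -/
def newPart (p : ℕ) : D.NewGen p →ₗ[ℚ] D.toCDGA.carrier :=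
  -- With truncated subtraction the condition means `n ≤ p`; below degree `n` there are no new
  -- generators and the value is zero.
  if h : n + (p - n) = p then
    D.new (p - n) ∘ₗ LinearMap.proj (φ := fun i : {i // n + i = p} => D.W i.1) ⟨p - n, h⟩
  else 0

theorem newPart_apply {p i : ℕ} (h : n + i = p) (z : D.NewGen p) :
    D.newPart p z = D.new i (z ⟨i, h⟩) := by
  subst h
  have key : ∀ j (hj : n + j = n + i), D.new j (z ⟨j, hj⟩) = D.new i (z ⟨i, rfl⟩) := by
    intro j hj
    obtain rfl : j = i := by omega
    rfl
  rw [newPart, dif_pos (by omega)]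
  exact key _ _

theorem newPart_of_lt {p : ℕ} (h : p < n) (z : D.NewGen p) : D.newPart p z = 0 := by
  rw [newPart, dif_neg (by omega)]
  rfl

theorem newPart_mem (p : ℕ) (z : D.NewGen p) : D.newPart p z ∈ D.toCDGA.grading p := by
  by_cases h : n + (p - n) = p
  · rw [D.newPart_apply h]
    have := D.new_mem (p - n) (z ⟨p - n, h⟩)
    rwa [h] at this
  · rw [D.newPart_of_lt (by omega)]; exact zero_mem _

section Free

variable {W : ℕ → Type u} [∀ p, AddCommGroup (W p)] [∀ p, Module ℚ (W p)]
  {σ : ∀ p, W p →ₗ[ℚ] U.carrier}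

/-- The generators of an extension of a free algebra. -/
def sigma (σ : ∀ p, W p →ₗ[ℚ] U.carrier) (p : ℕ) : (W p × D.NewGen p) →ₗ[ℚ] D.toCDGA.carrier :=
  (D.incl.toLinearMap ∘ₗ σ p).coprod (D.newPart p)

theorem sigma_apply (p : ℕ) (x : W p × D.NewGen p) :
    D.sigma σ p x = D.incl (σ p x.1) + D.newPart p x.2 := rfl

theorem sigma_single (i : ℕ) (v : D.W i) :
    D.sigma σ (n + i) (0, D.single i v) = D.new i v := by
  rw [sigma_apply, D.newPart_apply rfl]
  change D.incl (σ (n + i) 0) + D.new i v = _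
  simp

/-- An extension of a free algebra is free. -/
theorem freeOn (hU : U.FreeOn W σ) (hn : 2 ≤ n) :
    D.toCDGA.FreeOn (fun p => W p × D.NewGen p) (D.sigma σ) where
  mem p x := add_mem (D.incl_mem (hU.mem p x.1)) (D.newPart_mem p x.2)
  low p hp x := Prod.ext (hU.low p hp x.1) (funext fun i => absurd i.2 (by omega))
  adjoin := by
    refine eq_top_iff.2 fun a _ => ?_
    have hincl : ∀ x, D.incl x ∈ Algebra.adjoin ℚ (⋃ p, Set.range (D.sigma σ p)) := fun x => by
      have hx : x ∈ Algebra.adjoin ℚ (⋃ p, Set.range (σ p)) := hU.adjoin ▸ Algebra.mem_top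
      have := (AlgHom.map_adjoin D.incl (⋃ p, Set.range (σ p))).le ⟨x, hx, rfl⟩
      refine Algebra.adjoin_mono ?_ this
      rintro _ ⟨_, ⟨_, ⟨p, rfl⟩, y, rfl⟩, rfl⟩
      refine Set.mem_iUnion.2 ⟨p, (y, 0), ?_⟩
      rw [sigma_apply]
      simp
    induction a using D.span_induction with
    | one => exact one_mem _
    | base p x _ y hy => exact mul_mem (hincl x) (hy trivial)
    | new i v y hy =>
      refine mul_mem (Algebra.subset_adjoin ?_) (hy trivial)
      exact Set.mem_iUnion.2 ⟨n + i, (0, D.single i v), D.sigma_single i v⟩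
    | add x y hx hy => exact add_mem (hx trivial) (hy trivial)
    | smul c x hx => exact Subalgebra.smul_mem _ (hx trivial) c
  free R _ _ f hf := by
    obtain ⟨F, hF⟩ := hU.free R (fun p => f p ∘ₗ LinearMap.inl ℚ (W p) (D.NewGen p))
      fun p q x y => hf p q (x, 0) (y, 0)
    -- `R` carries no grading, so the sign rule between `F a` and a new generator is known only for
    -- generators `a` and has to be spread to products.
    have hFf : ∀ p q, ∀ a ∈ U.grading p, ∀ y, F a * f q y = (-1 : ℚ) ^ (p * q) • (f q y * F a) := by
      intro p q a ha y
      let C : ℕ → Submodule ℚ U.carrier := fun p => LinearMap.eqLocus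
        (LinearMap.mulRight ℚ (f q y) ∘ₗ F.toLinearMap)
        ((-1 : ℚ) ^ (p * q) • (LinearMap.mulLeft ℚ (f q y) ∘ₗ F.toLinearMap))
      refine hU.grading_le C ?_ ?_ p ha
      · change F 1 * f q y = (-1 : ℚ) ^ (0 * q) • (f q y * F 1)
        simp
      · intro r s x b hb
        have hb' : F b * f q y = (-1 : ℚ) ^ (s * q) • (f q y * F b) := hb
        have hx : F (σ r x) * f q y = (-1 : ℚ) ^ (r * q) • (f q y * F (σ r x)) := by
          rw [hF]; exact hf r q (x, 0) y
        change F (σ r x * b) * f q y = (-1 : ℚ) ^ ((r + s) * q) • (f q y * F (σ r x * b))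
        rw [map_mul, mul_assoc, hb', mul_smul_comm, ← mul_assoc, hx, smul_mul_assoc, smul_smul,
          ← pow_add, mul_assoc, add_mul, add_comm (s * q)]
    obtain ⟨L, hL1, hL2⟩ := D.exists_hom F
      (fun i => f (n + i) ∘ₗ LinearMap.inr ℚ (W (n + i)) (D.NewGen (n + i)) ∘ₗ
        { toFun := D.single i
          map_add' := D.single_add i
          map_smul' := D.single_smul i })
      (fun p i x hx v => hFf p (n + i) x hx _) (fun i j v w => hf _ _ _ _)
    refine ⟨L, fun p x => ?_⟩
    rw [sigma_apply, map_add, hL1, hF]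
    by_cases h : n ≤ p
    · obtain ⟨i, rfl⟩ := Nat.exists_eq_add_of_le h
      rw [D.newPart_apply rfl, hL2]
      change f (n + i) (x.1, 0) + f (n + i) (0, D.single i (x.2 ⟨i, rfl⟩)) = _
      rw [single_eq, ← map_add, Prod.mk_add_mk, add_zero, zero_add]
    · rw [D.newPart_of_lt (by omega), map_zero, add_zero]
      change f p (x.1, 0) = _
      congr 1
      exact Prod.ext rfl (funext fun i => absurd i.2 (by omega))

theorem lin_new (hU : U.FreeOn W σ) (hn : 2 ≤ n) (i : ℕ) (v : D.W i) :
    (D.freeOn hU hn).lin (n + i) (D.new i v) = (0, D.single i v) := by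
  rw [← D.sigma_single (σ := σ) i v]
  exact (D.freeOn hU hn).lin_gen (n + i) (0, D.single i v)

theorem incl_mem_dec {p : ℕ} {a : U.carrier} (ha : a ∈ U.dec p) : D.incl a ∈ D.toCDGA.dec p :=
  CDGA.map_dec (B := D.toCDGA) D.incl (fun h => D.incl_mem h) ha

theorem ret_mem_dec {p : ℕ} {a : D.toCDGA.carrier} (ha : a ∈ D.toCDGA.dec p) : D.ret a ∈ U.dec p :=
  CDGA.map_dec (A := D.toCDGA) D.ret (fun h => D.ret_mem h) ha

theorem lin_incl (hU : U.FreeOn W σ) (hn : 2 ≤ n) {p : ℕ} (hp : 1 ≤ p) {a : U.carrier} (ha : a ∈ U.grading p) :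
    (D.freeOn hU hn).lin p (D.incl a) = (hU.lin p a, 0) := by
  have h := (D.freeOn hU hn).lin_dec (D.incl_mem_dec (hU.sub_lin_mem_dec hp ha))
  have h2 : D.sigma σ p (hU.lin p a, 0) = D.incl (σ p (hU.lin p a)) := by
    rw [sigma_apply]; simp
  rw [map_sub, ← h2, map_sub, (D.freeOn hU hn).lin_gen p (hU.lin p a, 0)] at h
  exact sub_eq_zero.1 h

/-- New generators start in degree `n`, so up to degree `n` they cannot be multiplied by anything of
positive degree. -/
theorem mem_incl_of_lt (hU : U.FreeOn W σ) {p : ℕ} (hp : p ≤ n) {a : D.toCDGA.carrier}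
    (ha : a ∈ D.toCDGA.grading p) (hn : 2 ≤ n) :
    a ∈ (U.grading p).map D.incl.toLinearMap ⊔ LinearMap.range (D.newPart p) := by
  have := (D.freeOn hU hn).grading_le (fun p => if p ≤ n then
      (U.grading p).map D.incl.toLinearMap ⊔ LinearMap.range (D.newPart p) else ⊤) (by
      rw [if_pos (by omega)]
      exact Submodule.mem_sup_left ⟨1, U.one_mem_grading, map_one D.incl⟩) (fun p q x y hy => by
      by_cases hpq : p + q ≤ n
      · rw [if_pos hpq]
        rw [if_pos (by omega)] at hy
        rcases Nat.eq_zero_or_pos p with rfl | hp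
        · rw [(D.freeOn hU hn).low 0 (by omega) x]
          simp
        have hq : q < n := by omega
        obtain ⟨_, ⟨b, hb, rfl⟩, _, ⟨z, rfl⟩, rfl⟩ := Submodule.mem_sup.1 hy
        rw [D.newPart_of_lt hq, add_zero]
        rw [sigma_apply, AlgHom.toLinearMap_apply]
        rcases Nat.eq_zero_or_pos q with rfl | hq
        · obtain ⟨c, rfl⟩ := hU.exists_scalar hb
          rw [map_smul, map_one, mul_smul_comm, mul_one]
          exact Submodule.smul_mem _ _ (Submodule.add_mem_sup ⟨_, hU.mem p x.1, rfl⟩ ⟨_, rfl⟩)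
        · rw [D.newPart_of_lt (p := p) (by omega), add_zero, ← map_mul]
          exact Submodule.mem_sup_left ⟨_, CDGA.mul_mem_grading (hU.mem p x.1) hb, rfl⟩
      · simp [hpq]) p ha
  rwa [if_pos hp] at this

/-- Below degree `n` the extension agrees with the base. -/
theorem exists_incl_of_lt (hU : U.FreeOn W σ) (hn : 2 ≤ n) {p : ℕ} (hp : p < n)
    {a : D.toCDGA.carrier} (ha : a ∈ D.toCDGA.grading p) : ∃ b ∈ U.grading p, D.incl b = a := by
  obtain ⟨_, ⟨b, hb, rfl⟩, _, ⟨z, rfl⟩, rfl⟩ :=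
    Submodule.mem_sup.1 (D.mem_incl_of_lt hU hp.le ha hn)
  exact ⟨b, hb, by rw [D.newPart_of_lt hp, add_zero]; rfl⟩

/-- In degree `n` the extension is the sum of the base and the new generators. -/
theorem exists_incl_add_new (hU : U.FreeOn W σ) (hn : 2 ≤ n) {a : D.toCDGA.carrier} (ha : a ∈ D.toCDGA.grading n) :
    ∃ b ∈ U.grading n, ∃ v, D.incl b + D.new 0 v = a := by
  obtain ⟨_, ⟨b, hb, rfl⟩, _, ⟨z, rfl⟩, rfl⟩ :=
    Submodule.mem_sup.1 (D.mem_incl_of_lt hU le_rfl ha hn)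
  refine ⟨b, hb, z ⟨0, rfl⟩, ?_⟩
  rw [D.newPart_apply (p := n) (i := 0) rfl]
  rfl

/-- The linear part has separate components for old and new generators; the new one is `v`, and
decomposables have none. -/
theorem new_eq_zero (hU : U.FreeOn W σ) (hn : 2 ≤ n) {i : ℕ} {b : U.carrier} (hb : b ∈ U.grading (n + i)) {v : D.W i}
    (h : D.incl b + D.new i v ∈ D.toCDGA.dec (n + i)) : v = 0 := by
  have h1 := (D.freeOn hU hn).lin_dec h
  rw [map_add, D.lin_incl hU hn (by omega) hb, D.lin_new hU hn] at h1
  have h3 := congrFun (congrArg Prod.snd h1) ⟨i, rfl⟩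
  simpa [single_self] using h3

theorem incl_add_new_inj (hU : U.FreeOn W σ) (hn : 2 ≤ n) {i : ℕ} {b b' : U.carrier} {v v' : D.W i}
    (h : D.incl b + D.new i v = D.incl b' + D.new i v') : b = b' ∧ v = v' := by
  have h1 := congrArg D.ret h
  simp only [map_add, ret_incl, ret_new, add_zero] at h1
  subst h1
  refine ⟨rfl, ?_⟩
  have h2 := D.new_eq_zero hU hn (i := i) (b := 0) (v := v - v') (zero_mem _) (by
    have : D.new i (v - v') = 0 := by
      rw [map_sub, add_left_cancel h, sub_self]
    rw [this, map_zero, add_zero]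
    exact zero_mem _)
  exact sub_eq_zero.1 h2

end Free

end HirschData

/-! ### Products of systems, transport of freeness, exactness of indecomposables -/

namespace VecSystem

variable {G : Type u} [Group G]

/-- The pointwise product of a family of systems. -/
def pi {I : Type} (R : I → VecSystem G) : VecSystem G where
  obj H := ModuleCat.of ℚ (∀ i, (R i).obj H)
  map f := ModuleCat.ofHom (LinearMap.pi fun i => ((R i).map f).hom ∘ₗ LinearMap.proj i)
  map_id H := by
    refine ModuleCat.hom_ext (LinearMap.ext fun x => funext fun i => ?_)
    exact map_id_apply (R i) _
  map_comp f g := by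
    refine ModuleCat.hom_ext (LinearMap.ext fun x => funext fun i => ?_)
    exact map_comp_apply (R i) f g _

theorem pi_injective {I : Type} {R : I → VecSystem G} (hR : ∀ i, Injective (R i)) :
    Injective (pi R) := by
  refine injective_of_extension fun A Z j f hj => ?_
  have h := fun i => exists_extension (hR i) j
    (f ≫ mkHom (X := pi R) (Y := R i)
      (fun H => LinearMap.proj (φ := fun i => (R i).obj H) i) fun _ _ => rfl)
    (fun H y hy => by rw [(injective_iff_map_eq_zero _).1 (hj H) y hy, map_zero])
  choose g hg using h
  refine ⟨mkHom (Y := pi R) (fun H => LinearMap.pi fun i => ((g i).app H).hom) ?_, ?_⟩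
  · intro H K k x
    exact funext fun i => map_apply_comm (g i) k x
  · exact hom_ext fun H x => funext fun i => apply_of_comp_eq (hg i) x

end VecSystem

namespace CDGA

theorem hom_inv_apply {A B : CDGA.{u}} (e : A ≅ B) (a : A.carrier) :
    e.inv.toAlgHom (e.hom.toAlgHom a) = a :=
  DFunLike.congr_fun (congrArg Hom.toAlgHom e.hom_inv_id) a

theorem inv_hom_apply {A B : CDGA.{u}} (e : A ≅ B) (b : B.carrier) :
    e.hom.toAlgHom (e.inv.toAlgHom b) = b :=
  DFunLike.congr_fun (congrArg Hom.toAlgHom e.inv_hom_id) b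

theorem FreeOn.of_iso {A B : CDGA.{u}} (e : A ≅ B) {W : ℕ → Type u} [∀ p, AddCommGroup (W p)]
    [∀ p, Module ℚ (W p)] {σ : ∀ p, W p →ₗ[ℚ] A.carrier} (hA : A.FreeOn W σ) :
    B.FreeOn W (fun p => e.hom.toAlgHom.toLinearMap ∘ₗ σ p) where
  mem p x := e.hom.map_mem (hA.mem p x)
  low := hA.low
  adjoin := by
    refine eq_top_iff.2 fun b _ => ?_
    have hb : e.inv.toAlgHom b ∈ Algebra.adjoin ℚ (⋃ p, Set.range (σ p)) :=
      hA.adjoin ▸ Algebra.mem_top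
    have := (AlgHom.map_adjoin e.hom.toAlgHom (⋃ p, Set.range (σ p))).le ⟨_, hb, rfl⟩
    rw [Set.image_iUnion] at this
    have h : (e.hom.toAlgHom : A.carrier →+* B.carrier) (e.inv.toAlgHom b) = b := inv_hom_apply e b
    rw [h] at this
    refine Algebra.adjoin_mono ?_ this
    refine Set.iUnion_mono fun p => ?_
    rintro _ ⟨_, ⟨x, rfl⟩, rfl⟩
    exact ⟨x, rfl⟩
  free R _ _ f hf := by
    obtain ⟨F, hF⟩ := hA.free R f hf
    refine ⟨F.comp e.inv.toAlgHom, fun p x => ?_⟩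
    change F (e.inv.toAlgHom (e.hom.toAlgHom (σ p x))) = _
    rw [hom_inv_apply, hF]

/-- The complex of indecomposables is exact in degrees above `k`. -/
def ExactAbove (A : CDGA.{u}) (k : ℕ) : Prop :=
  ∀ p, k ≤ p → ∀ y ∈ A.grading (p + 1), A.d y ∈ A.dec (p + 1 + 1) →
    ∃ z ∈ A.grading p, y - A.d z ∈ A.dec (p + 1)

theorem ExactAbove.of_iso {A B : CDGA.{u}} (e : A ≅ B) {k : ℕ} (hA : A.ExactAbove k) :
    B.ExactAbove k := by
  intro p hp y hy hdy
  obtain ⟨z, hz, h⟩ := hA p hp (e.inv.toAlgHom y) (e.inv.map_mem hy) (by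
    rw [← e.inv.map_d]
    exact map_dec _ (fun h => e.inv.map_mem h) hdy)
  refine ⟨e.hom.toAlgHom z, e.hom.map_mem hz, ?_⟩
  have := map_dec e.hom.toAlgHom (fun h => e.hom.map_mem h) h
  rwa [map_sub, inv_hom_apply, e.hom.map_d] at this

end CDGA

namespace HirschData

section Exact

variable {U : CDGA.{u}} {n : ℕ} (D : HirschData U n)
  {W : ℕ → Type u} [∀ p, AddCommGroup (W p)] [∀ p, Module ℚ (W p)]
  {σ : ∀ p, W p →ₗ[ℚ] U.carrier}

/-- The new generators form a subquotient complex `W 0 → W 1 → ⋯` of the indecomposables starting in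
degree `n`, exact after its first term. Modulo decomposables `y` is an old generator plus some `v`
in `W (i + 1)`. The new component of `dy` forces `w v = 0`, so `v = w u`, and subtracting the
differential of `u` moves `y` into `U`, where exactness is given. In degree `n` itself nothing is
claimed, since there the kernel of `w 0` appears. -/
theorem exactAbove (hU : U.FreeOn W σ) (hn : 2 ≤ n) {k : ℕ} (hk : k ≤ n) (hex : U.ExactAbove k)
    (hw : ∀ i v, D.w (i + 1) v = 0 → ∃ u, D.w i u = v) : D.toCDGA.ExactAbove n := by
  intro p hp y hy hdy
  obtain ⟨i, rfl⟩ := Nat.exists_eq_add_of_le hp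
  obtain ⟨⟨x, z⟩, hxz⟩ := (D.freeOn hU hn).exists_sub_mem_dec (by omega) hy
  rw [sigma_apply, D.newPart_apply (p := n + i + 1) (i := i + 1) rfl] at hxz
  set v := z ⟨i + 1, rfl⟩
  change y - (D.incl (σ (n + i + 1) x) + D.new (i + 1) v) ∈ _ at hxz
  have h1 := sub_mem hdy (CDGA.d_mem_dec hxz)
  rw [← map_sub, sub_sub_cancel, map_add, ← incl_d, d_new] at h1
  have hv : D.w (i + 1) v = 0 := by
    refine D.new_eq_zero hU hn (i := i + 2)
      (b := U.d (σ (n + i + 1) x) + (-1 : ℚ) ^ (i + 1) • (D.a (i + 1) v : U.carrier)) ?_ ?_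
    · exact add_mem (U.d_mem (hU.mem _ x)) (Submodule.smul_mem _ _ (D.a (i + 1) v).2)
    · rw [map_add, map_smul, add_assoc]
      exact h1
  obtain ⟨u, hu⟩ := hw i v hv
  have hy' : y - D.toCDGA.d (D.new i u) -
      D.incl (σ (n + i + 1) x - (-1 : ℚ) ^ i • (D.a i u : U.carrier)) ∈
        D.toCDGA.dec (n + i + 1) := by
    rw [d_new, hu, map_sub, map_smul]
    convert hxz using 1
    abel
  set b := σ (n + i + 1) x - (-1 : ℚ) ^ i • (D.a i u : U.carrier) with hb
  have hbm : b ∈ U.grading (n + i + 1) :=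
    sub_mem (hU.mem _ x) (Submodule.smul_mem _ _ (D.a i u).2)
  have hdb : U.d b ∈ U.dec (n + i + 1 + 1) := by
    have h2 := sub_mem hdy (CDGA.d_mem_dec hy')
    rw [map_sub, map_sub, D.toCDGA.d_d, sub_zero, sub_sub_cancel, ← incl_d] at h2
    have := D.ret_mem_dec h2
    rwa [ret_incl] at this
  obtain ⟨c, hc, hbc⟩ := hex (n + i) (by omega) b hbm hdb
  refine ⟨D.new i u + D.incl c, add_mem (D.new_mem i u) (D.incl_mem hc), ?_⟩
  have h3 := add_mem hy' (D.incl_mem_dec hbc)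
  rw [map_sub D.incl b, incl_d] at h3
  convert h3 using 1
  rw [map_add]
  abel

end Exact

section Map

variable {U U' : CDGA.{u}} {n : ℕ} {D : HirschData U n} {D' : HirschData U' n} {f : U ⟶ U'}
  (m : Map f D D')

theorem Map.toHom_incl (x : U.carrier) :
    m.toHom.toAlgHom (D.incl x) = D'.incl (f.toAlgHom x) := by
  induction x using DirectSum.Decomposition.inductionOn U.grading with
  | zero => simp
  | @homogeneous i x =>
    rw [D.incl_of_mem x.2, D'.incl_of_mem (f.map_mem x.2)]
    exact m.algHom_gen (.base i x)
  | add x y hx hy => rw [map_add, map_add, map_add, map_add, hx, hy]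

theorem Map.toHom_new (i : ℕ) (v : D.W i) :
    m.toHom.toAlgHom (D.new i v) = D'.new i (m.map i v) :=
  m.algHom_gen (.new i v)

end Map

end HirschData

/-! ### Free models of the stages, and injectivity of the graded pieces -/

section FreeModel

variable {G : Type u} [Group G]

/-- A presentation of a diagram of CDGAs as freely generated by injective systems. -/
structure FreeModel (N : DGADiagram G) where
  X : ℕ → VecSystem G
  inj : ∀ p, Injective (X p)
  σ : ∀ (H : OrbitCat G) (p : ℕ), (X p).obj H →ₗ[ℚ] (N.obj H).carrier
  nat : ∀ {H K : OrbitCat G} (f : H ⟶ K) (p : ℕ) (x : (X p).obj H),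
    (N.map f).toAlgHom (σ H p x) = σ K p ((X p).map f x)
  free : ∀ H, (N.obj H).FreeOn (fun p => (X p).obj H) (σ H)

/-- Transport along an isomorphism. -/
def FreeModel.ofIso {N N' : DGADiagram G} (e : N ≅ N') (M : FreeModel N) : FreeModel N' where
  X := M.X
  inj := M.inj
  σ H p := (e.app H).hom.toAlgHom.toLinearMap ∘ₗ M.σ H p
  nat {H K} f p x := by
    have h : (e.hom.app H ≫ N'.map f).toAlgHom (M.σ H p x) =
        (N.map f ≫ e.hom.app K).toAlgHom (M.σ H p x) := by rw [e.hom.naturality]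
    refine h.trans ?_
    change (e.hom.app K).toAlgHom ((N.map f).toAlgHom (M.σ H p x)) = _
    rw [M.nat]
    rfl
  free H := (M.free H).of_iso (e.app H)

/-- The constant diagram `ℚ` is freely generated by nothing. -/
def FreeModel.ofBijective (N : DGADiagram G)
    (hN : ∀ H, Function.Bijective (algebraMap ℚ (N.obj H).carrier)) : FreeModel N where
  X _ := VecSystem.pi (I := Empty) Empty.elim
  inj _ := VecSystem.pi_injective fun i => i.elim
  σ _ _ := 0
  nat _ _ _ := map_zero _
  free H :=
    { mem := fun p x => zero_mem _
      low := fun p _ x => funext fun i => i.elim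
      adjoin := by
        refine eq_top_iff.2 fun a _ => ?_
        obtain ⟨c, rfl⟩ := (hN H).2 a
        exact Subalgebra.algebraMap_mem _ c
      free := fun R _ _ f _ => by
        let e := AlgEquiv.ofBijective (Algebra.ofId ℚ (N.obj H).carrier) (hN H)
        refine ⟨(Algebra.ofId ℚ R).comp e.symm.toAlgHom, fun p x => ?_⟩
        have hx : x = 0 := funext fun i => i.elim
        rw [hx, map_zero, map_zero, map_zero] }

namespace ElementaryData

variable {N : DGADiagram G} {V : VecSystem G} {n : ℕ} {γ : CohomologySucc N V n}
  (E : ElementaryData γ)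

/-- An elementary extension of a free model. -/
def freeModel (M : FreeModel N) (hn : 2 ≤ n) : FreeModel E.extension where
  X p := VecSystem.prod (M.X p) (VecSystem.pi fun i : {i // n + i = p} => E.res.obj i.1)
  inj p := VecSystem.prod_injective (M.inj p) (VecSystem.pi_injective fun i => E.res.injective i.1)
  σ H p := (E.level H).sigma (M.σ H) p
  nat {H K} f p x := by
    have key : ∀ (x : (M.X p).obj H) (z : (E.level H).NewGen p),
        (E.levelMap f).toHom.toAlgHom ((E.level H).sigma (M.σ H) p (x, z)) =
          (E.level K).sigma (M.σ K) p ((M.X p).map f x, fun i => (E.levelMap f).map i.1 (z i)) := by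
      intro x z
      rw [HirschData.sigma_apply, map_add, HirschData.Map.toHom_incl, M.nat, HirschData.sigma_apply]
      congr 1
      by_cases h : n ≤ p
      · obtain ⟨i, rfl⟩ := Nat.exists_eq_add_of_le h
        rw [HirschData.newPart_apply _ rfl, HirschData.newPart_apply _ rfl,
          HirschData.Map.toHom_new]
      · rw [HirschData.newPart_of_lt _ (by omega), HirschData.newPart_of_lt _ (by omega), map_zero]
    exact key x.1 x.2
  free H := (E.level H).freeOn (M.free H) hn

end ElementaryData

/-- The stages of a minimal system are freely generated by injective systems, with exact complex
of indecomposables above the stage. -/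
theorem IsMinimalStage.exists_freeModel {k : ℕ} {N : DGADiagram G} (h : IsMinimalStage k N) :
    Nonempty (FreeModel N) ∧ ∀ H, (N.obj H).ExactAbove k := by
  induction h with
  | base k hk N hN =>
    let M := FreeModel.ofBijective N hN
    refine ⟨⟨M⟩, fun H p _ y hy _ => ⟨0, zero_mem _, ?_⟩⟩
    -- There are no generators, so every element of positive degree is decomposable.
    obtain ⟨x, hx⟩ := (M.free H).exists_sub_mem_dec (by omega) hy
    rw [map_zero]
    exact hx
  | step k hk N N' hN V γ E e ih =>
    obtain ⟨⟨M⟩, hex⟩ := ih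
    refine ⟨⟨(E.freeModel M (by omega)).ofIso e.symm⟩, fun H => ?_⟩
    refine CDGA.ExactAbove.of_iso (e.symm.app H) ?_
    refine (E.level H).exactAbove (M.free H) (by omega) (Nat.le_succ k) (hex H) fun i v hv => ?_
    exact (E.res.exact_succ i H v).1 hv

namespace FreeModel

variable {N : DGADiagram G} (M : FreeModel N)

/-- The graded pieces of a diagram with a free model are injective. -/
theorem degree_injective [Finite G] {N : DGADiagram G} (M : FreeModel N) (p : ℕ) :
    Injective (degreeSystem N p) := by
  choose r hr using fun q => VecSystem.exists_coind_retraction (M.inj q)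
  have hr' : ∀ q H x, (r q).app H ((VecSystem.toCoind (M.X q)).app H x) = x :=
    fun q H x => VecSystem.apply_of_comp_eq (hr q) x
  let F : VecSystem G := VecSystem.freeSystem fun q => VecSystem.coind (M.X q).obj
  -- The embeddings and retractions between the generators and coinduced systems induce natural
  -- algebra maps `I` and `J` with `J I = id`. Restricting `I` to degree `p`, and following `J` by
  -- the degree `p` component, makes `N^p` a retract of the injective system `F`.
  choose I hI using fun H => (M.free H).free
    (GradedSym fun q => (VecSystem.coind (M.X q).obj).obj H)
    (fun q => GradedSym.ι q ∘ₗ ((VecSystem.toCoind (M.X q)).app H).hom)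
    (fun q q' x y => GradedSym.ι_comm q q' _ _)
  let J : ∀ H, (GradedSym fun q => (VecSystem.coind (M.X q).obj).obj H) →ₐ[ℚ] (N.obj H).carrier :=
    fun H => GradedSym.lift (fun q => M.σ H q ∘ₗ ((r q).app H).hom)
      fun q q' x y => (N.obj H).graded_comm ((M.free H).mem _ _) ((M.free H).mem _ _)
  have hJ : ∀ H q x, J H (GradedSym.ι q x) = M.σ H q ((r q).app H x) :=
    fun H q x => GradedSym.lift_ι _ _ _ _
  have hJI : ∀ H a, J H (I H a) = a := fun H a => by
    have : (J H).comp (I H) = AlgHom.id ℚ _ := (M.free H).hom_ext fun q x => by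
      rw [AlgHom.comp_apply, hI]
      exact (hJ H q _).trans (by rw [hr']; rfl)
    exact DFunLike.congr_fun this a
  have hInat : ∀ {H K : OrbitCat G} (f : H ⟶ K) a,
      I K ((N.map f).toAlgHom a) = F.map f (I H a) := by
    intro H K f a
    have : (I K).comp (N.map f).toAlgHom =
        (GradedSym.map fun q => ((VecSystem.coind (M.X q).obj).map f).hom).comp (I H) := by
      refine (M.free H).hom_ext fun q x => ?_
      rw [AlgHom.comp_apply, AlgHom.comp_apply, M.nat, hI, hI]
      refine Eq.trans ?_ (GradedSym.map_ι _ _ _).symm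
      exact congrArg (GradedSym.ι q) (VecSystem.map_apply_comm (VecSystem.toCoind (M.X q)) f x)
    exact DFunLike.congr_fun this a
  have hJnat : ∀ {H K : OrbitCat G} (f : H ⟶ K) (a : F.obj H),
      J K (F.map f a) = (N.map f).toAlgHom (J H a) := by
    intro H K f a
    have : (J K).comp (GradedSym.map fun q => ((VecSystem.coind (M.X q).obj).map f).hom) =
        (N.map f).toAlgHom.comp (J H) := by
      refine GradedSym.algHom_ext fun q x => ?_
      rw [AlgHom.comp_apply, AlgHom.comp_apply, GradedSym.map_ι, hJ, hJ, M.nat]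
      exact congrArg (M.σ K q) (VecSystem.map_apply_comm (r q) f x)
    exact DFunLike.congr_fun this a
  refine VecSystem.injective_of_retract
    (VecSystem.freeSystem_coind_injective fun q => (M.X q).obj)
    (VecSystem.mkHom (Y := F) (fun H => (I H).toLinearMap ∘ₗ ((N.obj H).grading p).subtype) ?_)
    (VecSystem.mkHom (X := F) (Y := degreeSystem N p) (fun H =>
      (N.obj H).component p ∘ₗ (J H).toLinearMap) ?_) ?_
  · intro H K f x
    exact hInat f _
  · intro H K f x
    refine Subtype.ext ?_
    refine (congrArg (fun a => (DirectSum.decompose (N.obj K).grading a p : (N.obj K).carrier))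
      (hJnat f x)).trans ?_
    exact CDGA.decompose_map (N.map f).toAlgHom (fun h => (N.map f).map_mem h) (J H x) p
  · intro H x
    refine Subtype.ext ?_
    refine (congrArg (fun a => (DirectSum.decompose (N.obj H).grading a p : (N.obj H).carrier))
      (hJI H (show (N.obj H).grading p from x).1)).trans ?_
    exact DirectSum.decompose_of_mem_same _ (show (N.obj H).grading p from x).2

end FreeModel

end FreeModel

/-! ### Natural families of graded algebra maps -/

namespace CDGA

theorem isIso_of_bijective {A B : CDGA.{u}} (f : A ⟶ B) (hf : Function.Bijective f.toAlgHom) :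
    IsIso f := by
  let e : A.carrier ≃ₐ[ℚ] B.carrier := AlgEquiv.ofBijective f.toAlgHom hf
  have he : ∀ a, f.toAlgHom (e.symm a) = a := fun a => e.apply_symm_apply a
  have hmem : ∀ {p : ℕ} {b : B.carrier}, b ∈ B.grading p → e.symm b ∈ A.grading p := by
    intro p b hb
    have h := decompose_map f.toAlgHom (fun h => f.map_mem h) (e.symm b) p
    rw [he, DirectSum.decompose_of_mem_same _ hb] at h
    have : e.symm b = (DirectSum.decompose A.grading (e.symm b) p : A.carrier) :=
      hf.1 ((he b).trans h)
    rw [this]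
    exact (DirectSum.decompose A.grading (e.symm b) p).2
  let g : B ⟶ A := ⟨e.symm.toAlgHom, hmem, fun b => hf.1 (by
    rw [f.map_d]
    exact (he _).trans (congrArg B.d (he b).symm))⟩
  refine ⟨g, Hom.ext (AlgHom.ext fun a => e.symm_apply_apply a), Hom.ext (AlgHom.ext fun b => he b)⟩

end CDGA

section DegreeValue

variable {G : Type u} [Group G]

/-- The underlying element of an element of a system of graded pieces. -/
def degVal {N : DGADiagram G} {p : ℕ} {H : OrbitCat G} :
    (degreeSystem N p).obj H →ₗ[ℚ] (N.obj H).carrier :=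
  ((N.obj H).grading p).subtype

theorem degVal_mem {N : DGADiagram G} {p : ℕ} {H : OrbitCat G} (x : (degreeSystem N p).obj H) :
    degVal x ∈ (N.obj H).grading p :=
  (show (N.obj H).grading p from x).2

theorem degVal_injective {N : DGADiagram G} {p : ℕ} {H : OrbitCat G} :
    Function.Injective (degVal (N := N) (p := p) (H := H)) :=
  Subtype.val_injective

theorem degVal_naturality {X : VecSystem G} {N : DGADiagram G} {p : ℕ} (η : X ⟶ degreeSystem N p)
    {H K : OrbitCat G} (f : H ⟶ K) (x : X.obj H) :
    degVal (η.app K (X.map f x)) = (N.map f).toAlgHom (degVal (η.app H x)) := by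
  rw [VecSystem.map_apply_comm]; rfl

/-- A natural family of linear maps with values in degree `p`, as a map of systems. -/
def toDegree {X : VecSystem G} {N : DGADiagram G} {p : ℕ}
    (f : ∀ H, X.obj H →ₗ[ℚ] (N.obj H).carrier) (mem : ∀ H x, f H x ∈ (N.obj H).grading p)
    (nat : ∀ {H K : OrbitCat G} (g : H ⟶ K) (x : X.obj H),
      f K (X.map g x) = (N.map g).toAlgHom (f H x)) : X ⟶ degreeSystem N p :=
  VecSystem.mkHom (Y := degreeSystem N p) (fun H => (f H).codRestrict _ (mem H))
    fun g x => Subtype.ext (nat g x)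

/-- A natural family of graded algebra maps, not necessarily compatible with the differentials. -/
structure AlgNat (N N' : DGADiagram G) where
  hom : ∀ H, (N.obj H).carrier →ₐ[ℚ] (N'.obj H).carrier
  mem : ∀ {H p a}, a ∈ (N.obj H).grading p → hom H a ∈ (N'.obj H).grading p
  nat : ∀ {H K : OrbitCat G} (f : H ⟶ K) (a : (N.obj H).carrier),
    hom K ((N.map f).toAlgHom a) = (N'.map f).toAlgHom (hom H a)

/-- A natural family of bijective graded algebra maps compatible with the differentials is an
isomorphism. -/
theorem AlgNat.exists_iso {N N' : DGADiagram G} (F : AlgNat N N')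
    (hd : ∀ H p, ∀ a ∈ (N.obj H).grading p, (N'.obj H).d (F.hom H a) = F.hom H ((N.obj H).d a))
    (hF : ∀ H, Function.Bijective (F.hom H)) :
    ∃ e : N ≅ N', ∀ H a, (e.hom.app H).toAlgHom a = F.hom H a := by
  have hd' : ∀ H a, F.hom H ((N.obj H).d a) = (N'.obj H).d (F.hom H a) := by
    intro H a
    induction a using DirectSum.Decomposition.inductionOn (N.obj H).grading with
    | zero => simp
    | @homogeneous i m => exact (hd H i m m.2).symm
    | add x y hx hy => simp only [map_add, hx, hy]
  let η : N ⟶ N' :=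
    { app := fun H => ⟨F.hom H, F.mem, hd' H⟩
      naturality := fun H K f => CDGA.Hom.ext (AlgHom.ext fun a => F.nat f a) }
  have : ∀ H, IsIso (η.app H) := fun H => CDGA.isIso_of_bijective _ (hF H)
  have : IsIso η := NatIso.isIso_of_isIso_app η
  exact ⟨asIso η, fun H a => rfl⟩

end DegreeValue

/-! ### Constructing automorphisms of a free model degree by degree -/

namespace FreeModel

variable {G : Type u} [Group G] {N : DGADiagram G} (M : FreeModel N)

theorem exists_algNat {N' : DGADiagram G} (κ : ∀ p, M.X p ⟶ degreeSystem N' p) :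
    ∃ F : AlgNat N N', ∀ H p x, F.hom H (M.σ H p x) = degVal ((κ p).app H x) := by
  choose F hF using fun H => (M.free H).exists_hom (B := N'.obj H)
    (fun p => degVal ∘ₗ ((κ p).app H).hom) fun p x => degVal_mem _
  have hF' : ∀ H p x, F H (M.σ H p x) = degVal ((κ p).app H x) := hF
  refine ⟨⟨F, fun {H p a} ha => (M.free H).map_mem (fun p x => ?_) ha, fun {H K} f a => ?_⟩, hF'⟩
  · rw [hF']; exact degVal_mem _
  · have : (F K).comp (N.map f).toAlgHom = (N'.map f).toAlgHom.comp (F H) :=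
      (M.free H).hom_ext fun p x => by
        rw [AlgHom.comp_apply, AlgHom.comp_apply, M.nat, hF', hF']
        exact degVal_naturality (κ p) f x
    exact DFunLike.congr_fun this a

/-- The natural graded algebra map with prescribed values on the generators. -/
noncomputable def extend {N' : DGADiagram G} (κ : ∀ p, M.X p ⟶ degreeSystem N' p) : AlgNat N N' :=
  (M.exists_algNat κ).choose

theorem extend_gen {N' : DGADiagram G} (κ : ∀ p, M.X p ⟶ degreeSystem N' p) (H : OrbitCat G)
    (p : ℕ) (x : (M.X p).obj H) :
    (M.extend κ).hom H (M.σ H p x) = degVal ((κ p).app H x) :=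
  (M.exists_algNat κ).choose_spec H p x

/-- The projection onto the generators of degree `p`, at an orbit. -/
noncomputable def linAt (H : OrbitCat G) (p : ℕ) : (N.obj H).carrier →ₗ[ℚ] (M.X p).obj H :=
  (M.free H).lin p

theorem linAt_gen (H : OrbitCat G) (p : ℕ) (x : (M.X p).obj H) : M.linAt H p (M.σ H p x) = x :=
  (M.free H).lin_gen p x

theorem linAt_dec {H : OrbitCat G} {p : ℕ} {a : (N.obj H).carrier} (ha : a ∈ (N.obj H).dec p) :
    M.linAt H p a = 0 :=
  (M.free H).lin_dec ha

theorem sub_linAt_mem_dec {H : OrbitCat G} {p : ℕ} (hp : 1 ≤ p) {a : (N.obj H).carrier}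
    (ha : a ∈ (N.obj H).grading p) : a - M.σ H p (M.linAt H p a) ∈ (N.obj H).dec p :=
  (M.free H).sub_lin_mem_dec hp ha

theorem linAt_nat {H K : OrbitCat G} (f : H ⟶ K) {p : ℕ} (hp : 1 ≤ p) {a : (N.obj H).carrier}
    (ha : a ∈ (N.obj H).grading p) :
    M.linAt K p ((N.map f).toAlgHom a) = (M.X p).map f (M.linAt H p a) := by
  have h := M.linAt_dec (CDGA.map_dec (N.map f).toAlgHom (fun h => (N.map f).map_mem h)
    (M.sub_linAt_mem_dec hp ha))
  rw [map_sub, map_sub, M.nat, linAt_gen] at h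
  exact sub_eq_zero.1 h

/-- The projection onto the generators of degree `p + 1`, as a map of systems. -/
noncomputable def linNat (p : ℕ) (hp : 1 ≤ p) : degreeSystem N p ⟶ M.X p :=
  VecSystem.mkHom (X := degreeSystem N p) (fun H => M.linAt H p ∘ₗ degVal)
    fun f x => M.linAt_nat f hp (degVal_mem x)

/-- The inclusion of the generators, as a map of systems. -/
def sigmaNat (p : ℕ) : M.X p ⟶ degreeSystem N p :=
  toDegree (fun H => M.σ H p) (fun H x => (M.free H).mem p x) fun f x => (M.nat f p x).symm

/-- The linear part of the differential. -/
noncomputable def linD (p : ℕ) : M.X p ⟶ M.X (p + 1) :=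
  VecSystem.mkHom (fun H => M.linAt H (p + 1) ∘ₗ (N.obj H).d ∘ₗ M.σ H p) fun {H K} f x => by
    change M.linAt K (p + 1) ((N.obj K).d (M.σ K p ((M.X p).map f x))) = _
    rw [← M.nat, ← (N.map f).map_d, M.linAt_nat f (by omega)]
    · rfl
    · exact (N.obj H).d_mem ((M.free H).mem p x)

theorem linD_apply (p : ℕ) {H : OrbitCat G} (x : (M.X p).obj H) :
    (M.linD p).app H x = M.linAt H (p + 1) ((N.obj H).d (M.σ H p x)) := rfl

theorem linAt_d {H : OrbitCat G} {p : ℕ} (hp : 1 ≤ p) {a : (N.obj H).carrier}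
    (ha : a ∈ (N.obj H).grading p) :
    M.linAt H (p + 1) ((N.obj H).d a) = (M.linD p).app H (M.linAt H p a) := by
  have h := M.linAt_dec (CDGA.d_mem_dec (M.sub_linAt_mem_dec hp ha))
  rw [map_sub, map_sub] at h
  exact sub_eq_zero.1 h

theorem linD_linD {H : OrbitCat G} {p : ℕ} (x : (M.X p).obj H) :
    (M.linD (p + 1)).app H ((M.linD p).app H x) = 0 := by
  rw [linD_apply M p, ← M.linAt_d (by omega) ((N.obj H).d_mem ((M.free H).mem p x)),
    (N.obj H).d_d, map_zero]

/-- A graded algebra map preserves decomposables, so it acts on indecomposables; this needs no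
compatibility with `d`. -/
theorem linAt_map {H : OrbitCat G} (F : AlgNat N N) {p : ℕ} (hp : 1 ≤ p) {a : (N.obj H).carrier}
    (ha : a ∈ (N.obj H).grading p) :
    M.linAt H p (F.hom H a) = M.linAt H p (F.hom H (M.σ H p (M.linAt H p a))) :=
  (M.free H).lin_map (fun h => F.mem h) hp ha

theorem exists_linD_eq {k : ℕ} (hex : ∀ H, (N.obj H).ExactAbove k) {H : OrbitCat G} {p : ℕ}
    (hp : 1 ≤ p) (hkp : k ≤ p) (x : (M.X (p + 1)).obj H) (hx : (M.linD (p + 1)).app H x = 0) :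
    ∃ z, (M.linD p).app H z = x := by
  have hm := (M.free H).mem (p + 1) x
  obtain ⟨z, hz, h⟩ := hex H p hkp (M.σ H (p + 1) x) hm
    ((M.free H).mem_dec_of_lin (by omega) ((N.obj H).d_mem hm) hx)
  refine ⟨M.linAt H p z, ?_⟩
  have := M.linAt_dec h
  rw [map_sub, linAt_gen, M.linAt_d hp hz, sub_eq_zero] at this
  exact this.symm

/-- The values `κ` on generators define a map compatible with the differentials up to degree `m`
whose linear part is bijective. -/
structure GoodUpTo (m : ℕ) (κ : ∀ p, M.X p ⟶ degreeSystem N p) : Prop where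
  d_comm : ∀ H, ∀ q < m, ∀ x, (N.obj H).d ((M.extend κ).hom H (M.σ H q x)) =
    (M.extend κ).hom H ((N.obj H).d (M.σ H q x))
  d_comm_ker : ∀ H x, (M.linD m).app H x = 0 → (N.obj H).d ((M.extend κ).hom H (M.σ H m x)) =
    (M.extend κ).hom H ((N.obj H).d (M.σ H m x))
  bij : ∀ H, ∀ q ≤ m, Function.Bijective fun x => M.linAt H q (degVal ((κ q).app H x))
  ker : ∀ H x, (M.linD m).app H (M.linAt H m (degVal ((κ m).app H x))) = 0 →
    (M.linD m).app H x = 0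

theorem extend_eq_of_le {κ κ' : ∀ p, M.X p ⟶ degreeSystem N p} {m : ℕ}
    (h : ∀ q ≤ m, κ q = κ' q) {H : OrbitCat G} {p : ℕ} (hp : p ≤ m) {a : (N.obj H).carrier}
    (ha : a ∈ (N.obj H).grading p) : (M.extend κ).hom H a = (M.extend κ').hom H a :=
  (M.free H).eq_of_le (fun q hq x => by rw [extend_gen, extend_gen, h q hq]) hp ha

theorem extend_eq_of_dec {κ κ' : ∀ p, M.X p ⟶ degreeSystem N p} {m : ℕ}
    (h : ∀ q ≤ m, κ q = κ' q) {H : OrbitCat G} {a : (N.obj H).carrier}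
    (ha : a ∈ (N.obj H).dec (m + 1)) : (M.extend κ).hom H a = (M.extend κ').hom H a :=
  CDGA.eq_of_mem_dec (fun q hq _ hb => M.extend_eq_of_le h (by omega : q ≤ m) hb) ha

/-- Write `δ` for `linD`. On generators of degree `m`, compatibility with `d` prescribes the new
values on the image of `δ`, and the prescription is consistent exactly because compatibility already
holds on `ker δ`. It extends to all generators of degree `m + 1` by injectivity of `N^{m+1}`, and is
then corrected off the image of `δ` to have bijective linear part. Exactness restores the two kernel
conditions one degree higher. -/
theorem GoodUpTo.exists_succ {k m : ℕ} (hex : ∀ H, (N.obj H).ExactAbove k) (hk : 1 ≤ k)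
    (hkm : k ≤ m) (hinj : Injective (degreeSystem N (m + 1)))
    {κ : ∀ p, M.X p ⟶ degreeSystem N p} (hκ : M.GoodUpTo m κ) :
    ∃ κ' : ∀ p, M.X p ⟶ degreeSystem N p, (∀ q ≤ m, κ' q = κ q) ∧ M.GoodUpTo (m + 1) κ' := by
  classical
  have hm : 1 ≤ m := hk.trans hkm
  have hσ := fun H => (M.free H).mem m
  have hdσ := fun H x => (N.obj H).d_mem (hσ H x)
  let F := M.extend κ
  have hF : ∀ H p x, F.hom H (M.σ H p x) = degVal ((κ p).app H x) := M.extend_gen κ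
  let e : M.X m ⟶ M.X m := κ m ≫ M.linNat m hm
  have he : ∀ H x, e.app H x = M.linAt H m (degVal ((κ m).app H x)) := fun _ _ => rfl
  have hde : ∀ H x, M.linAt H (m + 1) ((N.obj H).d (F.hom H (M.σ H m x))) =
      (M.linD m).app H (e.app H x) := fun H x => by
    rw [M.linAt_d hm (F.mem (hσ H x)), hF, he]
  -- Since `d x` is `δ x` plus a decomposable, on which the old and new maps agree, compatibility at
  -- `x` says that the new value at `δ x` is `u x`. The old value of `κ (m + 1)` in the formula only
  -- cancels the contribution of `δ x` to `F (d x)`.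
  let u : M.X m ⟶ degreeSystem N (m + 1) := toDegree
    (fun H => (N.obj H).d ∘ₗ (F.hom H).toLinearMap ∘ₗ M.σ H m -
      (F.hom H).toLinearMap ∘ₗ (N.obj H).d ∘ₗ M.σ H m +
        degVal ∘ₗ ((κ (m + 1)).app H).hom ∘ₗ ((M.linD m).app H).hom)
    (fun H x => add_mem (sub_mem ((N.obj H).d_mem (F.mem (hσ H x))) (F.mem (hdσ H x)))
      (degVal_mem _))
    (fun {H K} g x => by
      change (N.obj K).d (F.hom K (M.σ K m ((M.X m).map g x))) -
        F.hom K ((N.obj K).d (M.σ K m ((M.X m).map g x))) +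
          degVal ((κ (m + 1)).app K ((M.linD m).app K ((M.X m).map g x))) =
        (N.map g).toAlgHom ((N.obj H).d (F.hom H (M.σ H m x)) -
        F.hom H ((N.obj H).d (M.σ H m x)) + degVal ((κ (m + 1)).app H ((M.linD m).app H x)))
      rw [VecSystem.map_apply_comm, degVal_naturality, ← M.nat, F.nat, ← (N.map g).map_d,
        ← (N.map g).map_d, F.nat, map_add, map_sub])
  have hu : ∀ H x, degVal (u.app H x) = (N.obj H).d (F.hom H (M.σ H m x)) -
      F.hom H ((N.obj H).d (M.σ H m x)) + degVal ((κ (m + 1)).app H ((M.linD m).app H x)) :=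
    fun _ _ => rfl
  obtain ⟨k₀, hk₀⟩ := VecSystem.exists_extension hinj (M.linD m) u (fun H x hx => by
    apply degVal_injective
    rw [hu, hκ.d_comm_ker H x hx, hx, map_zero, map_zero, add_zero]
    exact sub_self _)
  obtain ⟨e', hee', hbij⟩ := VecSystem.exists_automorphism_extending (M.inj (m + 1)) (M.linD m) e
    (fun H => (hκ.bij H m le_rfl).2) (fun H x => ⟨hκ.ker H x, fun hx => by
      rw [← hde, hκ.d_comm_ker H x hx]
      exact M.linAt_dec (CDGA.map_dec _ (fun h => F.mem h)
        ((M.free H).mem_dec_of_lin (by omega) (hdσ H x) hx))⟩)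
  have hk₀' : ∀ H x, k₀.app H ((M.linD m).app H x) = u.app H x :=
    fun H x => VecSystem.apply_of_comp_eq hk₀ x
  have hee : ∀ H x, e'.app H ((M.linD m).app H x) = (M.linD m).app H (e.app H x) :=
    fun H x => VecSystem.apply_of_comp_eq hee' x
  -- The correction replaces the linear part of `k₀` by the automorphism `e'`. It vanishes on the
  -- image of `δ`, where both linear parts are `δ ∘ e`, so the prescribed values are kept.
  let new : M.X (m + 1) ⟶ degreeSystem N (m + 1) :=
    k₀ + (e' - k₀ ≫ M.linNat (m + 1) (by omega)) ≫ M.sigmaNat (m + 1)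
  have hnew : ∀ H x, degVal (new.app H x) = degVal (k₀.app H x) +
      M.σ H (m + 1) (e'.app H x - M.linAt H (m + 1) (degVal (k₀.app H x))) := fun _ _ => rfl
  let κ' : ∀ p, M.X p ⟶ degreeSystem N p := Function.update κ (m + 1) new
  have hκ'1 : κ' (m + 1) = new := Function.update_self _ _ _
  have hκ'2 : ∀ q ≤ m, κ' q = κ q := fun q hq => Function.update_of_ne (by omega) _ _
  let F' := M.extend κ'
  have hF' : ∀ H p x, F'.hom H (M.σ H p x) = degVal ((κ' p).app H x) := M.extend_gen κ'
  have hlin : ∀ H x, M.linAt H (m + 1) (degVal ((κ' (m + 1)).app H x)) = e'.app H x := by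
    intro H x
    rw [hκ'1, hnew, map_add, linAt_gen, add_sub_cancel]
  have hlinu : ∀ H x, M.linAt H (m + 1) (degVal (u.app H x)) = (M.linD m).app H (e.app H x) := by
    intro H x
    rw [hu, map_add, map_sub, hde, M.linAt_map F (by omega) (hdσ H x), ← linD_apply, hF,
      sub_add_cancel]
  have hnewu : ∀ H x, degVal (new.app H ((M.linD m).app H x)) = degVal (u.app H x) := by
    intro H x
    rw [hnew, hk₀', hlinu, hee, sub_self, map_zero, add_zero]
  have hFF' : ∀ H p, p ≤ m → ∀ a ∈ (N.obj H).grading p, F'.hom H a = F.hom H a :=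
    fun H p hp a ha => M.extend_eq_of_le hκ'2 hp ha
  have hd : ∀ H, ∀ q < m + 1, ∀ x, (N.obj H).d (F'.hom H (M.σ H q x)) =
      F'.hom H ((N.obj H).d (M.σ H q x)) := by
    intro H q hq x
    have hq' := (M.free H).mem q x
    rw [hFF' H q (by omega) _ hq']
    rcases Nat.lt_succ_iff_lt_or_eq.1 hq with hq | rfl
    · rw [hFF' H (q + 1) (by omega) _ ((N.obj H).d_mem hq')]
      exact hκ.d_comm H q hq x
    · have h1 := M.sub_linAt_mem_dec (by omega) (hdσ H x)
      have h2 : F'.hom H _ = F.hom H _ := M.extend_eq_of_dec hκ'2 h1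
      rw [← linD_apply, map_sub, map_sub, hF', hF, hκ'1, hnewu, hu] at h2
      rw [sub_eq_iff_eq_add.1 h2]
      abel
  have hd' : ∀ H, ∀ q < m + 1, ∀ a ∈ (N.obj H).grading q, (N.obj H).d (F'.hom H a) =
      F'.hom H ((N.obj H).d a) := fun H q hq a ha =>
    (M.free H).d_comm (fun p x => F'.mem ((M.free H).mem p x)) (hd H) hq ha
  refine ⟨κ', hκ'2, hd, fun H x hx => ?_, fun H q hq => ?_, fun H x hx => ?_⟩
  · have hx' := (M.free H).mem (m + 1) x
    -- By exactness the generator is `dz` plus a decomposable, with `z` of degree `m`; on both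
    -- pieces compatibility follows from degrees at most `m`.
    obtain ⟨z, hz, h⟩ := hex H m hkm _ hx'
      ((M.free H).mem_dec_of_lin (by omega) ((N.obj H).d_mem hx') hx)
    have h1 := CDGA.d_comm_of_mem_dec (fun h => F'.mem h) (hd' H) h
    rw [map_sub, map_sub, map_sub, map_sub, (N.obj H).d_d, map_zero, sub_zero,
      ← hd' H m (by omega) z hz, (N.obj H).d_d, sub_zero] at h1
    exact h1
  · rcases Nat.le_succ_iff.1 hq with hq | rfl
    · rw [hκ'2 q hq]; exact hκ.bij H q hq
    · simp only [hlin]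
      exact hbij H
  · rw [hlin] at hx
    -- If `δ (e' x) = 0`, then `e' x = δ z = δ (e w) = e' (δ w)`, so `x = δ w` and `δ x = 0`.
    obtain ⟨z, hz⟩ := M.exists_linD_eq hex hm hkm _ hx
    obtain ⟨w, rfl⟩ := (hκ.bij H m le_rfl).2 z
    change (M.linD m).app H (e.app H w) = _ at hz
    rw [← hee] at hz
    rw [← (hbij H).1 hz, linD_linD]

/-- A graded algebra endomorphism that, up to degree `k`, is invertible and compatible with the
differentials agrees up to degree `k` with an automorphism. -/
theorem exists_automorphism {N : DGADiagram G} (M : FreeModel N) {k : ℕ}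
    (hex : ∀ H, (N.obj H).ExactAbove k) (hk : 1 ≤ k)
    (hinj : ∀ p, Injective (degreeSystem N p)) (Φ Ψ : AlgNat N N)
    (hΦ : ∀ H, ∀ p ≤ k, ∀ a ∈ (N.obj H).grading p,
      (N.obj H).d (Φ.hom H a) = Φ.hom H ((N.obj H).d a))
    (hΨ : ∀ H, ∀ p ≤ k, ∀ a ∈ (N.obj H).grading p,
      (N.obj H).d (Ψ.hom H a) = Ψ.hom H ((N.obj H).d a))
    (hΦΨ : ∀ H, ∀ p ≤ k, ∀ a ∈ (N.obj H).grading p, Φ.hom H (Ψ.hom H a) = a)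
    (hΨΦ : ∀ H, ∀ p ≤ k, ∀ a ∈ (N.obj H).grading p, Ψ.hom H (Φ.hom H a) = a) :
    ∃ κ : N ≅ N, ∀ H, ∀ p ≤ k, ∀ a ∈ (N.obj H).grading p,
      (κ.hom.app H).toAlgHom a = Φ.hom H a := by
  let κ₀ : ∀ p, M.X p ⟶ degreeSystem N p := fun p =>
    toDegree (fun H => (Φ.hom H).toLinearMap ∘ₗ M.σ H p)
      (fun H x => Φ.mem ((M.free H).mem p x)) fun {H K} f x => by
        change Φ.hom K (M.σ K p ((M.X p).map f x)) = (N.map f).toAlgHom (Φ.hom H (M.σ H p x))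
        rw [← M.nat, Φ.nat]
  have hκ₀ : ∀ H p x, degVal ((κ₀ p).app H x) = Φ.hom H (M.σ H p x) := fun _ _ _ => rfl
  have hext : ∀ H a, (M.extend κ₀).hom H a = Φ.hom H a := fun H a => by
    have : (M.extend κ₀).hom H = Φ.hom H := (M.free H).hom_ext fun p x => M.extend_gen κ₀ H p x
    rw [this]
  have hgood : M.GoodUpTo k κ₀ := by
    refine ⟨fun H q hq x => ?_, fun H x _ => ?_, fun H q hq => ?_, fun H x hx => ?_⟩
    · rw [hext, hext]; exact hΦ H q hq.le _ ((M.free H).mem q x)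
    · rw [hext, hext]; exact hΦ H k le_rfl _ ((M.free H).mem k x)
    · rcases Nat.eq_zero_or_pos q with rfl | hq0
      · have h0 := (M.free H).low 0 (by omega)
        exact ⟨fun x y _ => (h0 x).trans (h0 y).symm, fun x => ⟨0, (h0 _).trans (h0 x).symm⟩⟩
      refine Function.bijective_iff_has_inverse.2
        ⟨fun x => M.linAt H q (Ψ.hom H (M.σ H q x)), fun x => ?_, fun x => ?_⟩
      · have hx := (M.free H).mem q x
        change M.linAt H q (Ψ.hom H (M.σ H q (M.linAt H q (Φ.hom H (M.σ H q x))))) = x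
        rw [← M.linAt_map Ψ hq0 (Φ.mem hx), hΨΦ H q hq _ hx, linAt_gen]
      · have hx := (M.free H).mem q x
        change M.linAt H q (Φ.hom H (M.σ H q (M.linAt H q (Ψ.hom H (M.σ H q x))))) = x
        rw [← M.linAt_map Φ hq0 (Ψ.mem hx), hΦΨ H q hq _ hx, linAt_gen]
    · have hm := (M.free H).mem k x
      rw [hκ₀, ← M.linAt_d hk (Φ.mem hm), hΦ H k le_rfl _ hm] at hx
      -- The differential has degree `k + 1`, outside the range where `Φ` and `Ψ` are known to be
      -- inverse. Being the differential of an element of degree `k`, it is nevertheless recovered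
      -- by `Ψ`.
      have h1 : Ψ.hom H (Φ.hom H ((N.obj H).d (M.σ H k x))) = (N.obj H).d (M.σ H k x) := by
        rw [← hΦ H k le_rfl _ hm, ← hΨ H k le_rfl _ (Φ.mem hm), hΨΦ H k le_rfl _ hm]
      rw [linD_apply, ← h1, M.linAt_map Ψ (by omega) (Φ.mem ((N.obj H).d_mem hm)), hx, map_zero,
        map_zero, map_zero]
  have hstep := fun (j : ℕ) (s : {κ // M.GoodUpTo (k + j) κ}) =>
    GoodUpTo.exists_succ M hex hk (Nat.le_add_right k j) (hinj _) s.2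
  let s : ∀ j, {κ // M.GoodUpTo (k + j) κ} := fun j => Nat.rec ⟨κ₀, hgood⟩
    (fun j s => ⟨(hstep j s).choose, (hstep j s).choose_spec.2⟩) j
  have hs : ∀ j, ∀ q ≤ k + j, (s (j + 1)).1 q = (s j).1 q := fun j =>
    (hstep j (s j)).choose_spec.1
  have hs' : ∀ i j, ∀ q ≤ k + j, (s (j + i)).1 q = (s j).1 q := by
    intro i
    induction i with
    | zero => intro j q _; rfl
    | succ i ih => intro j q hq; exact (hs (j + i) q (by omega)).trans (ih j q hq)
  -- From stage `j` on, the values in degrees up to `k + j` no longer change, so the diagonal is the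
  -- limit of the stages.
  let κ : ∀ p, M.X p ⟶ degreeSystem N p := fun p => (s p).1 p
  have hκ : ∀ j, ∀ q ≤ k + j, κ q = (s j).1 q := by
    intro j q hq
    rw [← hs' q j q hq, add_comm j q, hs' j q q (by omega)]
  let F := M.extend κ
  have hFs : ∀ H j p, p ≤ k + j → ∀ a ∈ (N.obj H).grading p,
      F.hom H a = (M.extend (s j).1).hom H a := fun H j p hp a ha =>
    M.extend_eq_of_le (hκ j) hp ha
  have hd : ∀ H p, ∀ a ∈ (N.obj H).grading p, (N.obj H).d (F.hom H a) =
      F.hom H ((N.obj H).d a) := by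
    intro H p a ha
    refine (M.free H).d_comm (m := p + 1) (fun p x => F.mem ((M.free H).mem p x)) ?_ (by omega) ha
    intro q hq x
    have hm := (M.free H).mem q x
    rw [hFs H (q + 1) q (by omega) _ hm, hFs H (q + 1) (q + 1) (by omega) _ ((N.obj H).d_mem hm)]
    exact (s (q + 1)).2.d_comm H q (by omega) x
  have hbij : ∀ H, Function.Bijective (F.hom H) := fun H =>
    (M.free H).bijective_of_lin _ (fun h => F.mem h) fun p => by
      have := (s p).2.bij H p (by omega)
      convert this using 2 with x
      exact congrArg (M.linAt H p) (M.extend_gen κ H p x)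
  obtain ⟨E, hE⟩ := F.exists_iso hd hbij
  refine ⟨E, fun H p hp a ha => ?_⟩
  rw [hE, hFs H 0 p (by omega) a ha]
  exact hext H a

end FreeModel

/-! ### Elementary extensions as diagrams -/

section Elementary

variable {G : Type u} [Group G]

namespace AlgNat

/-- The family underlying a morphism of diagrams. -/
def ofHom {N N' : DGADiagram G} (f : N ⟶ N') : AlgNat N N' where
  hom H := (f.app H).toAlgHom
  mem h := (f.app _).map_mem h
  nat g a := DFunLike.congr_fun (congrArg CDGA.Hom.toAlgHom (f.naturality g)) a

/-- Composition. -/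
def comp {N N' N'' : DGADiagram G} (F : AlgNat N N') (F' : AlgNat N' N'') : AlgNat N N'' where
  hom H := (F'.hom H).comp (F.hom H)
  mem h := F'.mem (F.mem h)
  nat f a := by
    rw [AlgHom.comp_apply, AlgHom.comp_apply, F.nat, F'.nat]

end AlgNat

theorem degVal_degreeMap {N N' : DGADiagram G} (f : N ⟶ N') {p : ℕ} {H : OrbitCat G}
    (x : (degreeSystem N p).obj H) :
    degVal ((degreeMap f p).app H x) = (f.app H).toAlgHom (degVal x) := rfl

namespace ElementaryData

variable {N : DGADiagram G} {V : VecSystem G} {n : ℕ} {γ γ' : CohomologySucc N V n}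
  (E : ElementaryData γ)

/-- The inclusion of the base. -/
def incl : AlgNat N E.extension where
  hom H := (E.level H).incl
  mem h := (E.level _).incl_mem h
  nat f a := ((E.levelMap f).toHom_incl a).symm

/-- The new generators. -/
def new (H : OrbitCat G) (i : ℕ) : (E.res.obj i).obj H →ₗ[ℚ] (E.extension.obj H).carrier :=
  (E.level H).new i

theorem new_mem (H : OrbitCat G) (i : ℕ) (v : (E.res.obj i).obj H) :
    E.new H i v ∈ (E.extension.obj H).grading (n + i) :=
  (E.level H).new_mem i v

theorem incl_d (H : OrbitCat G) (x : (N.obj H).carrier) :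
    E.incl.hom H ((N.obj H).d x) = (E.extension.obj H).d (E.incl.hom H x) :=
  (E.level H).incl_d x

theorem d_new (H : OrbitCat G) (i : ℕ) (v : (E.res.obj i).obj H) :
    (E.extension.obj H).d (E.new H i v) =
      (-1 : ℚ) ^ i • E.incl.hom H (degVal ((E.ext i).app H v)) +
        E.new H (i + 1) ((E.res.w i).app H v) :=
  (E.level H).d_new i v

theorem map_new {H K : OrbitCat G} (f : H ⟶ K) (i : ℕ) (v : (E.res.obj i).obj H) :
    (E.extension.map f).toAlgHom (E.new H i v) = E.new K i ((E.res.obj i).map f v) :=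
  (E.levelMap f).toHom_new i v

theorem degVal_inclBase {p : ℕ} {H : OrbitCat G} (x : (degreeSystem N p).obj H) :
    degVal ((E.inclBase p).app H x) = E.incl.hom H (degVal x) :=
  ((E.level H).incl_coe x).symm

theorem degVal_inclV {H : OrbitCat G} (v : V.obj H) :
    degVal ((E.inclV).app H v) = E.new H 0 (E.res.ι.app H v) := rfl

theorem hom_ext {H : OrbitCat G} {R : Type*} [Ring R] [Algebra ℚ R]
    {L L' : (E.extension.obj H).carrier →ₐ[ℚ] R}
    (base : ∀ x, L (E.incl.hom H x) = L' (E.incl.hom H x))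
    (new : ∀ i v, L (E.new H i v) = L' (E.new H i v)) : L = L' :=
  (E.level H).hom_ext base new

theorem exists_algNat {Q : DGADiagram G} (F : AlgNat N Q)
    (f : ∀ i, E.res.obj i ⟶ degreeSystem Q (n + i)) :
    ∃ L : AlgNat E.extension Q, (∀ H x, L.hom H (E.incl.hom H x) = F.hom H x) ∧
      ∀ H i v, L.hom H (E.new H i v) = degVal ((f i).app H v) := by
  have hL : ∀ H, ∃ L : (E.extension.obj H).carrier →ₐ[ℚ] (Q.obj H).carrier,
      (∀ x, L (E.incl.hom H x) = F.hom H x) ∧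
        ∀ i v, L (E.new H i v) = degVal ((f i).app H v) := fun H =>
    (E.level H).exists_hom (F.hom H) (fun i => degVal ∘ₗ ((f i).app H).hom)
      (fun p i x hx v => (Q.obj H).graded_comm (F.mem hx) (degVal_mem _))
      (fun i j v w => (Q.obj H).graded_comm (degVal_mem _) (degVal_mem _))
  choose L h1 h2 using hL
  refine ⟨⟨L, fun {H p a} ha => (E.level H).map_mem (B := Q.obj H) (fun p x hx => ?_)
    (fun i v => ?_) ha, fun {H K} f' a => ?_⟩, h1, h2⟩
  · exact (h1 H x).symm ▸ F.mem hx
  · exact (h2 H i v).symm ▸ degVal_mem _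
  · have : (L K).comp (E.extension.map f').toAlgHom = (Q.map f').toAlgHom.comp (L H) := by
      refine E.hom_ext (fun x => ?_) (fun i v => ?_)
      · rw [AlgHom.comp_apply, AlgHom.comp_apply, ← E.incl.nat, h1, h1, F.nat]
      · rw [AlgHom.comp_apply, AlgHom.comp_apply, E.map_new, h2, h2]
        exact degVal_naturality (f i) f' v
    exact DFunLike.congr_fun this a

theorem d_comm {Q : DGADiagram G} (L : AlgNat E.extension Q) (H : OrbitCat G)
    (base : ∀ x, (Q.obj H).d (L.hom H (E.incl.hom H x)) = L.hom H (E.incl.hom H ((N.obj H).d x)))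
    (new : ∀ i v, (Q.obj H).d (L.hom H (E.new H i v)) =
      L.hom H ((E.extension.obj H).d (E.new H i v))) (a : (E.extension.obj H).carrier) :
    (Q.obj H).d (L.hom H a) = L.hom H ((E.extension.obj H).d a) :=
  (E.level H).map_d (B := Q.obj H) (fun h => L.mem h)
    (fun _ x _ => (base x).trans (congrArg _ (E.incl_d H x))) new a

theorem exists_ret : ∃ L : AlgNat E.extension N, (∀ H x, L.hom H (E.incl.hom H x) = x) ∧
    ∀ H i v, L.hom H (E.new H i v) = 0 := by
  obtain ⟨L, h1, h2⟩ := E.exists_algNat (AlgNat.ofHom (𝟙 N)) (fun i => 0)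
  exact ⟨L, h1, h2⟩

/-- The retraction onto the base that kills the new generators. -/
noncomputable def ret : AlgNat E.extension N := E.exists_ret.choose

theorem ret_incl (H : OrbitCat G) (x : (N.obj H).carrier) : E.ret.hom H (E.incl.hom H x) = x :=
  E.exists_ret.choose_spec.1 H x

theorem incl_injective (H : OrbitCat G) : Function.Injective (E.incl.hom H) :=
  Function.LeftInverse.injective (E.ret_incl H)

theorem ret_new (H : OrbitCat G) (i : ℕ) (v : (E.res.obj i).obj H) :
    E.ret.hom H (E.new H i v) = 0 :=
  E.exists_ret.choose_spec.2 H i v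

theorem d_new_ι (H : OrbitCat G) (v : V.obj H) :
    (E.extension.obj H).d (E.new H 0 (E.res.ι.app H v)) =
      E.incl.hom H (degVal (E.α.1.app H v)) := by
  rw [E.d_new, (E.res.exact_zero H _).2 ⟨v, rfl⟩, VecSystem.apply_of_comp_eq E.ext_zero v, pow_zero,
    one_smul, map_zero, add_zero]

theorem d_α (H : OrbitCat G) (v : V.obj H) : (N.obj H).d (degVal (E.α.1.app H v)) = 0 :=
  congrArg degVal (VecSystem.apply_of_comp_eq E.α.2 v)

theorem d_ext (H : OrbitCat G) (i : ℕ) (v : (E.res.obj i).obj H) :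
    degVal ((E.ext (i + 1)).app H ((E.res.w i).app H v)) =
      (N.obj H).d (degVal ((E.ext i).app H v)) :=
  congrArg degVal (VecSystem.apply_of_comp_eq (E.ext_succ i) v)

/-- The equation in the definition of `ConditionC`, on elements. -/
theorem condition_iff (E' : ElementaryData γ') (κ : N ≅ N) (g : V ⟶ V) (β : V ⟶ degreeSystem N n) :
    E.α.1 ≫ degreeMap κ.hom (n + 1) ≫ E'.inclBase (n + 1) =
      (g ≫ E'.inclV + β ≫ E'.inclBase n) ≫ diffSystem E'.extension n ↔
    ∀ H v, E'.incl.hom H ((κ.hom.app H).toAlgHom (degVal (E.α.1.app H v))) =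
      (E'.extension.obj H).d (E'.new H 0 (E'.res.ι.app H (g.app H v)) +
        E'.incl.hom H (degVal (β.app H v))) := by
  have h1 : ∀ H v, degVal ((E.α.1 ≫ degreeMap κ.hom (n + 1) ≫ E'.inclBase (n + 1)).app H v) =
      E'.incl.hom H ((κ.hom.app H).toAlgHom (degVal (E.α.1.app H v))) := fun H v =>
    E'.degVal_inclBase _
  have h2 : ∀ H v, degVal (((g ≫ E'.inclV + β ≫ E'.inclBase n) ≫
      diffSystem E'.extension n).app H v) =
      (E'.extension.obj H).d (E'.new H 0 (E'.res.ι.app H (g.app H v)) +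
        E'.incl.hom H (degVal (β.app H v))) := fun H v => by
    rw [← E'.degVal_inclBase]
    rfl
  refine ⟨fun h H v => ?_, fun h => VecSystem.hom_ext fun H v => degVal_injective ?_⟩
  · rw [← h1, ← h2, h]
  · rw [h1, h2, h]

end ElementaryData

/-- Dependent choice, used for the lift of `g` and for the homotopy: there `P` is what makes the
next extension problem solvable and `R` is the equation that the next term solves. -/
theorem exists_seq {X : ℕ → Type*} (P : ∀ i, X i → Prop) (R : ∀ i, X i → X (i + 1) → Prop)
    (x₀ : X 0) (h₀ : P 0 x₀) (hs : ∀ i x, P i x → ∃ y, P (i + 1) y ∧ R i x y) :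
    ∃ s : ∀ i, X i, s 0 = x₀ ∧ (∀ i, P i (s i)) ∧ ∀ i, R i (s i) (s (i + 1)) := by
  let s : ∀ i, {x : X i // P i x} := fun i => Nat.rec ⟨x₀, h₀⟩
    (fun i x => ⟨(hs i x.1 x.2).choose, (hs i x.1 x.2).choose_spec.1⟩) i
  exact ⟨fun i => (s i).1, rfl, fun i => (s i).2, fun i => (hs i (s i).1 (s i).2).choose_spec.2⟩

/-! ### Comparison of minimal injective resolutions -/

namespace MinimalInjectiveResolution

variable {V : VecSystem G} (R R' : MinimalInjectiveResolution V)

/-- Minimality enters twice: `R.obj i` is essential over `ker w`, so `f` is injective; `R'.obj i` is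
essential over `ker w'`, which the image of `f` contains, so `f` is onto. -/
theorem bijective_of_ker {R R' : MinimalInjectiveResolution V} {i : ℕ} (f : R.obj i ⟶ R'.obj i)
    (h₁ : ∀ H u, (R.w i).app H u = 0 → f.app H u = 0 → u = 0)
    (h₂ : ∀ H v, (R'.w i).app H v = 0 → ∃ u, (R.w i).app H u = 0 ∧ f.app H u = v) :
    (∀ H, Function.Bijective (f.app H)) ∧
      ∀ H u, (R'.w i).app H (f.app H u) = 0 → (R.w i).app H u = 0 := by
  have hinj := R.essential i _ f h₁
  refine ⟨VecSystem.bijective_of_essential (R.injective i) f hinj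
    (fun H => {v | (R'.w i).app H v = 0}) (fun H v hv => ?_) (fun g hg => R'.essential i _ g hg),
    fun H u hu => ?_⟩
  · obtain ⟨u, -, rfl⟩ := h₂ H v hv
    exact ⟨u, rfl⟩
  · obtain ⟨u', hu', h⟩ := h₂ H _ hu
    rwa [← hinj H h]

/-- An automorphism lifts to an isomorphism of minimal injective resolutions. -/
theorem exists_lift (g : V ≅ V) : ∃ s : ∀ i, R.obj i ⟶ R'.obj i, R.ι ≫ s 0 = g.hom ≫ R'.ι ∧
    (∀ i H, Function.Bijective ((s i).app H)) ∧ ∀ i, R.w i ≫ s (i + 1) = s i ≫ R'.w i := by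
  have hg := VecSystem.bijective_of_isIso g.hom
  obtain ⟨g₀, hg₀⟩ := VecSystem.exists_extension (R'.injective 0) R.ι (g.hom ≫ R'.ι)
    (fun H y hy => by rw [(injective_iff_map_eq_zero _).1 (R.ι_injective H) y hy, map_zero])
  have hg₀' : ∀ H x, g₀.app H (R.ι.app H x) = R'.ι.app H (g.hom.app H x) := fun H x =>
    VecSystem.apply_of_comp_eq hg₀ x
  -- The invariant that `s_i` matches `ker w_i` with `ker w'_i` is what lets `s_i` followed by
  -- `w'_i` extend along `w_i`.
  obtain ⟨s, rfl, hs, hs'⟩ := exists_seq (X := fun i => R.obj i ⟶ R'.obj i)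
    (fun i f => (∀ H, Function.Bijective (f.app H)) ∧
      ∀ H u, (R'.w i).app H (f.app H u) = 0 ↔ (R.w i).app H u = 0)
    (fun i f f' => R.w i ≫ f' = f ≫ R'.w i) g₀ (by
      have h₁ : ∀ H u, (R.w 0).app H u = 0 → g₀.app H u = 0 → u = 0 := fun H u hu h0 => by
        obtain ⟨y, rfl⟩ := (R.exact_zero H _).1 hu
        rw [hg₀'] at h0
        rw [(injective_iff_map_eq_zero _).1 (hg H).1 y
          ((injective_iff_map_eq_zero _).1 (R'.ι_injective H) _ h0), map_zero]
      obtain ⟨h, h'⟩ := bijective_of_ker g₀ h₁ (fun H v hv => by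
        obtain ⟨y, rfl⟩ := (R'.exact_zero H _).1 hv
        obtain ⟨x, rfl⟩ := (hg H).2 y
        exact ⟨R.ι.app H x, (R.exact_zero H _).2 ⟨_, rfl⟩, hg₀' H x⟩)
      refine ⟨h, fun H u => ⟨h' H u, fun hu => ?_⟩⟩
      obtain ⟨y, rfl⟩ := (R.exact_zero H _).1 hu
      rw [hg₀']
      exact (R'.exact_zero H _).2 ⟨_, rfl⟩)
    (fun i f hf => by
      obtain ⟨f', hf'⟩ := VecSystem.exists_extension (R'.injective (i + 1)) (R.w i) (f ≫ R'.w i)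
        (fun H y hy => (hf.2 H y).2 hy)
      have hff : ∀ H x, f'.app H ((R.w i).app H x) = (R'.w i).app H (f.app H x) := fun H x =>
        VecSystem.apply_of_comp_eq hf' x
      have h₁ : ∀ H u, (R.w (i + 1)).app H u = 0 → f'.app H u = 0 → u = 0 := fun H u hu h0 => by
        obtain ⟨y, rfl⟩ := (R.exact_succ i H _).1 hu
        rw [hff] at h0
        exact (hf.2 H y).1 h0
      obtain ⟨h, h'⟩ := bijective_of_ker f' h₁ (fun H v hv => by
        obtain ⟨y, rfl⟩ := (R'.exact_succ i H _).1 hv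
        obtain ⟨x, rfl⟩ := (hf.1 H).2 y
        exact ⟨(R.w i).app H x, (R.exact_succ i H _).2 ⟨_, rfl⟩, hff H x⟩)
      refine ⟨f', ⟨h, fun H u => ⟨h' H u, fun hu => ?_⟩⟩, hf'⟩
      obtain ⟨y, rfl⟩ := (R.exact_succ i H _).1 hu
      rw [hff]
      exact (R'.exact_succ i H _).2 ⟨_, rfl⟩)
  exact ⟨s, hg₀, fun i => (hs i).1, hs'⟩

end MinimalInjectiveResolution

end Elementary

/-! ### From an equation to an isomorphism -/

section Classification

variable {G : Type u} [Group G]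

namespace ElementaryData

variable {N : DGADiagram G} {V : VecSystem G} {n : ℕ} {γ γ' : CohomologySucc N V n}

/-- A homotopy defined on `V` extends over the resolution. -/
theorem exists_homotopy (E : ElementaryData γ) (E' : ElementaryData γ')
    (hinj : ∀ p, Injective (degreeSystem N p)) (κ : N ⟶ N) (β : V ⟶ degreeSystem N n)
    (s : ∀ i, E.res.obj i ⟶ E'.res.obj i) (hs : ∀ i, E.res.w i ≫ s (i + 1) = s i ≫ E'.res.w i)
    (h : ∀ H v, (κ.app H).toAlgHom (degVal (E.α.1.app H v)) =
      degVal ((E'.ext 0).app H ((s 0).app H (E.res.ι.app H v))) +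
        (N.obj H).d (degVal (β.app H v))) :
    ∃ b : ∀ i, E.res.obj i ⟶ degreeSystem N (n + i), ∀ i H v,
      degVal ((b (i + 1)).app H ((E.res.w i).app H v)) = (N.obj H).d (degVal ((b i).app H v)) +
        (-1 : ℚ) ^ i • (degVal ((E'.ext i).app H ((s i).app H v)) -
          (κ.app H).toAlgHom (degVal ((E.ext i).app H v))) := by
  have hs' : ∀ i H x, (s (i + 1)).app H ((E.res.w i).app H x) =
      (E'.res.w i).app H ((s i).app H x) := fun i H x => VecSystem.apply_of_comp_eq (hs i) x
  let u : ∀ i, (E.res.obj i ⟶ degreeSystem N (n + i)) →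
      (E.res.obj i ⟶ degreeSystem N (n + (i + 1))) := fun i b =>
    b ≫ diffSystem N (n + i) +
      (-1 : ℚ) ^ i • (s i ≫ E'.ext i - E.ext i ≫ degreeMap κ (n + i + 1))
  have hu : ∀ i b H v, degVal ((u i b).app H v) = (N.obj H).d (degVal (b.app H v)) +
      (-1 : ℚ) ^ i • (degVal ((E'.ext i).app H ((s i).app H v)) -
        (κ.app H).toAlgHom (degVal ((E.ext i).app H v))) := fun _ _ _ _ => rfl
  obtain ⟨b₀, hb₀⟩ := VecSystem.exists_extension (hinj n) E.res.ι β
    (fun H y hy => by rw [(injective_iff_map_eq_zero _).1 (E.res.ι_injective H) y hy, map_zero])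
  -- The next term must extend `u i b` along `w_i`, so `u i b` has to vanish on `ker w_i`. For `i =
  -- 0` this kernel is `V` and the vanishing is the hypothesis; afterwards the kernel is the image
  -- of the previous `w`, and the alternating sign makes the two contributions cancel.
  obtain ⟨b, -, -, hb⟩ := exists_seq (X := fun i => E.res.obj i ⟶ degreeSystem N (n + i))
    (fun i b => ∀ H v, (E.res.w i).app H v = 0 → (u i b).app H v = 0)
    (fun i b b' => E.res.w i ≫ b' = u i b) b₀ (fun H v hv => by
      obtain ⟨y, rfl⟩ := (E.res.exact_zero H _).1 hv
      apply degVal_injective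
      rw [hu, VecSystem.apply_of_comp_eq hb₀ y, VecSystem.apply_of_comp_eq E.ext_zero y, h,
        pow_zero, one_smul, sub_add_cancel_left, add_neg_cancel]
      rfl) (fun i b hbi => by
      obtain ⟨b', hb'⟩ := VecSystem.exists_extension (hinj (n + (i + 1))) (E.res.w i) (u i b) hbi
      refine ⟨b', fun H v hv => ?_, hb'⟩
      obtain ⟨y, rfl⟩ := (E.res.exact_succ i H _).1 hv
      apply degVal_injective
      rw [hu, VecSystem.apply_of_comp_eq hb' y, hu, hs', E.d_ext, E'.d_ext, map_add,
        (N.obj H).d_d, zero_add, map_smul, map_sub, CDGA.Hom.map_d, pow_succ, mul_neg_one, neg_smul,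
        add_neg_cancel]
      rfl)
  exact ⟨b, fun i H v => (congrArg degVal (VecSystem.apply_of_comp_eq (hb i) v)).trans (hu i _ H v)⟩

/-- The isomorphism `L` is `κ` on `N` and `s_i + b_i` on `V_i`. Such a triangular map has an
explicit inverse `K`, which is `κ⁻¹` on `N` and sends `s_i v` to `v - κ⁻¹ b_i v`; the homotopy
equation for the `b_i` is compatibility with `d` on generators. -/
theorem nonempty_iso_of_eq (E : ElementaryData γ) (E' : ElementaryData γ')
    (hinj : ∀ p, Injective (degreeSystem N p)) (κ : N ≅ N) (g : V ≅ V) (β : V ⟶ degreeSystem N n)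
    (h : ∀ H v, E'.incl.hom H ((κ.hom.app H).toAlgHom (degVal (E.α.1.app H v))) =
      (E'.extension.obj H).d (E'.new H 0 (E'.res.ι.app H (g.hom.app H v)) +
        E'.incl.hom H (degVal (β.app H v)))) :
    Nonempty (E.extension ≅ E'.extension) := by
  obtain ⟨s, hs0, hsb, hs⟩ := E.res.exists_lift E'.res g
  have hs' : ∀ i H x, (s (i + 1)).app H ((E.res.w i).app H x) =
      (E'.res.w i).app H ((s i).app H x) := fun i H x => VecSystem.apply_of_comp_eq (hs i) x
  obtain ⟨b, hb⟩ := E.exists_homotopy E' hinj κ.hom β s hs (fun H v => by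
    apply E'.incl_injective H
    rw [h, map_add, E'.d_new_ι, ← E'.incl_d, map_add, VecSystem.apply_of_comp_eq hs0 v,
      VecSystem.comp_apply, VecSystem.apply_of_comp_eq E'.ext_zero])
  have hsiso : ∀ i, IsIso (s i) := fun i => VecSystem.isIso_of_bijective _ (hsb i)
  obtain ⟨L, hL, hL'⟩ := E.exists_algNat ((AlgNat.ofHom κ.hom).comp E'.incl)
    (fun i => s i ≫ E'.inclGen i + b i ≫ E'.inclBase (n + i))
  obtain ⟨K, hK, hK'⟩ := E'.exists_algNat ((AlgNat.ofHom κ.inv).comp E.incl)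
    (fun i => inv (s i) ≫ (E.inclGen i - b i ≫ degreeMap κ.inv (n + i) ≫ E.inclBase (n + i)))
  have hLi : ∀ H x, L.hom H (E.incl.hom H x) = E'.incl.hom H ((κ.hom.app H).toAlgHom x) := hL
  have hKi : ∀ H x, K.hom H (E'.incl.hom H x) = E.incl.hom H ((κ.inv.app H).toAlgHom x) := hK
  have hLn : ∀ H i v, L.hom H (E.new H i v) = E'.new H i ((s i).app H v) +
      E'.incl.hom H (degVal ((b i).app H v)) := fun H i v => by
    rw [hL', ← E'.degVal_inclBase]; rfl
  have hKn : ∀ H i v, K.hom H (E'.new H i ((s i).app H v)) = E.new H i v -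
      E.incl.hom H ((κ.inv.app H).toAlgHom (degVal ((b i).app H v))) := fun H i v => by
    rw [hK', VecSystem.comp_apply, VecSystem.apply_of_comp_eq (IsIso.hom_inv_id (s i)) v,
      ← degVal_degreeMap, ← E.degVal_inclBase]
    rfl
  have hκ₁ : ∀ H x, (κ.inv.app H).toAlgHom ((κ.hom.app H).toAlgHom x) = x := fun H x =>
    CDGA.hom_inv_apply (κ.app H) x
  have hκ₂ : ∀ H x, (κ.hom.app H).toAlgHom ((κ.inv.app H).toAlgHom x) = x := fun H x =>
    CDGA.inv_hom_apply (κ.app H) x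
  have hKL : ∀ H, (K.hom H).comp (L.hom H) = AlgHom.id ℚ _ := fun H => by
    refine E.hom_ext (fun x => ?_) (fun i v => ?_)
    · rw [AlgHom.comp_apply, hLi, hKi, hκ₁]; rfl
    · rw [AlgHom.comp_apply, hLn, map_add, hKn, hKi, sub_add_cancel]; rfl
  have hLK : ∀ H, (L.hom H).comp (K.hom H) = AlgHom.id ℚ _ := fun H => by
    refine E'.hom_ext (fun x => ?_) (fun i v => ?_)
    · rw [AlgHom.comp_apply, hKi, hLi, hκ₂]; rfl
    · obtain ⟨v, rfl⟩ := (hsb i H).2 v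
      rw [AlgHom.comp_apply, hKn, map_sub, hLn, hLi, hκ₂, add_sub_cancel_right]; rfl
  have hd : ∀ H a, (E'.extension.obj H).d (L.hom H a) = L.hom H ((E.extension.obj H).d a) := by
    refine fun H => E.d_comm L H (fun x => ?_) (fun i v => ?_)
    · rw [hLi, hLi, CDGA.Hom.map_d, E'.incl_d]
    · rw [hLn, map_add, E'.d_new, ← E'.incl_d, E.d_new, map_add, map_smul, hLi, hLn, hb, hs',
        map_add, map_smul, map_sub, smul_sub]
      abel
  obtain ⟨e, -⟩ := L.exists_iso (fun H _ a _ => hd H a)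
    (fun H => Function.bijective_iff_has_inverse.2 ⟨K.hom H, fun a => DFunLike.congr_fun (hKL H) a,
      fun a => DFunLike.congr_fun (hLK H) a⟩)
  exact ⟨e⟩

end ElementaryData

end Classification

/-! ### From an isomorphism to an equation -/

namespace CDGA

/-- Two algebra maps that agree below degree `p` agree on decomposables of degree `p + 1`. -/
theorem FreeOn.eq_of_mem_dec_succ {A : CDGA.{u}} {W : ℕ → Type u} [∀ p, AddCommGroup (W p)]
    [∀ p, Module ℚ (W p)] {σ : ∀ p, W p →ₗ[ℚ] A.carrier} (hA : A.FreeOn W σ) {R : Type*} [Ring R]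
    [Algebra ℚ R] {F F' : A.carrier →ₐ[ℚ] R} {p : ℕ}
    (h : ∀ q < p, ∀ a ∈ A.grading q, F a = F' a) {a : A.carrier} (ha : a ∈ A.dec (p + 1)) :
    F a = F' a := by
  have : A.dec (p + 1) ≤ LinearMap.eqLocus F.toLinearMap F'.toLinearMap := by
    refine Submodule.span_le.2 ?_
    rintro _ ⟨i, j, a, b, hi, hj, hij, ha, hb, rfl⟩
    change F (a * b) = F' (a * b)
    -- A factor of degree `1` is zero. Otherwise both factors have degree at least `2`, hence at
    -- most `p - 1`, which gains one degree over the general statement for decomposables.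
    rcases eq_or_lt_of_le hi with rfl | hi'
    · rw [hA.grading_one ha, zero_mul, map_zero, map_zero]
    rcases eq_or_lt_of_le hj with rfl | hj'
    · rw [hA.grading_one hb, mul_zero, map_zero, map_zero]
    rw [map_mul, map_mul, h i (by omega) a ha, h j (by omega) b hb]
  exact this ha

theorem ExactAbove.exists_sub_d_mem_dec {A : CDGA.{u}} {n : ℕ} (hA : A.ExactAbove (n - 1))
    (hn : 1 ≤ n) {y : A.carrier} (hy : y ∈ A.grading n) (hdy : A.d y ∈ A.dec (n + 1)) :
    ∃ z ∈ A.grading (n - 1), y - A.d z ∈ A.dec n := by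
  obtain ⟨m, rfl⟩ := Nat.exists_eq_add_of_le' hn
  exact hA m le_rfl y hy hdy

end CDGA

section Classification

variable {G : Type u} [Group G]

theorem VecSystem.exists_factor {X Y Z : VecSystem G} (j : Y ⟶ Z)
    (hj : ∀ H, Function.Injective (j.app H)) (k : X ⟶ Z) (h : ∀ H x, ∃ y, j.app H y = k.app H x) :
    ∃ g : X ⟶ Y, ∀ H x, j.app H (g.app H x) = k.app H x := by
  choose g hg using h
  exact ⟨VecSystem.mkHom (fun H =>
    { toFun := g H
      map_add' := fun x y => hj H (by rw [map_add, hg, hg, hg, map_add])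
      map_smul' := fun c x => hj H (by rw [RingHom.id_apply, map_smul, hg, hg, map_smul]) })
    (fun {H K} f x => hj K (by
      change j.app K (g K (X.map f x)) = j.app K (Y.map f (g H x))
      rw [hg, map_apply_comm, map_apply_comm, hg])), hg⟩

namespace ElementaryData

variable {N : DGADiagram G} {V : VecSystem G} {n : ℕ} {γ γ' : CohomologySucc N V n}

section Degree

variable (E : ElementaryData γ)

theorem incl_ret_of_lt (M : FreeModel N) (hn : 2 ≤ n) {p : ℕ} (hp : p < n) {H : OrbitCat G}
    {a : (E.extension.obj H).carrier} (ha : a ∈ (E.extension.obj H).grading p) :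
    E.incl.hom H (E.ret.hom H a) = a := by
  obtain ⟨b, -, hb⟩ := (E.level H).exists_incl_of_lt (M.free H) hn hp ha
  have hb' : E.incl.hom H b = a := hb
  rw [← hb', E.ret_incl]

theorem exists_incl_add_new (M : FreeModel N) (hn : 2 ≤ n) {H : OrbitCat G}
    {a : (E.extension.obj H).carrier} (ha : a ∈ (E.extension.obj H).grading n) :
    ∃ b ∈ (N.obj H).grading n, ∃ v, E.incl.hom H b + E.new H 0 v = a :=
  (E.level H).exists_incl_add_new (M.free H) hn ha

theorem incl_add_new_inj (M : FreeModel N) (hn : 2 ≤ n) {H : OrbitCat G} {i : ℕ}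
    {b b' : (N.obj H).carrier} {v v' : (E.res.obj i).obj H}
    (h : E.incl.hom H b + E.new H i v = E.incl.hom H b' + E.new H i v') : b = b' ∧ v = v' :=
  (E.level H).incl_add_new_inj (M.free H) hn h

/-- An element of degree `n` whose differential lies in the base is the sum of elements of the base
and of `V`. -/
theorem exists_incl_add_new_ι (M : FreeModel N) (hn : 2 ≤ n) {H : OrbitCat G}
    {a : (E.extension.obj H).carrier} (ha : a ∈ (E.extension.obj H).grading n)
    {c : (N.obj H).carrier} (hc : (E.extension.obj H).d a = E.incl.hom H c) :
    ∃ b ∈ (N.obj H).grading n, ∃ v, E.incl.hom H b + E.new H 0 (E.res.ι.app H v) = a ∧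
      (N.obj H).d b + degVal (E.α.1.app H v) = c := by
  obtain ⟨b, hb, v₀, rfl⟩ := E.exists_incl_add_new M hn ha
  have hv₀ : (E.res.w 0).app H v₀ = 0 := by
    rw [map_add, E.d_new, pow_zero, one_smul, ← E.incl_d, ← add_assoc, ← map_add] at hc
    refine (E.incl_add_new_inj M hn (b' := c) (v' := 0) (hc.trans ?_)).2
    rw [map_zero, add_zero]
  obtain ⟨v, rfl⟩ := (E.res.exact_zero H _).1 hv₀
  refine ⟨b, hb, v, rfl, E.incl_injective H ?_⟩
  rw [← hc, map_add, map_add, E.d_new_ι, E.incl_d]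

theorem exists_α_sub_d_mem_dec (hex : ∀ H, (N.obj H).ExactAbove (n - 1)) (H : OrbitCat G)
    (v : V.obj H) : ∃ z ∈ (N.obj H).grading n,
      degVal (E.α.1.app H v) - (N.obj H).d z ∈ (N.obj H).dec (n + 1) :=
  hex H n (Nat.sub_le n 1) _ (degVal_mem _) (by rw [E.d_α]; exact zero_mem _)

theorem inclV_injective (M : FreeModel N) (hn : 2 ≤ n) (H : OrbitCat G) :
    Function.Injective (E.inclV.app H) := by
  intro v v' h
  have h' := congrArg degVal h
  rw [degVal_inclV, degVal_inclV] at h'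
  exact E.res.ι_injective H (E.incl_add_new_inj M hn (b := 0) (b' := 0)
    (congrArg (E.incl.hom H 0 + ·) h')).2

end Degree

/-- The map induced on the base by a morphism of elementary extensions. -/
noncomputable def baseMap (E : ElementaryData γ) (E' : ElementaryData γ')
    (φ : E.extension ⟶ E'.extension) : AlgNat N N :=
  (E.incl.comp (AlgNat.ofHom φ)).comp E'.ret

theorem baseMap_apply (E : ElementaryData γ) (E' : ElementaryData γ')
    (φ : E.extension ⟶ E'.extension) (H : OrbitCat G) (a : (N.obj H).carrier) :
    (E.baseMap E' φ).hom H a = E'.ret.hom H ((φ.app H).toAlgHom (E.incl.hom H a)) := rfl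

/-- Below degree `n` the target extension is its base, so the retraction loses nothing. In degree
`n` the value of `φ` may involve `V_0`, which is why `baseMap` is controlled only in lower degrees.
-/
theorem incl_baseMap (E : ElementaryData γ) (E' : ElementaryData γ')
    (φ : E.extension ⟶ E'.extension) (M : FreeModel N) (hn : 2 ≤ n) {p : ℕ} (hp : p < n)
    {H : OrbitCat G} {a : (N.obj H).carrier} (ha : a ∈ (N.obj H).grading p) :
    E'.incl.hom H ((E.baseMap E' φ).hom H a) = (φ.app H).toAlgHom (E.incl.hom H a) :=
  E'.incl_ret_of_lt M hn hp ((φ.app H).map_mem (E.incl.mem ha))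

theorem d_baseMap (E : ElementaryData γ) (E' : ElementaryData γ')
    (φ : E.extension ⟶ E'.extension) (M : FreeModel N) (hn : 2 ≤ n) {p : ℕ} (hp : p < n)
    {H : OrbitCat G} {a : (N.obj H).carrier} (ha : a ∈ (N.obj H).grading p) :
    (N.obj H).d ((E.baseMap E' φ).hom H a) = (E.baseMap E' φ).hom H ((N.obj H).d a) := by
  rw [E.baseMap_apply E' φ H ((N.obj H).d a), E.incl_d, CDGA.Hom.map_d,
    ← E.incl_baseMap E' φ M hn hp ha, ← E'.incl_d, E'.ret_incl]

theorem baseMap_baseMap (E : ElementaryData γ) (E' : ElementaryData γ')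
    (φ : E.extension ≅ E'.extension) (M : FreeModel N) (hn : 2 ≤ n) {p : ℕ} (hp : p < n)
    {H : OrbitCat G} {a : (N.obj H).carrier} (ha : a ∈ (N.obj H).grading p) :
    (E'.baseMap E φ.inv).hom H ((E.baseMap E' φ.hom).hom H a) = a := by
  rw [E'.baseMap_apply, E.incl_baseMap E' φ.hom M hn hp ha]
  have := CDGA.hom_inv_apply (φ.app H) (E.incl.hom H a)
  exact (congrArg _ this).trans (E.ret_incl H a)

/-- An isomorphism of elementary extensions agrees with an automorphism of the base in low
degrees. -/
theorem exists_base_automorphism (E : ElementaryData γ) (E' : ElementaryData γ')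
    (φ : E.extension ≅ E'.extension) (M : FreeModel N) (hn : 2 ≤ n)
    (hex : ∀ H, (N.obj H).ExactAbove (n - 1)) (hinj : ∀ p, Injective (degreeSystem N p)) :
    ∃ κ : N ≅ N, ∀ H, ∀ p < n, ∀ a ∈ (N.obj H).grading p,
      (φ.hom.app H).toAlgHom (E.incl.hom H a) = E'.incl.hom H ((κ.hom.app H).toAlgHom a) := by
  obtain ⟨κ, hκ⟩ := M.exists_automorphism hex (by omega) hinj (E.baseMap E' φ.hom)
    (E'.baseMap E φ.inv) (fun H p hp a ha => E.d_baseMap E' φ.hom M hn (by omega) ha)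
    (fun H p hp a ha => E'.d_baseMap E φ.inv M hn (by omega) ha)
    (fun H p hp a ha => E'.baseMap_baseMap E φ.symm M hn (by omega) ha)
    (fun H p hp a ha => E.baseMap_baseMap E' φ M hn (by omega) ha)
  refine ⟨κ, fun H p hp a ha => ?_⟩
  rw [hκ H p (by omega) a ha, E.incl_baseMap E' φ.hom M hn hp ha]

/-- The restriction of `φ` to `V` cannot be used directly, because `φ` and `κ` may differ on `N^n`
and on `α`. The difference is controlled by `z` with `α(v) - dz` decomposable, and adding `F'(z) -
F(z)` turns the differential `F(α v)` into `F'(α v)`. -/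
theorem exists_eq_of_iso (E : ElementaryData γ) (E' : ElementaryData γ')
    (φ : E.extension ≅ E'.extension) (M : FreeModel N) (hn : 2 ≤ n)
    (hex : ∀ H, (N.obj H).ExactAbove (n - 1)) (hinj : ∀ p, Injective (degreeSystem N p)) :
    ∃ (κ : N ≅ N) (g : V ≅ V) (β : V ⟶ degreeSystem N n), ∀ H v,
      E'.incl.hom H ((κ.hom.app H).toAlgHom (degVal (E.α.1.app H v))) =
        (E'.extension.obj H).d (E'.new H 0 (E'.res.ι.app H (g.hom.app H v)) +
          E'.incl.hom H (degVal (β.app H v))) := by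
  obtain ⟨κ, hκ⟩ := E.exists_base_automorphism E' φ M hn hex hinj
  have hκ₁ : ∀ H x, (κ.inv.app H).toAlgHom ((κ.hom.app H).toAlgHom x) = x := fun H x =>
    CDGA.hom_inv_apply (κ.app H) x
  have hκ₂ : ∀ H x, (κ.hom.app H).toAlgHom ((κ.inv.app H).toAlgHom x) = x := fun H x =>
    CDGA.inv_hom_apply (κ.app H) x
  have hφ₁ : ∀ H x, (φ.inv.app H).toAlgHom ((φ.hom.app H).toAlgHom x) = x := fun H x =>
    CDGA.hom_inv_apply (φ.app H) x
  have hφ₂ : ∀ H x, (φ.hom.app H).toAlgHom ((φ.inv.app H).toAlgHom x) = x := fun H x =>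
    CDGA.inv_hom_apply (φ.app H) x
  let F : AlgNat N E'.extension := E.incl.comp (AlgNat.ofHom φ.hom)
  let F' : AlgNat N E'.extension := (AlgNat.ofHom κ.hom).comp E'.incl
  have hF : ∀ H x, F.hom H x = (φ.hom.app H).toAlgHom (E.incl.hom H x) := fun _ _ => rfl
  have hF' : ∀ H x, F'.hom H x = E'.incl.hom H ((κ.hom.app H).toAlgHom x) := fun _ _ => rfl
  have hlow : ∀ H, ∀ p < n, ∀ a ∈ (N.obj H).grading p, F.hom H a = F'.hom H a := hκ
  have hFd : ∀ H x, F.hom H ((N.obj H).d x) = (E'.extension.obj H).d (F.hom H x) := fun H x => by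
    rw [hF, hF, E.incl_d, CDGA.Hom.map_d]
  have hFd' : ∀ H x, F'.hom H ((N.obj H).d x) = (E'.extension.obj H).d (F'.hom H x) :=
    fun H x => by rw [hF', hF', CDGA.Hom.map_d, E'.incl_d]
  have hdec : ∀ H, ∀ a ∈ (N.obj H).dec (n + 1), F.hom H a = F'.hom H a := fun H a ha =>
    (M.free H).eq_of_mem_dec_succ (hlow H) ha
  -- By exactness `y` is a boundary plus a decomposable. The primitive has degree `n - 1` and the
  -- factors have degree below `n`, so `F` and `F'` agree on both parts.
  have hcl : ∀ H, ∀ y ∈ (N.obj H).grading n, (N.obj H).d y ∈ (N.obj H).dec (n + 1) →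
      F.hom H y = F'.hom H y := fun H y hy hdy => by
    obtain ⟨z, hz, h⟩ := (hex H).exists_sub_d_mem_dec (by omega) hy hdy
    have h1 := CDGA.eq_of_mem_dec (hlow H) h
    rw [map_sub, map_sub, hFd, hFd', hlow H _ (by omega) z hz] at h1
    exact sub_left_injective h1
  have hD : ∀ H a, ∀ y ∈ (N.obj H).grading n, ∀ z ∈ (N.obj H).grading n,
      a - (N.obj H).d y ∈ (N.obj H).dec (n + 1) → a - (N.obj H).d z ∈ (N.obj H).dec (n + 1) →
      F'.hom H y - F.hom H y = F'.hom H z - F.hom H z := fun H a y hy z hz h1 h2 => by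
    have h := hcl H (y - z) (sub_mem hy hz) (by
      have := sub_mem h2 h1
      rwa [sub_sub_sub_cancel_left, ← map_sub] at this)
    rw [map_sub, map_sub] at h
    rw [sub_eq_sub_iff_sub_eq_sub, h]
  choose z hz hz' using fun H v => E.exists_α_sub_d_mem_dec hex H v
  -- The `z H v` are chosen with no linearity or naturality. By `hD` the correction is the same for
  -- every admissible choice, so sums, multiples and images of chosen elements may be used instead,
  -- and `h₀` is linear and natural.
  let h₀ : ∀ H, V.obj H → (E'.extension.obj H).carrier := fun H v =>
    (φ.hom.app H).toAlgHom (E.new H 0 (E.res.ι.app H v)) +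
      (F'.hom H (z H v) - F.hom H (z H v))
  have hh₀ : ∀ H v, ∀ y ∈ (N.obj H).grading n,
      degVal (E.α.1.app H v) - (N.obj H).d y ∈ (N.obj H).dec (n + 1) →
      h₀ H v = (φ.hom.app H).toAlgHom (E.new H 0 (E.res.ι.app H v)) +
        (F'.hom H y - F.hom H y) := fun H v y hy h1 => by
    rw [← hD H _ _ (hz H v) y hy (hz' H v) h1]
  let h : V ⟶ degreeSystem E'.extension n := toDegree
    (fun H =>
      { toFun := h₀ H
        map_add' := fun v w => by
          rw [hh₀ H (v + w) (z H v + z H w) (add_mem (hz H v) (hz H w)) (by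
            rw [map_add, map_add, map_add, add_sub_add_comm]
            exact add_mem (hz' H v) (hz' H w))]
          simp only [h₀, map_add]
          abel
        map_smul' := fun c v => by
          rw [hh₀ H (c • v) (c • z H v) (Submodule.smul_mem _ c (hz H v)) (by
            rw [map_smul, map_smul, map_smul, ← smul_sub]
            exact Submodule.smul_mem _ c (hz' H v))]
          simp only [h₀, map_smul, smul_add, smul_sub, RingHom.id_apply] })
    (fun H v => add_mem ((φ.hom.app H).map_mem (E.new_mem H 0 _))
      (sub_mem (F'.mem (hz H v)) (F.mem (hz H v))))
    (fun {H K} f v => by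
      change h₀ K (V.map f v) = (E'.extension.map f).toAlgHom (h₀ H v)
      rw [hh₀ K (V.map f v) ((N.map f).toAlgHom (z H v)) ((N.map f).map_mem (hz H v)) (by
        rw [degVal_naturality, ← CDGA.Hom.map_d, ← map_sub]
        exact CDGA.map_dec _ (fun h => (N.map f).map_mem h) (hz' H v)), map_add, map_sub, F.nat,
        F'.nat, VecSystem.map_apply_comm, ← E.map_new]
      congr 1
      exact (AlgNat.ofHom φ.hom).nat f _)
  have hh : ∀ H v, ∀ y ∈ (N.obj H).grading n,
      degVal (E.α.1.app H v) - (N.obj H).d y ∈ (N.obj H).dec (n + 1) →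
      degVal (h.app H v) = (φ.hom.app H).toAlgHom (E.new H 0 (E.res.ι.app H v)) +
        (F'.hom H y - F.hom H y) := hh₀
  have hdh : ∀ H v, (E'.extension.obj H).d (degVal (h.app H v)) =
      F'.hom H (degVal (E.α.1.app H v)) := fun H v => by
    have h1 := hdec H _ (hz' H v)
    rw [map_sub, map_sub] at h1
    rw [hh H v _ (hz H v) (hz' H v), map_add, map_sub, ← CDGA.Hom.map_d, E.d_new_ι, ← hF, ← hFd,
      ← hFd', sub_eq_iff_eq_add.1 h1]
    abel
  let β : V ⟶ degreeSystem N n := toDegree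
    (fun H => (E'.ret.hom H).toLinearMap ∘ₗ degVal ∘ₗ (h.app H).hom)
    (fun H v => E'.ret.mem (degVal_mem _)) (fun {H K} f v => by
      change E'.ret.hom K (degVal (h.app K (V.map f v))) =
        (N.map f).toAlgHom (E'.ret.hom H (degVal (h.app H v)))
      rw [degVal_naturality, E'.ret.nat])
  have hβ : ∀ H v, degVal (β.app H v) = E'.ret.hom H (degVal (h.app H v)) := fun _ _ => rfl
  obtain ⟨g, hg⟩ := VecSystem.exists_factor E'.inclV (E'.inclV_injective M hn)
    (h - β ≫ E'.inclBase n) (fun H v => by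
      obtain ⟨b, -, y, hby, -⟩ := E'.exists_incl_add_new_ι M hn (degVal_mem (h.app H v)) (hdh H v)
      refine ⟨y, degVal_injective ?_⟩
      rw [VecSystem.sub_apply, VecSystem.comp_apply, map_sub, E'.degVal_inclBase, hβ, ← hby,
        map_add, E'.ret_incl, E'.ret_new, add_zero, add_sub_cancel_left]
      rfl)
  have hg' : ∀ H v, E'.incl.hom H (degVal (β.app H v)) + E'.new H 0 (E'.res.ι.app H (g.app H v)) =
      degVal (h.app H v) := fun H v => by
    have := congrArg degVal (hg H v)
    rw [VecSystem.sub_apply, VecSystem.comp_apply, map_sub, E'.degVal_inclBase,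
      E'.degVal_inclV] at this
    rw [this, add_sub_cancel]
  have hbij : ∀ H, Function.Bijective (g.app H) := fun H => by
    refine ⟨VecSystem.injective_app_of_ker g H fun v hv => ?_, fun y => ?_⟩
    · have h1 := hg' H v
      rw [hv, map_zero, map_zero, add_zero, hh H v _ (hz H v) (hz' H v)] at h1
      -- If `g v = 0`, then `F' b = φ(v) - F z`, and comparing differentials gives `d b = α(v) -
      -- dz`, which is decomposable. Hence `F b = F' b`, so `φ(v) = φ(b + z)`: the vector `v` of `V`
      -- equals an element of the base, and is zero.
      set b := (κ.inv.app H).toAlgHom (degVal (β.app H v)) - z H v with hb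
      have hFb : F'.hom H b = (φ.hom.app H).toAlgHom (E.new H 0 (E.res.ι.app H v)) -
          F.hom H (z H v) := by
        rw [hb, map_sub, hF' H ((κ.inv.app H).toAlgHom _), hκ₂, h1]
        abel
      have hdb : (N.obj H).d b = degVal (E.α.1.app H v) - (N.obj H).d (z H v) := by
        have h2 : F'.hom H ((N.obj H).d b) =
            F'.hom H (degVal (E.α.1.app H v) - (N.obj H).d (z H v)) := by
          rw [← hdec H _ (hz' H v), hFd', hFb, map_sub, ← CDGA.Hom.map_d, E.d_new_ι, map_sub, hFd,
            hF H (degVal _)]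
        rw [hF', hF'] at h2
        exact Function.LeftInverse.injective (hκ₁ H) (E'.incl_injective H h2)
      have hb' : b ∈ (N.obj H).grading n :=
        sub_mem ((κ.inv.app H).map_mem (degVal_mem _)) (hz H v)
      have h3 := hcl H b hb' (hdb ▸ hz' H v)
      rw [hFb, eq_sub_iff_add_eq, ← map_add, hF] at h3
      have h4 := Function.LeftInverse.injective (hφ₁ H) h3
      have h5 := (E.incl_add_new_inj M hn (b := b + z H v) (b' := 0) (v := 0)
        (v' := E.res.ι.app H v) (by rw [h4, map_zero, map_zero, add_zero, zero_add])).2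
      exact (injective_iff_map_eq_zero _).1 (E.res.ι_injective H) v h5.symm
    · obtain ⟨z', hz₁, hz₂⟩ := E'.exists_α_sub_d_mem_dec hex H y
      -- `c` is decomposable, so `φ` and `κ` agree on it. Hence `φ⁻¹(y - z')` has differential `c`
      -- in the base and splits as `b + v` with `d b + α(v) = c`. Thus `-b` is an admissible choice
      -- for `v`, giving `h(v) = y - z' - κ b`, whose component in `V` is `y`.
      set c := (κ.inv.app H).toAlgHom (degVal (E'.α.1.app H y) - (N.obj H).d z') with hc
      have hcd : c ∈ (N.obj H).dec (n + 1) :=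
        CDGA.map_dec _ (fun h => (κ.inv.app H).map_mem h) hz₂
      have hFc : (φ.hom.app H).toAlgHom (E.incl.hom H c) =
          E'.incl.hom H (degVal (E'.α.1.app H y) - (N.obj H).d z') := by
        rw [← hF, hdec H c hcd, hF', hc, hκ₂]
      obtain ⟨b, hb, v, hbv, hbc⟩ := E.exists_incl_add_new_ι M hn (c := c)
        (a := (φ.inv.app H).toAlgHom (E'.new H 0 (E'.res.ι.app H y) - E'.incl.hom H z'))
        ((φ.inv.app H).map_mem (sub_mem (E'.new_mem H 0 _) (E'.incl.mem hz₁))) (by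
          rw [← CDGA.Hom.map_d, map_sub, E'.d_new_ι, ← E'.incl_d, ← map_sub, ← hFc, hφ₁])
      have h1 := congrArg (φ.hom.app H).toAlgHom hbv
      rw [hφ₂, map_add, ← hF] at h1
      have h2 := hh H v (-b) (neg_mem hb) (by
        rwa [map_neg, sub_neg_eq_add, add_comm (degVal _), hbc])
      refine ⟨v, E'.res.ι_injective H (E'.incl_add_new_inj M hn
        (b' := -(κ.hom.app H).toAlgHom b - z') ((hg' H v).trans ?_)).2⟩
      rw [h2, map_neg, map_neg, map_sub, map_neg, ← hF', eq_sub_iff_add_eq'.2 h1]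
      abel
  have : IsIso g := VecSystem.isIso_of_bijective g hbij
  refine ⟨κ, asIso g, β, fun H v => ?_⟩
  rw [asIso_hom, add_comm (E'.new H 0 _), hg', hdh, hF']

end ElementaryData

end Classification

theorem mainTheorem4 {G : Type u} [Group G] [Finite G] (n : ℕ) (hn : 2 ≤ n)
    (N : DGADiagram G) (hN : IsMinimalStage (n - 1) N) (V : VecSystem G)
    (γ γ' : CohomologySucc N V n) (E : ElementaryData γ) (E' : ElementaryData γ') :
    ¬ ConditionC E E' ↔ Nonempty (E.extension ≅ E'.extension) := by
  obtain ⟨⟨M⟩, hex⟩ := hN.exists_freeModel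
  have hinj := M.degree_injective
  rw [ConditionC, not_not]
  constructor
  · rintro ⟨κ, g, β, h⟩
    exact E.nonempty_iso_of_eq E' hinj κ g β ((E.condition_iff E' κ g.hom β).1 h)
  · rintro ⟨φ⟩
    obtain ⟨κ, g, β, h⟩ := E.exists_eq_of_iso E' φ M hn hex hinj
    exact ⟨κ, g, β, (E.condition_iff E' κ g.hom β).2 h⟩
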